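/- \textbf{Setting.} Fix a many-sorted first-order signature $\Sigma$ of function symbols, with equality $\approx$ as the only predicate, such that every sort has a ground term, and countably many variables of each sort; substitutions are sort-preserving and move finitely many variables. Literals are equations $s\approx t$ or disequations $s\not\approx t$ (unordered pairs), clauses are finite multisets of literals, and $\square$ is the empty clause. Program terms are the terms (\emph{simple} program terms) and the expressions $\mathsf{ite}(l\approx r,p,q)$ with terms $l,r$ and program terms $p,q$. An answer clause $C\lfloor p\rfloor$ is a clause $C$ with a program term $p$, its answer; substitutions act on both. Let $\Lambda=\langle\Sigma_c,\forall\bar x\,\exists y.\,F[\bar x,y]\rangle$ be a specification: $\Sigma_c\subseteq\Sigma$ and a closed formula. An expression is \emph{computable} if all its function symbols are in $\Sigma_c$. Let $\{C_1,\dots,C_m\}=\mathrm{cnf}(\neg F[\bar\alpha,y])$ be a clausal normal form, where $\bar\alpha$ are fresh computable Skolem constants, $y$ is kept as a free variable, and further fresh Skolem symbols of $\Sigma$ may occur. The \emph{initial set} is $\{C_1\lfloor y\rfloor,\dots,C_m\lfloor y\rfloor\}$. Let $\succ$ be a simplification order on terms (a well-founded strict order closed under substitutions and contexts, total on ground terms)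 that is \emph{partitioned}: every ground uncomputable term is greater than every ground computable term. (An example is a lexicographic path order in which every uncomputable symbol has higher precedence than every computable one.) It is extended to literals by the bag extension, with $s\approx t$ viewed as $\{s,t\}$ and $s\not\approx t$ as $\{s,s,t,t\}$, and to clauses by the bag extension again; answer clauses are compared by their clauses. \textbf{Calculus.} The rules are the following; underlined literals are the maximal literals of their clauses, and two premises share no variables. In the superposition rules $l'$ is a non-variable term that occurs in $s$, $s[r]$ is $s$ with all occurrences of $l'$ replaced by $r$, $r\sigma\not\succeq l\sigma$ and $t\sigma\not\succeq s[l']\sigma$, and $\bowtie$ is $\approx$ or $\not\approx$. \begin{itemize} \item ($\mathsf{Sup}_C$) from $(\underline{l\approx r}\lor C)\lfloor p\rfloor$ and $(\underline{s[l']\bowtie t}\lor D)\lfloor q\rfloor$ infer $(s[r]\bowtie t\lor C\lor D)\lfloor\mathsf{ite}(l\approx r,q,p)\rfloor\sigma$, where $\sigma=\mathrm{mgu}(l,l')$ and $\mathsf{ite}(l\approx r,q,p)\sigma$ is computable. \item ($\mathsf{Sup}_U$) from the same premises infer $(s[r]\bowtie t\lor C\lor D)\lfloor p\rfloor\sigma$,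 where $\sigma=\mathrm{mgu}((l,p),(l',q))$ and $p\sigma$ is a computable simple term. \item ($\mathsf{EqRes}$) from $(\underline{s\not\approx t}\lor C)\lfloor p\rfloor$ infer $C\lfloor p\rfloor\sigma$, where $\sigma=\mathrm{mgu}(s,t)$ and $p\sigma$ is computable. \item ($\mathsf{EqFac}$) from $(\underline{s\approx t}\lor l\approx r\lor C)\lfloor p\rfloor$ infer $(s\approx t\lor t\not\approx r\lor C)\lfloor p\rfloor\sigma$, where $\sigma=\mathrm{mgu}(s,l)$, $t\sigma\not\succeq s\sigma$, $r\sigma\not\succ t\sigma$, and $p\sigma$ is computable. \end{itemize} The abstraction rule ($\mathsf{Abs}$) replaces $(\underline{s[k]\bowtie t}\lor C)\lfloor p\rfloor$ by $(s[x]\bowtie t\lor x\not\approx k\lor C)\lfloor p\rfloor$, where $k$ is a non-variable term occurring in $s$ (all its occurrences in $s$ being replaced), $x$ is a fresh variable, $s\not\preceq t$, some substitution $\theta$ makes $s[k]\theta$ uncomputable and $k\theta$ computable, and no proper superterm of $k$ in $s[k]$ has the latter property. \textbf{Saturation.} For a set $S$ of answer clauses let $N$ be the set of all ground instances of its members. Whether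 a clause ``follows'' from others is judged by first-order consequence between the clauses, ignoring the answers. An answer clause is redundant w.r.t.\ $S$ if each of its ground instances follows from smaller members of $N$. An inference $\mathcal A_1,\dots,\mathcal A_n\vdash\mathcal D$ with mgu $\sigma$ is redundant w.r.t.\ $S$ if for every $\theta$ grounding $\mathcal A_1\sigma,\dots,\mathcal A_n\sigma$ and $\mathcal D$, either $\mathcal D\theta\succ\mathcal A_i\sigma\theta$ for all $i$, or $\mathcal D\theta$ follows from $\{C\in N\mid \mathcal A_i\sigma\theta\succ C\text{ for some }i\}$. Let $S$ be a set of answer clauses \emph{saturated up to redundancy from $\Lambda$ and abstracted}: every member of $S$ is derivable (up to renaming) from the initial set by the rules above including $\mathsf{Abs}$; every initial answer clause is transformed by finitely many (possibly zero) applications of $\mathsf{Abs}$ into an answer clause that is, up to renaming, in $S$ or is redundant w.r.t.\ $S$; every inference by $\mathsf{Sup}_C,\mathsf{Sup}_U,\mathsf{EqRes},\mathsf{EqFac}$ from (variants of) non-redundant members of $S$ is redundant w.r.t.\ $S$; and $\mathsf{Abs}$ applies to no member of $S$. \textbf{Computable grounding.} A c-clause $C\lfloor\!\lfloor\mathcal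 L\rfloor\!\rfloor$ is a clause $C$ with a list $\mathcal L$ of literals, standing for $C\lor\bigvee_{L\in\mathcal L}L$. For a clause $C$ and a program term $t$ of the sort of $y$, let $\mathrm{iteNF}(C,t)$ be the set of c-clauses defined as follows: if $y$ occurs in $C$ and $t=\mathsf{ite}(L,s_1,s_2)$, it consists of all $D\lfloor\!\lfloor\hat L,\mathcal L\rfloor\!\rfloor$ with $D\lfloor\!\lfloor\mathcal L\rfloor\!\rfloor\in\mathrm{iteNF}(C,s_1)$ and all $D\lfloor\!\lfloor L,\mathcal L\rfloor\!\rfloor$ with $D\lfloor\!\lfloor\mathcal L\rfloor\!\rfloor\in\mathrm{iteNF}(C,s_2)$, where $\hat L$ is the complement of $L$; otherwise it is $\{C\{y\mapsto t\}\lfloor\!\lfloor\,\rfloor\!\rfloor\}$. The set $\mathrm{CGr}(S)$ consists of all computable ground instances of c-clauses in $\mathrm{iteNF}(C_i,t)$, for all $i$ and all $t$, and of all computable ground c-clauses $C\theta\lfloor\!\lfloor\,\rfloor\!\rfloor$ with $C\lfloor p\rfloor\in S$. \textbf{Model.} Conditions are ordered by: $\mathcal L\succ[\,]$ for $\mathcal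 L$ non-empty; $(L,\mathcal L)\succ(K,\mathcal K)$ if $L\succ K$, or $L=K$ and $\mathcal L\succ\mathcal K$. Put $C\lfloor\!\lfloor\mathcal L\rfloor\!\rfloor\succ D\lfloor\!\lfloor\mathcal K\rfloor\!\rfloor$ if $C\succ D$, or $C=D$ and $\mathcal L\succ\mathcal K$. A ground equation is true in a rewrite system $R$ if its two sides have a common normal form in $R$; a ground disequation is true if the equation is not; a clause or c-clause is true if one of its literals is. For a set $G$ of ground c-clauses, let $R_G^{\prec\mathcal C}$ be the set of rules produced by those $\mathcal D\in G$ with $\mathcal D\prec\mathcal C$. A c-clause $\mathcal C\in G$ of the form $(l\approx r\lor C)\lfloor\!\lfloor\mathcal L\rfloor\!\rfloor$ produces $l\to r$ if $\mathcal L$ is computable; $l\approx r\lor C$ is false in $R_G^{\prec\mathcal C}$; if $l\approx r\lor C$ is uncomputable, all literals of $\mathcal L$ are false in $R_G^{\prec\mathcal C}$; $l\approx r$ is strictly maximal in $l\approx r\lor C$; $l\succ r$; $C$ is false in $R_G^{\prec\mathcal C}\cup\{l\to r\}$; and $l$ is irreducible in $R_G^{\prec\mathcal C}$. Let $R_G$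 be the set of all rules produced by members of $G$. \textbf{Lemma.} Suppose that $\square\lfloor p\rfloor\notin S$ for every computable program term $p$. Then for $G=\mathrm{CGr}(S)$ the recursion above is well-defined (exactly one assignment of sets of produced rules to the members of $G$ satisfies it), and $R_{\mathrm{CGr}(S)}\models\mathcal C$ for all $\mathcal C\in\mathrm{CGr}(S)$. -/

import Mathlib

/-!
Many-sorted first-order clauses with answers, the superposition calculus for synthesis with its
abstraction rule, saturation up to redundancy, and the rewrite model of a set of ground
conditional clauses.
-/

namespace Synth

/-! ### Signatures, terms, substitutions -/

/-- A many-sorted signature of function symbols. -/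
structure Signature where
  Srt : Type
  Sym : Type
  arity : Sym → ℕ
  dom : (f : Sym) → Fin (arity f) → Srt
  cod : Sym → Srt

/-- Variables: countably many of each sort. -/
structure Var (Sg : Signature) where
  sort : Sg.Srt
  idx : ℕ

/-- Terms respecting arities; sorts are imposed by `Term.WS`. -/
inductive Term (Sg : Signature) : Type
  | var (x : Var Sg) : Term Sg
  | app (f : Sg.Sym) (ts : Fin (Sg.arity f) → Term Sg) : Term Sg

variable {Sg : Signature}

namespace Term

def sort : Term Sg → Sg.Srt
  | var x => x.sort
  | app f _ => Sg.cod f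

/-- Well-sorted terms. -/
def WS : Term Sg → Prop
  | var _ => True
  | app f ts => ∀ i, (ts i).WS ∧ (ts i).sort = Sg.dom f i

def vars : Term Sg → Set (Var Sg)
  | var x => {x}
  | app _ ts => {x | ∃ i, x ∈ (ts i).vars}

def syms : Term Sg → Set Sg.Sym
  | var _ => ∅
  | app f ts => {g | g = f ∨ ∃ i, g ∈ (ts i).syms}

def Ground (t : Term Sg) : Prop := t.vars = ∅

/-- No uncomputable symbol occurs (`comp` is the set of computable symbols). -/
def Computable (comp : Set Sg.Sym) (t : Term Sg) : Prop := t.syms ⊆ comp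

def IsVar (t : Term Sg) : Prop := ∃ x, t = var x

def subst (σ : Var Sg → Term Sg) : Term Sg → Term Sg
  | var x => σ x
  | app f ts => app f fun i => (ts i).subst σ

/-- `Subterm k s`: the term `k` occurs in `s` (possibly `k = s`). -/
inductive Subterm (k : Term Sg) : Term Sg → Prop
  | refl : Subterm k k
  | arg (f : Sg.Sym) (ts : Fin (Sg.arity f) → Term Sg) (i : Fin (Sg.arity f)) :
      Subterm k (ts i) → Subterm k (app f ts)

open Classical in
/-- `s.replace k u`: replace all occurrences of `k` in `s` by `u`. -/
noncomputable def replace : (s k u : Term Sg) → Term Sg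
  | var x, k, u => if var x = k then u else var x
  | app f ts, k, u => if app f ts = k then u else app f fun i => (ts i).replace k u

end Term

/-- A substitution: sort-preserving, and the identity on all but finitely many variables. -/
def IsSubst (σ : Var Sg → Term Sg) : Prop :=
  (∀ x, (σ x).WS ∧ (σ x).sort = x.sort) ∧ {x | σ x ≠ Term.var x}.Finite

/-- `σ` is a most general element of the set of substitutions satisfying `U`. -/
def IsMGU (U : (Var Sg → Term Sg) → Prop) (σ : Var Sg → Term Sg) : Prop :=
  IsSubst σ ∧ U σ ∧
    ∀ θ, IsSubst θ → U θ → ∃ τ, IsSubst τ ∧ ∀ x, θ x = (σ x).subst τ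

open Classical in
/-- The substitution `{x ↦ t}`. -/
noncomputable def single (x : Var Sg) (t : Term Sg) : Var Sg → Term Sg :=
  Function.update Term.var x t

/-! ### Literals, clauses, program terms, answer clauses, conditional clauses -/

/-- An equation (`pos = true`) or disequation (`pos = false`) between an unordered pair of
terms. -/
structure Literal (Sg : Signature) where
  pos : Bool
  atom : Sym2 (Term Sg)

namespace Literal

def mk' (b : Bool) (s t : Term Sg) : Literal Sg := ⟨b, s(s, t)⟩

def eq (s t : Term Sg) : Literal Sg := ⟨true, s(s, t)⟩

def neq (s t : Term Sg) : Literal Sg := ⟨false, s(s, t)⟩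

/-- The complementary literal. -/
def compl (L : Literal Sg) : Literal Sg := ⟨!L.pos, L.atom⟩

def subst (σ : Var Sg → Term Sg) (L : Literal Sg) : Literal Sg :=
  ⟨L.pos, L.atom.map (Term.subst σ)⟩

def vars (L : Literal Sg) : Set (Var Sg) := {x | ∃ t ∈ L.atom, x ∈ t.vars}

def Ground (L : Literal Sg) : Prop := L.vars = ∅

def Computable (comp : Set Sg.Sym) (L : Literal Sg) : Prop := ∀ t ∈ L.atom, t.Computable comp

def WS (L : Literal Sg) : Prop :=
  (∀ t ∈ L.atom, t.WS) ∧ ∀ s ∈ L.atom, ∀ t ∈ L.atom, s.sort = t.sort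

/-- The bag `{s, t}` of `s ≈ t`, and the bag `{s, s, t, t}` of `s ≉ t`. -/
def bag (L : Literal Sg) : Multiset (Term Sg) :=
  if L.pos then Sym2.lift ⟨fun s t => ({s, t} : Multiset (Term Sg)), Multiset.pair_comm⟩ L.atom
  else Sym2.lift ⟨fun s t => ({s, t} : Multiset (Term Sg)) + {s, t}, fun s t => by
    simp only [Multiset.pair_comm s t]⟩ L.atom

end Literal

/-- Clauses are finite multisets of literals; the empty clause is `0`. -/
abbrev Clause (Sg : Signature) := Multiset (Literal Sg)

namespace Clause

def subst (σ : Var Sg → Term Sg) (C : Clause Sg) : Clause Sg := C.map (Literal.subst σ)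

def vars (C : Clause Sg) : Set (Var Sg) := {x | ∃ L ∈ C, x ∈ L.vars}

def Ground (C : Clause Sg) : Prop := vars C = ∅

def Computable (comp : Set Sg.Sym) (C : Clause Sg) : Prop := ∀ L ∈ C, L.Computable comp

def WS (C : Clause Sg) : Prop := ∀ L ∈ C, L.WS

end Clause

/-- Program terms: simple terms, and `if l ≈ r then p else q`, where `c` is the unordered pair
of the sides `l`, `r` of the condition. -/
inductive Prog (Sg : Signature) : Type
  | term (t : Term Sg) : Prog Sg
  | ite (c : Sym2 (Term Sg)) (p q : Prog Sg) : Prog Sg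

namespace Prog

def subst (σ : Var Sg → Term Sg) : Prog Sg → Prog Sg
  | term t => term (t.subst σ)
  | ite c p q => ite (c.map (Term.subst σ)) (p.subst σ) (q.subst σ)

def vars : Prog Sg → Set (Var Sg)
  | term t => t.vars
  | ite c p q => {x | ∃ t ∈ c, x ∈ t.vars} ∪ p.vars ∪ q.vars

def Computable (comp : Set Sg.Sym) : Prog Sg → Prop
  | term t => t.Computable comp
  | ite c p q => (∀ t ∈ c, t.Computable comp) ∧ p.Computable comp ∧ q.Computable comp

def IsSimple (p : Prog Sg) : Prop := ∃ t, p = term t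

/-- `p` is a well-sorted program term of sort `a`. -/
def HasSort (a : Sg.Srt) : Prog Sg → Prop
  | term t => t.WS ∧ t.sort = a
  | ite c p q => (⟨true, c⟩ : Literal Sg).WS ∧ p.HasSort a ∧ q.HasSort a

end Prog

/-- An answer clause: a clause together with its answer. -/
structure AnsClause (Sg : Signature) where
  clause : Clause Sg
  ans : Prog Sg

namespace AnsClause

def subst (σ : Var Sg → Term Sg) (A : AnsClause Sg) : AnsClause Sg :=
  ⟨Clause.subst σ A.clause, A.ans.subst σ⟩

def vars (A : AnsClause Sg) : Set (Var Sg) := Clause.vars A.clause ∪ A.ans.vars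

def Ground (A : AnsClause Sg) : Prop := A.vars = ∅

/-- `A` and `B` are equal up to renaming of variables: each is an instance of the other. -/
def Variant (A B : AnsClause Sg) : Prop :=
  (∃ ρ, IsSubst ρ ∧ B = A.subst ρ) ∧ ∃ ρ, IsSubst ρ ∧ A = B.subst ρ

end AnsClause

/-- A conditional clause: a clause together with a list of literals, its condition; it stands for
the disjunction of all these literals. -/
structure CClause (Sg : Signature) where
  clause : Clause Sg
  cond : List (Literal Sg)

namespace CClause

def subst (σ : Var Sg → Term Sg) (K : CClause Sg) : CClause Sg :=
  ⟨Clause.subst σ K.clause, K.cond.map (Literal.subst σ)⟩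

def Ground (K : CClause Sg) : Prop := Clause.Ground K.clause ∧ ∀ L ∈ K.cond, L.Ground

def Computable (comp : Set Sg.Sym) (K : CClause Sg) : Prop :=
  Clause.Computable comp K.clause ∧ ∀ L ∈ K.cond, L.Computable comp

end CClause

/-! ### First-order semantics -/

/-- A many-sorted structure. The domains of the sorts are non-empty subsets of one type; function
symbols respect the sorts, and their values on other arguments never matter. -/
structure Interp (Sg : Signature) where
  U : Type
  dom : Sg.Srt → Set U
  dom_nonempty : ∀ a, (dom a).Nonempty
  fn : (f : Sg.Sym) → (Fin (Sg.arity f) → U) → U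
  fn_mem : ∀ f us, (∀ i, us i ∈ dom (Sg.dom f i)) → fn f us ∈ dom (Sg.cod f)

namespace Interp

/-- Sort-respecting assignments. -/
def Assignment (M : Interp Sg) (v : Var Sg → M.U) : Prop := ∀ x, v x ∈ M.dom x.sort

def eval (M : Interp Sg) (v : Var Sg → M.U) : Term Sg → M.U
  | .var x => v x
  | .app f ts => M.fn f fun i => M.eval v (ts i)

def HoldsLit (M : Interp Sg) (v : Var Sg → M.U) (L : Literal Sg) : Prop :=
  if L.pos then (L.atom.map (M.eval v)).IsDiag else ¬ (L.atom.map (M.eval v)).IsDiag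

def HoldsClause (M : Interp Sg) (v : Var Sg → M.U) (C : Clause Sg) : Prop :=
  ∃ L ∈ C, M.HoldsLit v L

/-- The universal closure of `C` is true in `M`. -/
def SatClause (M : Interp Sg) (C : Clause Sg) : Prop :=
  ∀ v, M.Assignment v → M.HoldsClause v C

end Interp

/-- `C` follows from the set of clauses `Γ`. -/
def Entails (Γ : Set (Clause Sg)) (C : Clause Sg) : Prop :=
  ∀ M : Interp Sg, (∀ D ∈ Γ, M.SatClause D) → M.SatClause C

/-- First-order formulas with equality. -/
inductive Formula (Sg : Signature) : Type
  | eq (s t : Term Sg) : Formula Sg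
  | neg (F : Formula Sg) : Formula Sg
  | and (F G : Formula Sg) : Formula Sg
  | or (F G : Formula Sg) : Formula Sg
  | imp (F G : Formula Sg) : Formula Sg
  | all (x : Var Sg) (F : Formula Sg) : Formula Sg
  | ex (x : Var Sg) (F : Formula Sg) : Formula Sg

namespace Formula

def freeVars : Formula Sg → Set (Var Sg)
  | eq s t => s.vars ∪ t.vars
  | neg F => F.freeVars
  | and F G => F.freeVars ∪ G.freeVars
  | or F G => F.freeVars ∪ G.freeVars
  | imp F G => F.freeVars ∪ G.freeVars
  | all x F => F.freeVars \ {x}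
  | ex x F => F.freeVars \ {x}

def syms : Formula Sg → Set Sg.Sym
  | eq s t => s.syms ∪ t.syms
  | neg F => F.syms
  | and F G => F.syms ∪ G.syms
  | or F G => F.syms ∪ G.syms
  | imp F G => F.syms ∪ G.syms
  | all _ F => F.syms
  | ex _ F => F.syms

def WS : Formula Sg → Prop
  | eq s t => s.WS ∧ t.WS ∧ s.sort = t.sort
  | neg F => F.WS
  | and F G => F.WS ∧ G.WS
  | or F G => F.WS ∧ G.WS
  | imp F G => F.WS ∧ G.WS
  | all _ F => F.WS
  | ex _ F => F.WS

open Classical in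
def Holds (M : Interp Sg) : (Var Sg → M.U) → Formula Sg → Prop
  | v, eq s t => M.eval v s = M.eval v t
  | v, neg F => ¬ Holds M v F
  | v, and F G => Holds M v F ∧ Holds M v G
  | v, or F G => Holds M v F ∨ Holds M v G
  | v, imp F G => Holds M v F → Holds M v G
  | v, all x F => ∀ d ∈ M.dom x.sort, Holds M (Function.update v x d) F
  | v, ex x F => ∃ d ∈ M.dom x.sort, Holds M (Function.update v x d) F

end Formula

/-! ### Synthesis specifications and their initial sets -/

/-- A synthesis specification: the computable symbols, and a closed formula
`∀ xs. ∃ y. F`. -/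
structure Specification (Sg : Signature) where
  comp : Set Sg.Sym
  xs : List (Var Sg)
  xs_nodup : xs.Nodup
  y : Var Sg
  y_not_mem : y ∉ xs
  F : Formula Sg
  ws : F.WS
  closed : F.freeVars ⊆ {z | z ∈ xs ∨ z = y}

/-- The result of negating, skolemizing and clausifying a specification: computable Skolem
constants `α x` for the inputs `x`, further fresh Skolem symbols `sk`, and a finite set of clauses
`clauses` which is a clausal normal form of `¬ F[α, y]` with `y` as a free variable. -/
structure ClausalForm (Λ : Specification Sg) where
  α : Var Sg → Sg.Sym
  α_arity : ∀ x ∈ Λ.xs, Sg.arity (α x) = 0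
  α_sort : ∀ x ∈ Λ.xs, Sg.cod (α x) = x.sort
  α_inj : ∀ x ∈ Λ.xs, ∀ x' ∈ Λ.xs, α x = α x' → x = x'
  α_comp : ∀ x ∈ Λ.xs, α x ∈ Λ.comp
  α_fresh : ∀ x ∈ Λ.xs, α x ∉ Λ.F.syms
  sk : Set Sg.Sym
  sk_fresh : ∀ f ∈ sk, f ∉ Λ.F.syms ∧ ∀ x ∈ Λ.xs, f ≠ α x
  clauses : Set (Clause Sg)
  finite : clauses.Finite
  ws : ∀ C ∈ clauses, Clause.WS C
  /-- For every value of `y`, the clauses imply `¬ F[α, y]`. -/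
  sound : ∀ (M : Interp Sg) (v : Var Sg → M.U), M.Assignment v →
    (∀ x ∈ Λ.xs, ∀ us, v x = M.fn (α x) us) →
    (∀ w, M.Assignment w → w Λ.y = v Λ.y → ∀ C ∈ clauses, M.HoldsClause w C) →
    ¬ Formula.Holds M v Λ.F
  /-- In every structure the Skolem symbols can be reinterpreted so that, for every value of `y`,
  `¬ F[α, y]` implies the clauses. -/
  complete : ∀ M : Interp Sg, ∃ (fn' : (f : Sg.Sym) → (Fin (Sg.arity f) → M.U) → M.U)
    (fn'_mem : ∀ f us, (∀ i, us i ∈ M.dom (Sg.dom f i)) → fn' f us ∈ M.dom (Sg.cod f)),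
    (∀ f, f ∉ sk → fn' f = M.fn f) ∧
    ∀ v, M.Assignment v → (∀ x ∈ Λ.xs, ∀ us, v x = M.fn (α x) us) →
      ¬ Formula.Holds M v Λ.F →
      ∀ w, M.Assignment w → w Λ.y = v Λ.y → ∀ C ∈ clauses,
        Interp.HoldsClause ⟨M.U, M.dom, M.dom_nonempty, fn', fn'_mem⟩ w C

/-- The initial set: every clause of the clausal form, with the answer `y`. -/
def ClausalForm.initial {Λ : Specification Sg} (N : ClausalForm Λ) : Set (AnsClause Sg) :=
  {A | ∃ C ∈ N.clauses, A = ⟨C, .term (.var Λ.y)⟩}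

/-! ### Orderings -/

/-- A simplification order: a well-founded strict order on terms, closed under substitutions and
contexts, and total on ground terms. -/
structure IsSimplificationOrder (gt : Term Sg → Term Sg → Prop) : Prop where
  trans : ∀ s t u, gt s t → gt t u → gt s u
  wf : WellFounded fun s t => gt t s
  subst : ∀ s t σ, IsSubst σ → gt s t → gt (s.subst σ) (t.subst σ)
  context : ∀ (f : Sg.Sym) (ts : Fin (Sg.arity f) → Term Sg) i s t, gt s t →
    gt (.app f (Function.update ts i s)) (.app f (Function.update ts i t))
  total : ∀ s t : Term Sg, s.Ground → t.Ground → s ≠ t → gt s t ∨ gt t s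

/-- Ground uncomputable terms are greater than ground computable terms. -/
def IsPartitioned (comp : Set Sg.Sym) (gt : Term Sg → Term Sg → Prop) : Prop :=
  ∀ s t : Term Sg, s.Ground → t.Ground → ¬ s.Computable comp → t.Computable comp → gt s t

/-- The bag extension: the transitive closure of replacing one element by finitely many smaller
ones. -/
def BagGt {α : Type} (gt : α → α → Prop) (X Y : Multiset α) : Prop :=
  Relation.TransGen (Relation.CutExpand fun a b => gt b a) Y X

def LitGt (gt : Term Sg → Term Sg → Prop) (L K : Literal Sg) : Prop := BagGt gt L.bag K.bag

def ClauseGt (gt : Term Sg → Term Sg → Prop) (C D : Clause Sg) : Prop := BagGt (LitGt gt) C D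

/-- The ordering on conditions. -/
inductive CondGt (gt : Term Sg → Term Sg → Prop) : List (Literal Sg) → List (Literal Sg) → Prop
  | nil (L : Literal Sg) (l : List (Literal Sg)) : CondGt gt (L :: l) []
  | head (L K : Literal Sg) (l k : List (Literal Sg)) : LitGt gt L K → CondGt gt (L :: l) (K :: k)
  | tail (L : Literal Sg) (l k : List (Literal Sg)) : CondGt gt l k → CondGt gt (L :: l) (L :: k)

/-- The ordering on conditional clauses. -/
def CGt (gt : Term Sg → Term Sg → Prop) (K K' : CClause Sg) : Prop :=
  ClauseGt gt K.clause K'.clause ∨ (K.clause = K'.clause ∧ CondGt gt K.cond K'.cond)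

/-- The literal `L` is maximal, hence selected, in the clause `L ∨ C`. -/
def Selected (gt : Term Sg → Term Sg → Prop) (L : Literal Sg) (C : Clause Sg) : Prop :=
  ∀ K ∈ C, ¬ LitGt gt K L

/-- The literal `L` is strictly maximal in the clause `L ∨ C`. -/
def StrictlyMaximal (gt : Term Sg → Term Sg → Prop) (L : Literal Sg) (C : Clause Sg) : Prop :=
  ∀ K ∈ C, ¬ (LitGt gt K L ∨ K = L)

/-! ### The calculus -/

/-- `Inference gt comp Ps σ A`: the answer clause `A` is inferred from the list of premises `Ps`
with the most general unifier `σ`. -/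
inductive Inference (gt : Term Sg → Term Sg → Prop) (comp : Set Sg.Sym) :
    List (AnsClause Sg) → (Var Sg → Term Sg) → AnsClause Sg → Prop
  | supC (l r s t l' : Term Sg) (b : Bool) (C D : Clause Sg) (p q : Prog Sg)
      (σ : Var Sg → Term Sg)
      (disj : Disjoint (AnsClause.vars ⟨.eq l r ::ₘ C, p⟩)
        (AnsClause.vars ⟨.mk' b s t ::ₘ D, q⟩))
      (sel₁ : Selected gt (.eq l r) C) (sel₂ : Selected gt (.mk' b s t) D)
      (occ : l'.Subterm s)
      (mgu : IsMGU (fun τ => l.subst τ = l'.subst τ) σ)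
      (nonvar : ¬ l'.IsVar)
      (ord₁ : ¬ (gt (r.subst σ) (l.subst σ) ∨ r.subst σ = l.subst σ))
      (ord₂ : ¬ (gt (t.subst σ) (s.subst σ) ∨ t.subst σ = s.subst σ))
      (hcomp : ((Prog.ite s(l, r) q p).subst σ).Computable comp) :
      Inference gt comp [⟨.eq l r ::ₘ C, p⟩, ⟨.mk' b s t ::ₘ D, q⟩] σ
        (AnsClause.subst σ ⟨.mk' b (s.replace l' r) t ::ₘ (C + D), .ite s(l, r) q p⟩)
  | supU (l r s t l' : Term Sg) (b : Bool) (C D : Clause Sg) (p q : Prog Sg)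
      (σ : Var Sg → Term Sg)
      (disj : Disjoint (AnsClause.vars ⟨.eq l r ::ₘ C, p⟩)
        (AnsClause.vars ⟨.mk' b s t ::ₘ D, q⟩))
      (sel₁ : Selected gt (.eq l r) C) (sel₂ : Selected gt (.mk' b s t) D)
      (occ : l'.Subterm s)
      (mgu : IsMGU (fun τ => l.subst τ = l'.subst τ ∧ p.subst τ = q.subst τ) σ)
      (nonvar : ¬ l'.IsVar)
      (ord₁ : ¬ (gt (r.subst σ) (l.subst σ) ∨ r.subst σ = l.subst σ))
      (ord₂ : ¬ (gt (t.subst σ) (s.subst σ) ∨ t.subst σ = s.subst σ))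
      (hcomp : (p.subst σ).Computable comp) (simple : (p.subst σ).IsSimple) :
      Inference gt comp [⟨.eq l r ::ₘ C, p⟩, ⟨.mk' b s t ::ₘ D, q⟩] σ
        (AnsClause.subst σ ⟨.mk' b (s.replace l' r) t ::ₘ (C + D), p⟩)
  | eqRes (s t : Term Sg) (C : Clause Sg) (p : Prog Sg) (σ : Var Sg → Term Sg)
      (sel : Selected gt (.neq s t) C)
      (mgu : IsMGU (fun τ => s.subst τ = t.subst τ) σ)
      (hcomp : (p.subst σ).Computable comp) :
      Inference gt comp [⟨.neq s t ::ₘ C, p⟩] σ (AnsClause.subst σ ⟨C, p⟩)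
  | eqFac (s t l r : Term Sg) (C : Clause Sg) (p : Prog Sg) (σ : Var Sg → Term Sg)
      (sel : Selected gt (.eq s t) (.eq l r ::ₘ C))
      (mgu : IsMGU (fun τ => s.subst τ = l.subst τ) σ)
      (ord₁ : ¬ (gt (t.subst σ) (s.subst σ) ∨ t.subst σ = s.subst σ))
      (ord₂ : ¬ gt (r.subst σ) (t.subst σ))
      (hcomp : (p.subst σ).Computable comp) :
      Inference gt comp [⟨.eq s t ::ₘ .eq l r ::ₘ C, p⟩] σ
        (AnsClause.subst σ ⟨.eq s t ::ₘ .neq t r ::ₘ C, p⟩)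

/-- Some instance of `k` is computable while the corresponding instance of `s` is not. -/
def Separable (comp : Set Sg.Sym) (s k : Term Sg) : Prop :=
  ∃ θ, IsSubst θ ∧ ¬ (s.subst θ).Computable comp ∧ (k.subst θ).Computable comp

/-- The abstraction rule, which replaces the answer clause `A` by `B`. -/
inductive Abs (gt : Term Sg → Term Sg → Prop) (comp : Set Sg.Sym) :
    AnsClause Sg → AnsClause Sg → Prop
  | mk (s t k : Term Sg) (b : Bool) (C : Clause Sg) (p : Prog Sg) (x : Var Sg)
      (sel : Selected gt (.mk' b s t) C)
      (occ : k.Subterm s)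
      (ord : ¬ (gt t s ∨ s = t))
      (sep : Separable comp s k)
      (outermost : ∀ k' : Term Sg, k.Subterm k' → k' ≠ k → k'.Subterm s → ¬ Separable comp s k')
      (nonvar : ¬ k.IsVar)
      (fresh : x ∉ AnsClause.vars ⟨.mk' b s t ::ₘ C, p⟩) (hsort : x.sort = k.sort) :
      Abs gt comp ⟨.mk' b s t ::ₘ C, p⟩
        ⟨.mk' b (s.replace k (.var x)) t ::ₘ .neq (.var x) k ::ₘ C, p⟩

/-- Answer clauses derivable, up to renaming, from `I` by the calculus with abstraction. -/
inductive Derivable (gt : Term Sg → Term Sg → Prop) (comp : Set Sg.Sym) (I : Set (AnsClause Sg)) :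
    AnsClause Sg → Prop
  | init (A : AnsClause Sg) : A ∈ I → Derivable gt comp I A
  | infer (Ps : List (AnsClause Sg)) (σ : Var Sg → Term Sg) (A : AnsClause Sg) :
      Inference gt comp Ps σ A → (∀ P ∈ Ps, Derivable gt comp I P) → Derivable gt comp I A
  | abs (A B : AnsClause Sg) : Abs gt comp A B → Derivable gt comp I A → Derivable gt comp I B
  | variant (A B : AnsClause Sg) : A.Variant B → Derivable gt comp I A → Derivable gt comp I B

/-! ### Redundancy and saturation -/

/-- The clauses of the ground instances of the answer clauses in `S`. -/
def groundInstances (S : Set (AnsClause Sg)) : Set (Clause Sg) :=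
  {C | ∃ A ∈ S, ∃ θ, IsSubst θ ∧ (A.subst θ).Ground ∧ C = (A.subst θ).clause}

/-- Every ground instance of `A` follows from smaller ground instances of `S`. -/
def Redundant (gt : Term Sg → Term Sg → Prop) (S : Set (AnsClause Sg)) (A : AnsClause Sg) : Prop :=
  ∀ θ, IsSubst θ → (A.subst θ).Ground →
    Entails {C | C ∈ groundInstances S ∧ ClauseGt gt (A.subst θ).clause C} (A.subst θ).clause

/-- Redundancy of the inference of `A` from `Ps` with most general unifier `σ`; its ground
instances are those of the premises `P σ` and of the conclusion `A` under a common `θ`. -/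
def RedundantInference (gt : Term Sg → Term Sg → Prop) (S : Set (AnsClause Sg))
    (Ps : List (AnsClause Sg)) (σ : Var Sg → Term Sg) (A : AnsClause Sg) : Prop :=
  ∀ θ, IsSubst θ → (∀ P ∈ Ps, ((P.subst σ).subst θ).Ground) → (A.subst θ).Ground →
    (∀ P ∈ Ps, ClauseGt gt (A.subst θ).clause ((P.subst σ).subst θ).clause) ∨
    Entails {C | C ∈ groundInstances S ∧
      ∃ P ∈ Ps, ClauseGt gt ((P.subst σ).subst θ).clause C} (A.subst θ).clause

/-- Every inference from (variants of) non-redundant members of `S` is redundant. -/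
def Saturated (gt : Term Sg → Term Sg → Prop) (comp : Set Sg.Sym) (S : Set (AnsClause Sg)) : Prop :=
  ∀ Ps σ A, Inference gt comp Ps σ A →
    (∀ P ∈ Ps, ∃ B ∈ S, B.Variant P ∧ ¬ Redundant gt S B) → RedundantInference gt S Ps σ A

/-- The abstraction rule applies to no member of `S`. -/
def Abstracted (gt : Term Sg → Term Sg → Prop) (comp : Set Sg.Sym) (S : Set (AnsClause Sg)) :
    Prop :=
  ∀ A ∈ S, ∀ B, ¬ Abs gt comp A B

/-- `S` is saturated up to redundancy from the initial set `I`, and abstracted: its members are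
derivable from `I`, and every member of `I` is, after abstraction, in `S` (up to renaming) or
redundant. -/
structure SaturatedFrom (gt : Term Sg → Term Sg → Prop) (comp : Set Sg.Sym)
    (I S : Set (AnsClause Sg)) : Prop where
  derivable : ∀ A ∈ S, Derivable gt comp I A
  covers : ∀ A ∈ I, ∃ B, Relation.ReflTransGen (Abs gt comp) A B ∧
    ((∃ B' ∈ S, B.Variant B') ∨ Redundant gt S B)
  saturated : Saturated gt comp S
  abstracted : Abstracted gt comp S

/-! ### The computable grounding -/

open Classical in
/-- The normal form of the answer clause `C` with answer `y` with respect to a program term: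
conditionals are eliminated into the conditions of conditional clauses. -/
noncomputable def iteNF (C : Clause Sg) (y : Var Sg) : Prog Sg → Set (CClause Sg)
  | .term t => {⟨Clause.subst (single y t) C, []⟩}
  | .ite c p q =>
    if y ∈ Clause.vars C then
      {K | ∃ D ∈ iteNF C y p, K = ⟨D.clause, (⟨true, c⟩ : Literal Sg).compl :: D.cond⟩} ∪
      {K | ∃ D ∈ iteNF C y q, K = ⟨D.clause, (⟨true, c⟩ : Literal Sg) :: D.cond⟩}
    else {⟨C, []⟩}

/-- The computable grounding of `S`: the computable ground instances of the conditional clauses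
in the normal forms of the initial answer clauses, and those of the clauses in `S`. -/
def CGr {Λ : Specification Sg} (N : ClausalForm Λ) (S : Set (AnsClause Sg)) : Set (CClause Sg) :=
  {K | K.Ground ∧ K.Computable Λ.comp ∧
    ((∃ C ∈ N.clauses, ∃ t' : Prog Sg, t'.HasSort Λ.y.sort ∧
        ∃ K' ∈ iteNF C Λ.y t', ∃ θ, IsSubst θ ∧ K = K'.subst θ) ∨
      ∃ A ∈ S, ∃ θ, IsSubst θ ∧ K = ⟨Clause.subst θ A.clause, []⟩)}

/-! ### Rewrite systems and the model of a set of conditional clauses -/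

abbrev RewriteSystem (Sg : Signature) := Set (Term Sg × Term Sg)

/-- One rewrite step: the smallest rewrite relation that contains `R`. -/
inductive Step (R : RewriteSystem Sg) : Term Sg → Term Sg → Prop
  | rule (l r : Term Sg) (σ : Var Sg → Term Sg) :
      IsSubst σ → (l, r) ∈ R → Step R (l.subst σ) (r.subst σ)
  | congr (f : Sg.Sym) (ts : Fin (Sg.arity f) → Term Sg) (i : Fin (Sg.arity f)) (s t : Term Sg) :
      Step R s t → Step R (.app f (Function.update ts i s)) (.app f (Function.update ts i t))

def Irreducible (R : RewriteSystem Sg) (t : Term Sg) : Prop := ∀ u, ¬ Step R t u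

/-- `u` is a normal form of `t`. -/
def NormalForm (R : RewriteSystem Sg) (t u : Term Sg) : Prop :=
  Relation.ReflTransGen (Step R) t u ∧ Irreducible R u

/-- Truth of a ground literal: an equation is true if its sides have the same normal form. -/
def TrueLit (R : RewriteSystem Sg) (L : Literal Sg) : Prop :=
  if L.pos then ∃ u, ∀ t ∈ L.atom, NormalForm R t u else ¬ ∃ u, ∀ t ∈ L.atom, NormalForm R t u

def TrueClause (R : RewriteSystem Sg) (C : Clause Sg) : Prop := ∃ L ∈ C, TrueLit R L

/-- Truth of a ground conditional clause. -/
def TrueCClause (R : RewriteSystem Sg) (K : CClause Sg) : Prop :=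
  TrueClause R K.clause ∨ ∃ L ∈ K.cond, TrueLit R L

/-- `K` produces the rule `l → r`, where `R` is the partial interpretation below `K`. -/
def Produces (gt : Term Sg → Term Sg → Prop) (comp : Set Sg.Sym) (R : RewriteSystem Sg)
    (K : CClause Sg) (l r : Term Sg) : Prop :=
  ∃ C : Clause Sg, K.clause = .eq l r ::ₘ C ∧
    (∀ L ∈ K.cond, L.Computable comp) ∧
    ¬ TrueClause R K.clause ∧
    (¬ Clause.Computable comp K.clause → ∀ L ∈ K.cond, ¬ TrueLit R L) ∧
    StrictlyMaximal gt (.eq l r) C ∧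
    gt l r ∧
    ¬ TrueClause (R ∪ {(l, r)}) C ∧
    Irreducible R l

/-- Given the set `E D` of rules produced by each `D` in `G`, the partial interpretation strictly
below `K`: all rules produced by members of `G` smaller than `K`. -/
def below (gt : Term Sg → Term Sg → Prop) {G : Set (CClause Sg)} (E : G → RewriteSystem Sg)
    (K : CClause Sg) : RewriteSystem Sg :=
  {ρ | ∃ D : G, CGt gt K D ∧ ρ ∈ E D}

/-- The family `E` satisfies the recursion that defines the model: each `K` in `G` contributes
exactly the rule that it produces over the partial interpretation below it, if any. -/
def IsModelConstruction (gt : Term Sg → Term Sg → Prop) (comp : Set Sg.Sym) (G : Set (CClause Sg))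
    (E : G → RewriteSystem Sg) : Prop :=
  ∀ K : G, E K = {ρ | Produces gt comp (below gt E K) K ρ.1 ρ.2}

/-- The total interpretation: all rules produced. -/
def total {G : Set (CClause Sg)} (E : G → RewriteSystem Sg) : RewriteSystem Sg := {ρ | ∃ K, ρ ∈ E K}

end Synth

namespace Synth

/-! ### The bag extension of an ordering -/

section Bag

variable {α β : Type} {gt : α → α → Prop} {X Y Z : Multiset α}

/-! Every member of `CGr N S` is computable, and the set is closed under dropping conditions: a
branch of a conditional program ends in a program that gives the same clause with the empty
condition. Conditions therefore play no role in the model. Among the conditional clauses with a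
given clause, the one with the empty condition is least. If it produces a rule, the clause is
already true for all the others; if it does not, the others see the same rules and fail the same
test. The recursion thus collapses to one over clauses, whose ordering is well-founded (that of
conditions need not be), and this gives existence and uniqueness (`isModelConstruction_iff`).

Truth is shown by reducing minimal counterexamples, in the style of Bachmair and Ganzinger, among
the computable ground instances of `S`. Since the ordering is partitioned, everything smaller than a
computable ground clause is computable, so redundancy never leads out of this class. Answers of
members of `S` are computable, so under computable substitutions the side conditions on answers
always hold, and `supC` is the only superposition rule needed. Produced rules are ground, ordered
and non-overlapping, so joinability is an equivalence and a term model turns consequence into truth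
(`trueClause_of_entails`).

In a minimal false instance the substitution is irreducible (`irreducible_of_minimal`). A greatest
literal `s ≉ s` is removed by equality resolution (`eqRes_true`); a reducible greater side is
excluded by superposition (`irreducible_of_greatest`). A disequation with an irreducible greater
side cannot be false, and for an equation factoring shows that the clause produces a rule and so
becomes true (`false_of_irreducible`). The induction is `instance_true`.

A complication is that rules may come from instances of initial clauses that are not in `S`.
Abstraction adds to a computable ground instance only smaller literals `u ≉ u`, which are false
(`exists_abs_instance`); up to these, the instance belongs to `S` or follows from smaller instances
(`coveredBy_cgr`). From this `exists_instance_of_produced` finds, for each rule, an instance of `S`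
that can take the place of the producing clause in a superposition. -/

theorem BagGt.trans (h₁ : BagGt gt X Y) (h₂ : BagGt gt Y Z) : BagGt gt X Z :=
  Relation.TransGen.trans h₂ h₁

theorem BagGt.wf (h : WellFounded fun a b => gt b a) :
    WellFounded fun X Y : Multiset α => BagGt gt Y X :=
  h.cutExpand.transGen

theorem BagGt.irrefl (h : WellFounded fun a b => gt b a) (X : Multiset α) : ¬ BagGt gt X X :=
  fun hX => (BagGt.wf h).asymmetric _ _ hX hX

theorem BagGt.asymm (h : WellFounded fun a b => gt b a) (hXY : BagGt gt X Y) : ¬ BagGt gt Y X :=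
  fun hX => (BagGt.wf h).asymmetric _ _ hX hXY

/-- Each element of `X` in turn is replaced by the remaining elements of `Y` that it dominates; this
passes from the one-step definition to the Dershowitz–Manna criterion. -/
theorem BagGt.of_dominated (hX : X ≠ 0) (h : ∀ y ∈ Y, ∃ x ∈ X, gt x y) :
    BagGt gt (Z + X) (Z + Y) := by
  classical
  induction X using Multiset.induction generalizing Y Z with
  | empty => exact absurd rfl hX
  | cons a X ih =>
    by_cases hX0 : X = 0
    -- The transitive closure needs at least one step, so the singleton is the real base of the
    -- induction.
    · subst hX0
      refine .single ⟨Y, a, fun b hb => ?_, ?_⟩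
      · obtain ⟨x, hx, hxb⟩ := h b hb
        rw [Multiset.cons_zero, Multiset.mem_singleton] at hx
        exact hx ▸ hxb
      · simp [add_right_comm]
    · have hY : Y = Y.filter (gt a ·) + Y.filter (¬ gt a ·) := (Multiset.filter_add_not _ _).symm
      have h₁ : BagGt gt (Z + a ::ₘ X) (Z + Y.filter (gt a ·) + X) := by
        refine .single ⟨Y.filter (gt a ·), a, fun b hb => (Multiset.mem_filter.1 hb).2, ?_⟩
        rw [← Multiset.singleton_add]
        abel
      refine h₁.trans ?_
      nth_rw 2 [hY]
      rw [← add_assoc]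
      refine ih hX0 fun y hy => ?_
      obtain ⟨hy, hya⟩ := Multiset.mem_filter.1 hy
      obtain ⟨x, hx, hxy⟩ := h y hy
      rcases Multiset.mem_cons.1 hx with rfl | hx
      · exact absurd hxy hya
      · exact ⟨x, hx, hxy⟩

theorem BagGt.of_dominated' (hX : X ≠ 0) (h : ∀ y ∈ Y, ∃ x ∈ X, gt x y) : BagGt gt X Y := by
  simpa using BagGt.of_dominated (Z := 0) hX h

theorem BagGt.map {gt' : β → β → Prop} {f : α → β} (hf : ∀ a b, gt a b → gt' (f a) (f b))
    (h : BagGt gt X Y) : BagGt gt' (X.map f) (Y.map f) := by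
  refine Relation.TransGen.lift (Multiset.map f) ?_ _ _ h
  rintro A B ⟨t, a, ht, e⟩
  refine ⟨t.map f, f a, ?_, ?_⟩
  · intro b hb
    obtain ⟨c, hc, rfl⟩ := Multiset.mem_map.1 hb
    exact hf _ _ (ht c hc)
  · simpa using congrArg (Multiset.map f) e

/-- Totality is asked only on the members of `X`, because the term ordering is total only on ground
terms. -/
theorem exists_greatest (trans : ∀ a b c, gt a b → gt b c → gt a c) (hX : X ≠ 0)
    (total : ∀ a ∈ X, ∀ b ∈ X, a ≠ b → gt a b ∨ gt b a) :
    ∃ m ∈ X, ∀ x ∈ X, x = m ∨ gt m x := by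
  induction X using Multiset.induction with
  | empty => exact absurd rfl hX
  | cons a X ih =>
    by_cases hX0 : X = 0
    · subst hX0
      exact ⟨a, by simp, by simp⟩
    · obtain ⟨m, hm, hmax⟩ := ih hX0 fun a ha b hb =>
        total a (Multiset.mem_cons_of_mem ha) b (Multiset.mem_cons_of_mem hb)
      by_cases ham : gt a m
      · refine ⟨a, by simp, fun x hx => ?_⟩
        rcases Multiset.mem_cons.1 hx with rfl | hx
        · exact .inl rfl
        · rcases hmax x hx with rfl | h
          · exact .inr ham
          · exact .inr (trans _ _ _ ham h)
      · refine ⟨m, by simp [hm], fun x hx => ?_⟩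
        rcases Multiset.mem_cons.1 hx with rfl | hx
        · by_cases e : x = m
          · exact .inl e
          · exact .inr ((total x (by simp) m (by simp [hm]) e).resolve_left ham)
        · exact hmax x hx

/-- After the common part is cancelled, the greatest remaining element lies on one side only and
dominates the whole other side. -/
theorem BagGt.total (trans : ∀ a b c, gt a b → gt b c → gt a c)
    (total : ∀ a ∈ X + Y, ∀ b ∈ X + Y, a ≠ b → gt a b ∨ gt b a) (hXY : X ≠ Y) :
    BagGt gt X Y ∨ BagGt gt Y X := by
  classical
  have hX : X ∩ Y + (X - Y) = X := by
    rw [add_comm]; exact Multiset.sub_add_inter X Y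
  have hY : X ∩ Y + (Y - X) = Y := by
    rw [add_comm, Multiset.inter_comm]; exact Multiset.sub_add_inter Y X
  have hne : (X - Y) + (Y - X) ≠ 0 := by
    intro h
    obtain ⟨h₁, h₂⟩ := add_eq_zero.1 h
    exact hXY (le_antisymm (tsub_eq_zero_iff_le.1 h₁) (tsub_eq_zero_iff_le.1 h₂))
  have hsub : ∀ a ∈ (X - Y) + (Y - X), a ∈ X + Y := by
    intro a ha
    rcases Multiset.mem_add.1 ha with h | h
    · exact Multiset.mem_add.2 (.inl (Multiset.mem_of_le tsub_le_self h))
    · exact Multiset.mem_add.2 (.inr (Multiset.mem_of_le tsub_le_self h))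
  have hdisj : ∀ a, a ∈ X - Y → a ∈ Y - X → False := by
    intro a h₁ h₂
    rw [← Multiset.count_pos, Multiset.count_sub] at h₁ h₂
    omega
  obtain ⟨m, hm, hmax⟩ := exists_greatest trans hne
    fun a ha b hb => total a (hsub a ha) b (hsub b hb)
  rcases Multiset.mem_add.1 hm with hm | hm
  · left
    suffices h : BagGt gt (X ∩ Y + (X - Y)) (X ∩ Y + (Y - X)) by rwa [hX, hY] at h
    refine BagGt.of_dominated (fun h => by simp [h] at hm) fun y hy => ⟨m, hm, ?_⟩
    refine (hmax y (Multiset.mem_add.2 (.inr hy))).resolve_left ?_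
    rintro rfl
    exact hdisj _ hm hy
  · right
    suffices h : BagGt gt (X ∩ Y + (Y - X)) (X ∩ Y + (X - Y)) by rwa [hX, hY] at h
    refine BagGt.of_dominated (fun h => by simp [h] at hm) fun y hy => ⟨m, hm, ?_⟩
    refine (hmax y (Multiset.mem_add.2 (.inl hy))).resolve_left ?_
    rintro rfl
    exact hdisj _ hy hm

end Bag

variable {Sg : Signature}

/-! ### Terms, literals and clauses under substitutions -/

namespace Term

theorem subst_congr {σ τ : Var Sg → Term Sg} {t : Term Sg} (h : ∀ x ∈ t.vars, σ x = τ x) :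
    t.subst σ = t.subst τ := by
  induction t with
  | var x => exact h x rfl
  | app f ts ih => simp only [subst]; congr 1; funext i; exact ih i fun x hx => h x ⟨i, hx⟩

theorem subst_inj {σ τ : Var Sg → Term Sg} {t : Term Sg} (h : t.subst σ = t.subst τ) :
    ∀ x ∈ t.vars, σ x = τ x := by
  induction t with
  | var y => rintro x rfl; exact h
  | app f ts ih =>
    rintro x ⟨i, hx⟩
    simp only [subst, app.injEq, heq_eq_eq, true_and] at h
    exact ih i (congrFun h i) x hx

theorem subst_var (t : Term Sg) : t.subst var = t := by
  induction t with
  | var x => rfl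
  | app f ts ih => simp only [subst]; congr 1; funext i; exact ih i

theorem subst_subst (σ τ : Var Sg → Term Sg) (t : Term Sg) :
    (t.subst σ).subst τ = t.subst fun x => (σ x).subst τ := by
  induction t with
  | var x => rfl
  | app f ts ih => simp only [subst]; congr 1; funext i; exact ih i

theorem Ground.subst {t : Term Sg} (h : t.Ground) (σ : Var Sg → Term Sg) : t.subst σ = t := by
  rw [subst_congr (τ := var), subst_var]
  intro x hx
  rw [Ground] at h
  simp [h] at hx

theorem vars_subst (σ : Var Sg → Term Sg) (t : Term Sg) :
    (t.subst σ).vars = {y | ∃ x ∈ t.vars, y ∈ (σ x).vars} := by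
  induction t with
  | var x => ext y; simp [Term.subst, vars]
  | app f ts ih =>
    ext y
    simp only [Term.subst, vars, Set.mem_ofPred_eq]
    constructor
    · rintro ⟨i, hi⟩
      rw [ih i] at hi
      obtain ⟨x, hx, hy⟩ := hi
      exact ⟨x, ⟨i, hx⟩, hy⟩
    · rintro ⟨x, ⟨i, hx⟩, hy⟩
      exact ⟨i, by rw [ih i]; exact ⟨x, hx, hy⟩⟩

theorem vars_finite (t : Term Sg) : t.vars.Finite := by
  induction t with
  | var x => exact Set.finite_singleton x
  | app f ts ih =>
    have : (app f ts).vars = ⋃ i, (ts i).vars := by ext; simp [vars]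
    rw [this]
    exact Set.finite_iUnion ih

theorem ground_subst_iff {σ : Var Sg → Term Sg} {t : Term Sg} :
    (t.subst σ).Ground ↔ ∀ x ∈ t.vars, (σ x).Ground := by
  simp only [Ground, vars_subst, Set.eq_empty_iff_forall_notMem, Set.mem_ofPred_eq]
  grind

theorem ground_app {f : Sg.Sym} {ts : Fin (Sg.arity f) → Term Sg} :
    (app f ts).Ground ↔ ∀ i, (ts i).Ground := by
  simp only [Ground, vars, Set.eq_empty_iff_forall_notMem, Set.mem_ofPred_eq]
  grind

theorem computable_app {comp : Set Sg.Sym} {f : Sg.Sym} {ts : Fin (Sg.arity f) → Term Sg} :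
    (app f ts).Computable comp ↔ f ∈ comp ∧ ∀ i, (ts i).Computable comp := by
  simp only [Computable, syms, Set.subset_def, Set.mem_ofPred_eq]
  grind

theorem computable_var (comp : Set Sg.Sym) (x : Var Sg) : (var x).Computable comp := by
  simp [Computable, syms]

theorem computable_subst_iff {comp : Set Sg.Sym} {σ : Var Sg → Term Sg} {t : Term Sg} :
    (t.subst σ).Computable comp ↔ t.Computable comp ∧ ∀ x ∈ t.vars, (σ x).Computable comp := by
  induction t with
  | var x => simp [Term.subst, vars, computable_var]
  | app f ts ih =>
    simp only [Term.subst, computable_app, ih, vars, Set.mem_ofPred_eq]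
    grind

theorem Subterm.trans {s t u : Term Sg} (h₁ : s.Subterm t) (h₂ : t.Subterm u) : s.Subterm u := by
  induction h₂ with
  | refl => exact h₁
  | arg f ts i _ ih => exact .arg f ts i ih

theorem Subterm.vars_subset {s t : Term Sg} (h : s.Subterm t) : s.vars ⊆ t.vars := by
  induction h with
  | refl => exact subset_rfl
  | arg f ts i _ ih => exact fun x hx => ⟨i, ih hx⟩

theorem Subterm.ground {s t : Term Sg} (h : s.Subterm t) (ht : t.Ground) : s.Ground :=
  Set.subset_eq_empty h.vars_subset ht

theorem Subterm.computable {comp : Set Sg.Sym} {s t : Term Sg} (h : s.Subterm t)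
    (ht : t.Computable comp) : s.Computable comp := by
  induction h with
  | refl => exact ht
  | arg f ts i _ ih => exact ih ((computable_app.1 ht).2 i)

theorem Subterm.subst {s t : Term Sg} (h : s.Subterm t) (σ : Var Sg → Term Sg) :
    (s.subst σ).Subterm (t.subst σ) := by
  induction h with
  | refl => exact .refl
  | arg f ts i _ ih => exact .arg f _ i ih

theorem Subterm.ws {s t : Term Sg} (h : s.Subterm t) (ht : t.WS) : s.WS := by
  induction h with
  | refl => exact ht
  | arg f ts i _ ih => exact ih (ht i).1

/-- A non-variable occurrence in an instance either comes from the term or from the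
substitution. -/
theorem Subterm.of_subst {l t : Term Sg} {σ : Var Sg → Term Sg} (h : l.Subterm (t.subst σ)) :
    (∃ l' : Term Sg, l'.Subterm t ∧ ¬ l'.IsVar ∧ l'.subst σ = l) ∨ ∃ x ∈ t.vars, l.Subterm (σ x) := by
  induction t with
  | var x => exact .inr ⟨x, rfl, h⟩
  | app f ts ih =>
    by_cases e : l = (app f ts).subst σ
    · exact .inl ⟨_, .refl, (fun ⟨x, hx⟩ => by cases hx), e.symm⟩
    · have : ∃ i, l.Subterm ((ts i).subst σ) := by
        simp only [Term.subst] at h e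
        generalize hu : (fun i => (ts i).subst σ) = us at h e
        cases h with
        | refl => exact absurd rfl e
        | arg _ _ i hi => exact ⟨i, by rw [← hu] at hi; exact hi⟩
      obtain ⟨i, hi⟩ := this
      rcases ih i hi with ⟨l', h₁, h₂, h₃⟩ | ⟨x, hx, h⟩
      · exact .inl ⟨l', .arg f ts i h₁, h₂, h₃⟩
      · exact .inr ⟨x, ⟨i, hx⟩, h⟩

theorem mem_vars_iff_subterm {x : Var Sg} {t : Term Sg} : x ∈ t.vars ↔ (var x).Subterm t := by
  refine ⟨fun h => ?_, fun h => h.vars_subset rfl⟩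
  induction t with
  | var y => cases h; exact .refl
  | app f ts ih => obtain ⟨i, hi⟩ := h; exact .arg f ts i (ih i hi)

theorem sort_subst {σ : Var Sg → Term Sg} (hσ : IsSubst σ) (t : Term Sg) :
    (t.subst σ).sort = t.sort := by
  cases t with
  | var x => exact (hσ.1 x).2
  | app f ts => rfl

theorem WS.subst {σ : Var Sg → Term Sg} (hσ : IsSubst σ) {t : Term Sg} (ht : t.WS) :
    (t.subst σ).WS := by
  induction t with
  | var x => exact (hσ.1 x).1
  | app f ts ih => exact fun i => ⟨ih i (ht i).1, (sort_subst hσ _).trans (ht i).2⟩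

theorem sort_replace {s k u : Term Sg} (h : u.sort = k.sort) : (s.replace k u).sort = s.sort := by
  cases s with
  | var x => simp only [replace]; split_ifs with e <;> simp_all
  | app f ts => simp only [replace]; split_ifs with e
                · rw [e, h]
                · rfl

theorem WS.replace {s k u : Term Sg} (hs : s.WS) (hu : u.WS) (h : u.sort = k.sort) :
    (s.replace k u).WS := by
  induction s with
  | var x => simp only [Term.replace]; split_ifs <;> assumption
  | app f ts ih =>
    simp only [Term.replace]; split_ifs
    · exact hu
    · exact fun i => ⟨ih i (hs i).1, (sort_replace h).trans (hs i).2⟩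

/-- Size, for the termination of unification. -/
def size : Term Sg → ℕ
  | var _ => 1
  | app _ ts => 1 + ∑ i, (ts i).size

theorem Subterm.size_lt {s t : Term Sg} (h : s.Subterm t) : s = t ∨ s.size < t.size := by
  induction h with
  | refl => exact .inl rfl
  | arg f ts i _ ih =>
    right
    have : (ts i).size ≤ ∑ i, (ts i).size :=
      Finset.single_le_sum (f := fun i => (ts i).size) (fun _ _ => Nat.zero_le _) (Finset.mem_univ i)
    simp only [size]
    rcases ih with rfl | h <;> omega

/-- This undoes an abstraction once the fresh variable is instantiated by the instance of the
abstracted term. -/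
theorem replace_subst_of_subst_eq {s k u : Term Sg} {σ : Var Sg → Term Sg}
    (h : u.subst σ = k.subst σ) : (s.replace k u).subst σ = s.subst σ := by
  induction s with
  | var x => simp only [replace]; split_ifs with e
             · rw [h, ← e]
             · rfl
  | app f ts ih => simp only [replace]; split_ifs with e
                   · rw [h, ← e]
                   · simp only [Term.subst]; congr 1; funext i; exact ih i

/-- Replacing an occurring term by one with another instance changes the instance. -/
theorem replace_subst_ne {s k u : Term Sg} {σ : Var Sg → Term Sg} (hk : k.Subterm s)
    (h : u.subst σ ≠ k.subst σ) : (s.replace k u).subst σ ≠ s.subst σ := by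
  induction hk with
  | refl => cases k <;> simpa only [replace, if_true] using h
  | arg f ts i _ ih =>
    simp only [replace]; split_ifs with e
    · rwa [e]
    · intro h'
      simp only [Term.subst, app.injEq, heq_eq_eq, true_and] at h'
      exact ih (congrFun h' i)

end Term

namespace Literal

variable {σ τ : Var Sg → Term Sg} {L K : Literal Sg} {comp : Set Sg.Sym}

theorem bag_mk (b : Bool) (s t : Term Sg) :
    (⟨b, s(s, t)⟩ : Literal Sg).bag = if b then {s, t} else {s, t} + {s, t} := by
  cases b <;> rfl

theorem mem_bag {t : Term Sg} : t ∈ L.bag ↔ t ∈ L.atom := by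
  obtain ⟨b, a⟩ := L
  induction a using Sym2.ind with | _ u v
  cases b <;> simp [bag_mk]

theorem bag_subst (σ : Var Sg → Term Sg) (L : Literal Sg) :
    (L.subst σ).bag = L.bag.map (Term.subst σ) := by
  obtain ⟨b, a⟩ := L
  induction a using Sym2.ind with | _ u v
  cases b <;> simp [bag_mk, subst]

theorem pair_injective {s t u v : Term Sg} (h : ({s, t} : Multiset (Term Sg)) = {u, v}) :
    s(s, t) = s(u, v) := by
  rw [Multiset.insert_eq_cons, Multiset.insert_eq_cons, Multiset.cons_eq_cons] at h
  rw [Sym2.eq_iff]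
  rcases h with ⟨h₁, h₂⟩ | ⟨-, cs, h₁, h₂⟩
  · exact .inl ⟨h₁, by simpa using h₂⟩
  · have hc : cs = 0 := by simpa using congrArg Multiset.card h₁
    subst hc
    exact .inr ⟨by simpa using h₂.symm, by simpa using h₁⟩

/-- The cardinality of the bag, two or four, reveals the sign, and halving the multiplicities
recovers the pair of a disequation. Hence totality on bags carries over to literals. -/
theorem bag_injective : Function.Injective (bag (Sg := Sg)) := by
  classical
  rintro ⟨b, a⟩ ⟨c, a'⟩ h
  induction a using Sym2.ind with | _ s t
  induction a' using Sym2.ind with | _ u v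
  have hc := congrArg Multiset.card h
  cases b <;> cases c <;> simp only [bag_mk] at h hc
  · congr 1
    refine pair_injective (Multiset.ext.2 fun x => ?_)
    have := congrArg (Multiset.count x) h
    simp only [Bool.false_eq_true, if_false, Multiset.count_add] at this
    omega
  · simp at hc
  · simp at hc
  · congr 1
    exact pair_injective h

theorem mem_atom_subst {t : Term Sg} :
    t ∈ (L.subst σ).atom ↔ ∃ u ∈ L.atom, u.subst σ = t := by
  simp [subst, Sym2.mem_map]

theorem subst_congr (h : ∀ x ∈ L.vars, σ x = τ x) : L.subst σ = L.subst τ := by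
  refine bag_injective ?_
  rw [bag_subst, bag_subst]
  exact Multiset.map_congr rfl fun t ht =>
    Term.subst_congr fun x hx => h x ⟨t, mem_bag.1 ht, hx⟩

theorem subst_var (L : Literal Sg) : L.subst Term.var = L := by
  refine bag_injective ?_
  rw [bag_subst]
  simp [Term.subst_var]

theorem subst_subst (σ τ : Var Sg → Term Sg) (L : Literal Sg) :
    (L.subst σ).subst τ = L.subst fun x => (σ x).subst τ := by
  refine bag_injective ?_
  simp [bag_subst, Term.subst_subst]

theorem ground_iff : L.Ground ↔ ∀ t ∈ L.atom, t.Ground := by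
  simp only [Ground, vars, Term.Ground, Set.eq_empty_iff_forall_notMem, Set.mem_ofPred_eq]
  grind

theorem ground_subst_iff : (L.subst σ).Ground ↔ ∀ x ∈ L.vars, (σ x).Ground := by
  simp only [ground_iff, mem_atom_subst, vars]
  constructor
  · rintro h x ⟨t, ht, hx⟩
    exact Term.ground_subst_iff.1 (h _ ⟨t, ht, rfl⟩) x hx
  · rintro h _ ⟨t, ht, rfl⟩
    exact Term.ground_subst_iff.2 fun x hx => h x ⟨t, ht, hx⟩

theorem computable_subst_iff :
    (L.subst σ).Computable comp ↔ L.Computable comp ∧ ∀ x ∈ L.vars, (σ x).Computable comp := by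
  simp only [Computable, mem_atom_subst, vars]
  constructor
  · refine fun h => ⟨fun t ht => (Term.computable_subst_iff.1 (h _ ⟨t, ht, rfl⟩)).1, ?_⟩
    rintro x ⟨t, ht, hx⟩
    exact (Term.computable_subst_iff.1 (h _ ⟨t, ht, rfl⟩)).2 x hx
  · rintro ⟨h₁, h₂⟩ _ ⟨t, ht, rfl⟩
    exact Term.computable_subst_iff.2 ⟨h₁ t ht, fun x hx => h₂ x ⟨t, ht, hx⟩⟩

theorem WS.subst (hσ : IsSubst σ) (h : L.WS) : (L.subst σ).WS := by
  refine ⟨fun t ht => ?_, fun s hs t ht => ?_⟩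
  · obtain ⟨u, hu, rfl⟩ := mem_atom_subst.1 ht
    exact (h.1 u hu).subst hσ
  · obtain ⟨u, hu, rfl⟩ := mem_atom_subst.1 hs
    obtain ⟨v, hv, rfl⟩ := mem_atom_subst.1 ht
    rw [Term.sort_subst hσ, Term.sort_subst hσ]
    exact h.2 u hu v hv

theorem ws_mk {b : Bool} {s t : Term Sg} :
    (⟨b, s(s, t)⟩ : Literal Sg).WS ↔ s.WS ∧ t.WS ∧ s.sort = t.sort := by
  simp only [WS, Sym2.mem_iff, forall_eq_or_imp, forall_eq]
  grind

/-- Atoms are unordered, so the sides of `L` may be named in whichever order matches the instance.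
-/
theorem exists_of_subst_eq {b : Bool} {l r : Term Sg} (h : L.subst σ = ⟨b, s(l, r)⟩) :
    ∃ l' r', L = ⟨b, s(l', r')⟩ ∧ l'.subst σ = l ∧ r'.subst σ = r := by
  obtain ⟨c, a⟩ := L
  induction a using Sym2.ind with | _ u v
  simp only [subst, Sym2.map_mk, mk.injEq, Sym2.eq_iff] at h
  obtain ⟨rfl, ⟨h₁, h₂⟩ | ⟨h₁, h₂⟩⟩ := h
  · exact ⟨u, v, rfl, h₁, h₂⟩
  · exact ⟨v, u, by rw [Sym2.eq_swap], h₂, h₁⟩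

theorem vars_finite (L : Literal Sg) : L.vars.Finite := by
  have : L.vars = ⋃ t ∈ {t | t ∈ L.atom}, t.vars := by ext; simp [vars]
  rw [this]
  refine Set.Finite.biUnion ?_ fun t _ => t.vars_finite
  obtain ⟨b, a⟩ := L
  induction a using Sym2.ind with | _ u v
  refine (Set.toFinite {u, v}).subset fun t ht => ?_
  simpa using ht

end Literal

namespace Clause

variable {σ τ : Var Sg → Term Sg} {C D : Clause Sg} {comp : Set Sg.Sym} {L : Literal Sg}

theorem mem_subst : L ∈ subst σ C ↔ ∃ K ∈ C, K.subst σ = L := Multiset.mem_map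

theorem subst_congr (h : ∀ x ∈ vars C, σ x = τ x) : subst σ C = subst τ C :=
  Multiset.map_congr rfl fun L hL => Literal.subst_congr fun x hx => h x ⟨L, hL, hx⟩

theorem subst_var (C : Clause Sg) : subst Term.var C = C := by
  simp [subst, Literal.subst_var]

theorem subst_subst (σ τ : Var Sg → Term Sg) (C : Clause Sg) :
    subst τ (subst σ C) = subst (fun x => (σ x).subst τ) C := by
  simp [subst, Literal.subst_subst]

theorem subst_cons : subst σ (L ::ₘ C) = L.subst σ ::ₘ subst σ C := Multiset.map_cons _ _ _

theorem subst_add : subst σ (C + D) = subst σ C + subst σ D := Multiset.map_add _ _ _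

theorem ground_iff : Ground C ↔ ∀ L ∈ C, L.Ground := by
  simp only [Ground, vars, Literal.Ground, Set.eq_empty_iff_forall_notMem, Set.mem_ofPred_eq]
  grind

theorem ground_subst_iff : Ground (subst σ C) ↔ ∀ x ∈ vars C, (σ x).Ground := by
  simp only [ground_iff, mem_subst, vars]
  constructor
  · rintro h x ⟨t, ht, hx⟩
    exact Literal.ground_subst_iff.1 (h _ ⟨t, ht, rfl⟩) x hx
  · rintro h _ ⟨t, ht, rfl⟩
    exact Literal.ground_subst_iff.2 fun x hx => h x ⟨t, ht, hx⟩

theorem computable_subst_iff :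
    Computable comp (subst σ C) ↔
      Computable comp C ∧ ∀ x ∈ vars C, (σ x).Computable comp := by
  simp only [Computable, mem_subst, vars]
  constructor
  · refine fun h => ⟨fun t ht => (Literal.computable_subst_iff.1 (h _ ⟨t, ht, rfl⟩)).1, ?_⟩
    rintro x ⟨t, ht, hx⟩
    exact (Literal.computable_subst_iff.1 (h _ ⟨t, ht, rfl⟩)).2 x hx
  · rintro ⟨h₁, h₂⟩ _ ⟨t, ht, rfl⟩
    exact Literal.computable_subst_iff.2 ⟨h₁ t ht, fun x hx => h₂ x ⟨t, ht, hx⟩⟩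

theorem WS.subst (hσ : IsSubst σ) (h : WS C) : WS (subst σ C) := by
  intro L hL
  obtain ⟨K, hK, rfl⟩ := mem_subst.1 hL
  exact (h K hK).subst hσ

theorem Ground.subst (h : Ground C) (σ : Var Sg → Term Sg) : Clause.subst σ C = C := by
  rw [subst_congr (τ := Term.var), subst_var]
  intro x hx
  rw [Ground] at h
  simp [h] at hx

theorem vars_finite (C : Clause Sg) : (vars C).Finite := by
  have : vars C = ⋃ L ∈ {L | L ∈ C}, L.vars := by ext; simp [vars]
  rw [this]
  exact Set.Finite.biUnion (Multiset.finite_toSet C) fun L _ => L.vars_finite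

end Clause

namespace Prog

variable {σ τ : Var Sg → Term Sg} {p : Prog Sg} {comp : Set Sg.Sym}

theorem computable_subst (hp : p.Computable comp) (h : ∀ x, (σ x).Computable comp) :
    (p.subst σ).Computable comp := by
  induction p with
  | term t => exact Term.computable_subst_iff.2 ⟨hp, fun x _ => h x⟩
  | ite c p q ihp ihq =>
    refine ⟨fun t ht => ?_, ihp hp.2.1, ihq hp.2.2⟩
    obtain ⟨u, hu, rfl⟩ := Sym2.mem_map.1 ht
    exact Term.computable_subst_iff.2 ⟨hp.1 u hu, fun x _ => h x⟩

theorem Computable.of_subst (hp : (p.subst σ).Computable comp) : p.Computable comp := by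
  induction p with
  | term t => exact (Term.computable_subst_iff.1 hp).1
  | ite c p q ihp ihq =>
    refine ⟨fun t ht => ?_, ihp hp.2.1, ihq hp.2.2⟩
    exact (Term.computable_subst_iff.1 (hp.1 _ (Sym2.mem_map.2 ⟨t, ht, rfl⟩))).1

theorem vars_finite (p : Prog Sg) : p.vars.Finite := by
  induction p with
  | term t => exact t.vars_finite
  | ite c p q ihp ihq => exact (((⟨true, c⟩ : Literal Sg).vars_finite).union ihp).union ihq

theorem ground_subst (h : ∀ x ∈ p.vars, (σ x).Ground) : (p.subst σ).vars = ∅ := by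
  induction p with
  | term t => exact Term.ground_subst_iff.2 h
  | ite c p q ihp ihq =>
    simp only [vars, Set.mem_union] at h
    simp only [subst, vars, Set.union_empty_iff]
    exact ⟨⟨(Literal.ground_subst_iff (L := ⟨true, c⟩)).2 fun x hx => h x (.inl (.inl hx)),
      ihp fun x hx => h x (.inl (.inr hx))⟩, ihq fun x hx => h x (.inr hx)⟩

theorem subst_congr (h : ∀ x ∈ p.vars, σ x = τ x) : p.subst σ = p.subst τ := by
  induction p with
  | term t => exact congrArg _ (Term.subst_congr h)
  | ite c p q ihp ihq =>
    simp only [vars, Set.mem_union] at h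
    have hc := Literal.subst_congr (L := ⟨true, c⟩) fun x hx => h x (.inl (.inl hx))
    simp only [Literal.subst, Literal.mk.injEq, true_and] at hc
    simp only [subst, hc, ihp fun x hx => h x (.inl (.inr hx)), ihq fun x hx => h x (.inr hx)]

theorem subst_var (p : Prog Sg) : p.subst Term.var = p := by
  induction p with
  | term t => exact congrArg _ (Term.subst_var t)
  | ite c p q ihp ihq =>
    have hc := Literal.subst_var ⟨true, c⟩
    simp only [Literal.subst, Literal.mk.injEq, true_and] at hc
    simp only [subst, ihp, ihq, hc]

theorem subst_subst (σ τ : Var Sg → Term Sg) (p : Prog Sg) :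
    (p.subst σ).subst τ = p.subst fun x => (σ x).subst τ := by
  induction p with
  | term t => exact congrArg _ (Term.subst_subst σ τ t)
  | ite c p q ihp ihq =>
    have hc := Literal.subst_subst σ τ ⟨true, c⟩
    simp only [Literal.subst, Literal.mk.injEq, true_and] at hc
    simp only [subst, ihp, ihq, hc]

end Prog

namespace AnsClause

variable {σ τ : Var Sg → Term Sg} {A : AnsClause Sg}

theorem vars_finite (A : AnsClause Sg) : A.vars.Finite :=
  (Clause.vars_finite _).union A.ans.vars_finite

theorem ground_subst (h : ∀ x ∈ A.vars, (σ x).Ground) : (A.subst σ).Ground := by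
  simp only [Ground, vars, Set.union_empty_iff]
  exact ⟨Clause.ground_subst_iff.2 fun x hx => h x (.inl hx),
    Prog.ground_subst fun x hx => h x (.inr hx)⟩

theorem Ground.clause (h : A.Ground) : Clause.Ground A.clause :=
  (Set.union_empty_iff.1 h).1

theorem subst_congr (h : ∀ x ∈ A.vars, σ x = τ x) : A.subst σ = A.subst τ := by
  simp only [subst, mk.injEq]
  exact ⟨Clause.subst_congr fun x hx => h x (.inl hx), Prog.subst_congr fun x hx => h x (.inr hx)⟩

theorem subst_var (A : AnsClause Sg) : A.subst Term.var = A := by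
  simp only [subst, Clause.subst_var, Prog.subst_var]

theorem subst_subst (σ τ : Var Sg → Term Sg) (A : AnsClause Sg) :
    (A.subst σ).subst τ = A.subst fun x => (σ x).subst τ := by
  simp only [subst, Clause.subst_subst, Prog.subst_subst]

end AnsClause

/-! ### Substitutions -/

theorem isSubst_var : IsSubst (Term.var (Sg := Sg)) :=
  ⟨fun _ => ⟨trivial, rfl⟩, by simp⟩

theorem IsSubst.comp {σ τ : Var Sg → Term Sg} (hσ : IsSubst σ) (hτ : IsSubst τ) :
    IsSubst fun x => (σ x).subst τ := by
  refine ⟨fun x => ⟨(hσ.1 x).1.subst hτ, ?_⟩, ?_⟩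
  · rw [Term.sort_subst hτ]; exact (hσ.1 x).2
  · refine (hσ.2.union hτ.2).subset fun x hx => ?_
    by_contra h
    simp only [Set.mem_union, Set.mem_ofPred_eq, not_or, not_not] at h
    apply hx
    simp only [h.1, Term.subst, h.2]

open Classical in
theorem IsSubst.update {σ : Var Sg → Term Sg} (hσ : IsSubst σ) {x : Var Sg} {t : Term Sg}
    (ht : t.WS) (hs : t.sort = x.sort) : IsSubst (Function.update σ x t) := by
  refine ⟨fun y => ?_, (hσ.2.union (Set.finite_singleton x)).subset fun y hy => ?_⟩
  · by_cases h : y = x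
    · subst h; simpa using ⟨ht, hs⟩
    · simpa [h] using hσ.1 y
  · by_cases h : y = x
    · exact .inr h
    · left; simpa [h] using hy

open Classical in
/-- Combination of two substitutions, along a set of variables. -/
theorem IsSubst.piecewise {σ τ : Var Sg → Term Sg} (hσ : IsSubst σ) (hτ : IsSubst τ)
    (V : Set (Var Sg)) : IsSubst fun x => if x ∈ V then σ x else τ x := by
  refine ⟨fun y => ?_, (hσ.2.union hτ.2).subset fun y hy => ?_⟩
  · simp only; split_ifs
    · exact hσ.1 y
    · exact hτ.1 y
  · simp only [Set.mem_ofPred_eq] at hy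
    split_ifs at hy
    · exact .inl hy
    · exact .inr hy

open Classical in
/-- If every sort is inhabited, there are substitutions that ground finitely many variables. -/
theorem exists_grounding (inhabited : ∀ a : Sg.Srt, ∃ t : Term Sg, t.WS ∧ t.sort = a ∧ t.Ground)
    {V : Set (Var Sg)} (hV : V.Finite) : ∃ γ, IsSubst γ ∧ ∀ x ∈ V, (γ x).Ground := by
  choose g hg using inhabited
  refine ⟨fun x => if x ∈ V then g x.sort else Term.var x, ⟨fun x => ?_, ?_⟩, fun x hx => ?_⟩
  · simp only; split_ifs
    · exact ⟨(hg _).1, (hg _).2.1⟩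
    · exact ⟨trivial, rfl⟩
  · refine hV.subset fun x hx => ?_
    by_contra h
    exact hx (by simp [h])
  · simpa [hx] using (hg _).2.2

/-- Unchanged elements cancel, and each of the others dominates its own replacement. -/
theorem BagGt.map_of_ge {α β : Type} {gt : β → β → Prop} {f g : α → β} {X : Multiset α}
    (h : ∀ a ∈ X, f a = g a ∨ gt (f a) (g a)) (hs : ∃ a ∈ X, f a ≠ g a) :
    BagGt gt (X.map f) (X.map g) := by
  classical
  have hX : X.filter (fun a => f a = g a) + X.filter (fun a => ¬ f a = g a) = X :=
    Multiset.filter_add_not _ _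
  have he : (X.filter (fun a => f a = g a)).map g = (X.filter (fun a => f a = g a)).map f :=
    Multiset.map_congr rfl fun a ha => (Multiset.mem_filter.1 ha).2.symm
  rw [← hX, Multiset.map_add, Multiset.map_add, he]
  refine BagGt.of_dominated ?_ fun y hy => ?_
  · obtain ⟨a, ha, hne⟩ := hs
    intro h0
    rw [Multiset.map_eq_zero] at h0
    exact Multiset.notMem_zero a (h0 ▸ Multiset.mem_filter.2 ⟨ha, hne⟩)
  · obtain ⟨a, ha, rfl⟩ := Multiset.mem_map.1 hy
    obtain ⟨ha, hne⟩ := Multiset.mem_filter.1 ha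
    exact ⟨f a, Multiset.mem_map.2 ⟨a, Multiset.mem_filter.2 ⟨ha, hne⟩, rfl⟩,
      (h a ha).resolve_left hne⟩

namespace Literal

theorem mem_mk {b : Bool} {s t u : Term Sg} : u ∈ (⟨b, s(s, t)⟩ : Literal Sg).atom ↔ u = s ∨ u = t :=
  Sym2.mem_iff

end Literal

/-! ### Terms, literals and clauses under a simplification order -/

namespace IsSimplificationOrder

variable {gt : Term Sg → Term Sg → Prop} {comp : Set Sg.Sym}
variable {s t l r v : Term Sg} {L K M : Literal Sg} {C D E : Clause Sg}

theorem irrefl (hgt : IsSimplificationOrder gt) (s : Term Sg) : ¬ gt s s :=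
  fun h => hgt.wf.asymmetric _ _ h h

theorem asymm (hgt : IsSimplificationOrder gt) (h : gt s t) : ¬ gt t s :=
  fun h' => hgt.wf.asymmetric _ _ h h'

/-- The subterm property follows from well-foundedness: if an argument exceeded the term, inserting
that comparison repeatedly into the context would give an infinite descent. Groundness supplies
totality. -/
theorem gt_arg (hgt : IsSimplificationOrder gt) {f : Sg.Sym} {ts : Fin (Sg.arity f) → Term Sg}
    (h : (Term.app f ts).Ground) (i : Fin (Sg.arity f)) : gt (.app f ts) (ts i) := by
  have hne : Term.app f ts ≠ ts i := by
    intro e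
    have : (ts i).size ≤ ∑ i, (ts i).size :=
      Finset.single_le_sum (f := fun i => (ts i).size) (fun _ _ => Nat.zero_le _) (Finset.mem_univ i)
    have h' := congrArg Term.size e
    simp only [Term.size] at h'
    omega
  refine (hgt.total _ _ h (Term.ground_app.1 h i) hne).resolve_right fun hlt => ?_
  have hmem : ∃ u, gt u (.app f (Function.update ts i u)) :=
    ⟨ts i, by rwa [Function.update_eq_self]⟩
  obtain ⟨u, hu, hmin⟩ := hgt.wf.has_min {u | gt u (.app f (Function.update ts i u))} hmem
  exact hmin _ (hgt.context f ts i _ _ hu) hu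

theorem subterm_le (hgt : IsSimplificationOrder gt) (h : s.Subterm t) (ht : t.Ground) :
    s = t ∨ gt t s := by
  induction h with
  | refl => exact .inl rfl
  | arg f ts i _ ih =>
    right
    rcases ih (Term.ground_app.1 ht i) with rfl | h
    · exact hgt.gt_arg ht i
    · exact hgt.trans _ _ _ (hgt.gt_arg ht i) h

theorem litGt_wf (hgt : IsSimplificationOrder gt) : WellFounded fun L K => LitGt gt K L :=
  InvImage.wf Literal.bag (BagGt.wf hgt.wf)

theorem litGt_trans (h₁ : LitGt gt L K) (h₂ : LitGt gt K M) : LitGt gt L M :=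
  BagGt.trans h₁ h₂

theorem litGt_irrefl (hgt : IsSimplificationOrder gt) (L : Literal Sg) : ¬ LitGt gt L L :=
  BagGt.irrefl hgt.wf _

theorem litGt_asymm (hgt : IsSimplificationOrder gt) (h : LitGt gt L K) : ¬ LitGt gt K L :=
  BagGt.asymm hgt.wf h

theorem litGt_total (hgt : IsSimplificationOrder gt) (hL : L.Ground) (hK : K.Ground) (h : L ≠ K) :
    LitGt gt L K ∨ LitGt gt K L := by
  refine BagGt.total hgt.trans (fun a ha b hb hab => ?_) fun e => h (Literal.bag_injective e)
  have : ∀ a ∈ L.bag + K.bag, a.Ground := by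
    intro a ha
    rcases Multiset.mem_add.1 ha with ha | ha
    · exact Literal.ground_iff.1 hL a (Literal.mem_bag.1 ha)
    · exact Literal.ground_iff.1 hK a (Literal.mem_bag.1 ha)
  exact hgt.total a b (this a ha) (this b hb) hab

theorem litGt_subst (hgt : IsSimplificationOrder gt) {σ : Var Sg → Term Sg} (hσ : IsSubst σ)
    (h : LitGt gt L K) : LitGt gt (L.subst σ) (K.subst σ) := by
  rw [LitGt, Literal.bag_subst, Literal.bag_subst]
  exact BagGt.map (fun a b => hgt.subst a b σ hσ) h

theorem clauseGt_wf (hgt : IsSimplificationOrder gt) : WellFounded fun C D => ClauseGt gt D C :=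
  BagGt.wf hgt.litGt_wf

theorem clauseGt_trans (h₁ : ClauseGt gt C D) (h₂ : ClauseGt gt D E) : ClauseGt gt C E :=
  BagGt.trans h₁ h₂

theorem clauseGt_irrefl (hgt : IsSimplificationOrder gt) (C : Clause Sg) : ¬ ClauseGt gt C C :=
  BagGt.irrefl hgt.litGt_wf _

theorem clauseGt_asymm (hgt : IsSimplificationOrder gt) (h : ClauseGt gt C D) :
    ¬ ClauseGt gt D C :=
  BagGt.asymm hgt.litGt_wf h

theorem clauseGt_total (hgt : IsSimplificationOrder gt) (hC : Clause.Ground C)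
    (hD : Clause.Ground D) (h : C ≠ D) : ClauseGt gt C D ∨ ClauseGt gt D C := by
  refine BagGt.total (fun _ _ _ => litGt_trans) (fun a ha b hb hab => ?_) h
  have : ∀ a ∈ C + D, a.Ground := by
    intro a ha
    rcases Multiset.mem_add.1 ha with ha | ha
    · exact Clause.ground_iff.1 hC a ha
    · exact Clause.ground_iff.1 hD a ha
  exact hgt.litGt_total (this a ha) (this b hb) hab

theorem litGt_of_mem (ht : t ∈ L.atom) (h : ∀ u ∈ K.atom, gt t u) : LitGt gt L K :=
  BagGt.of_dominated' (fun h0 => Multiset.notMem_zero t (h0 ▸ Literal.mem_bag.2 ht))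
    fun u hu => ⟨t, Literal.mem_bag.2 ht, h u (Literal.mem_bag.1 hu)⟩

theorem eq_gt_eq (h : gt r v) : LitGt gt (.eq l r) (.eq l v) := by
  simp only [LitGt, Literal.eq, Literal.bag_mk, if_true, Multiset.insert_eq_cons,
    ← Multiset.singleton_add l]
  exact BagGt.of_dominated (by simp) (by simpa using h)

theorem mk_gt_mk {b : Bool} (h : gt s v) : LitGt gt (.mk' b s t) (.mk' b v t) := by
  cases b
  · have e : ∀ s : Term Sg, ({s, t} : Multiset (Term Sg)) + {s, t} = {t, t} + {s, s} := by
      intro s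
      simp only [Multiset.insert_eq_cons, ← Multiset.singleton_add]
      abel
    simp only [LitGt, Literal.mk', Literal.bag_mk, Bool.false_eq_true, if_false, e]
    exact BagGt.of_dominated (by simp) (by simpa using h)
  · have e : ∀ s : Term Sg, ({s, t} : Multiset (Term Sg)) = {t} + {s} := by
      intro s
      simp only [Multiset.insert_eq_cons, ← Multiset.singleton_add]
      abel
    simp only [LitGt, Literal.mk', Literal.bag_mk, if_true, e]
    exact BagGt.of_dominated (by simp) (by simpa using h)

/-- When `s = l`, one copy of `s` in the doubled bag cancels against `l` and the other dominates
`r`. -/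
theorem neq_gt_eq (hgt : IsSimplificationOrder gt) (hlr : gt l r) (hs : s = l ∨ gt s l)
    (hL : L.pos = false) (hsL : s ∈ L.atom) : LitGt gt L (.eq l r) := by
  rcases hs with rfl | hs
  · obtain ⟨b, a⟩ := L
    obtain ⟨t, rfl⟩ := Sym2.mem_iff_exists.1 hsL
    subst hL
    have e : ({s, t} : Multiset (Term Sg)) + {s, t} = {s} + {s, t, t} := by
      simp only [Multiset.insert_eq_cons, ← Multiset.singleton_add]
      abel
    simp only [LitGt, Literal.eq, Literal.bag_mk, Bool.false_eq_true, if_false, if_true, e,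
      Multiset.insert_eq_cons s {r}, ← Multiset.singleton_add s {r}]
    exact BagGt.of_dominated (by simp) (by simpa using .inl hlr)
  · refine litGt_of_mem hsL fun u hu => ?_
    rcases Literal.mem_mk.1 hu with rfl | rfl
    · exact hs
    · exact hgt.trans _ _ _ hs hlr

/-- The terms of a ground literal that is not greater than `l ≈ r` are bounded by `l`. -/
theorem le_lhs (hgt : IsSimplificationOrder gt) (hlr : gt l r) (hl : l.Ground) (hL : L.Ground)
    (h : ¬ LitGt gt L (.eq l r)) (ht : t ∈ L.atom) : t = l ∨ gt l t := by
  by_contra hn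
  rw [not_or] at hn
  have htl := (hgt.total t l (Literal.ground_iff.1 hL t ht) hl hn.1).resolve_right hn.2
  refine h (litGt_of_mem ht fun u hu => ?_)
  rcases Literal.mem_mk.1 hu with rfl | rfl
  · exact htl
  · exact hgt.trans _ _ _ htl hlr

/-- The terms of a ground disequation that is not greater than `l ≈ r` are smaller than `l`. -/
theorem lt_lhs (hgt : IsSimplificationOrder gt) (hlr : gt l r) (hl : l.Ground) (hL : L.Ground)
    (h : ¬ LitGt gt L (.eq l r)) (hpos : L.pos = false) (ht : t ∈ L.atom) : gt l t := by
  refine (hgt.le_lhs hlr hl hL h ht).resolve_left ?_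
  rintro rfl
  exact h (hgt.neq_gt_eq hlr (.inl rfl) hpos ht)

theorem clauseGt_of_mem (hL : L ∈ C) (h : ∀ K ∈ D, LitGt gt L K) : ClauseGt gt C D :=
  BagGt.of_dominated' (fun h0 => Multiset.notMem_zero L (h0 ▸ hL)) fun K hK => ⟨L, hL, h K hK⟩

theorem computable_of_gt (hgt : IsSimplificationOrder gt) (hpart : IsPartitioned comp gt)
    (hs : s.Ground) (ht : t.Ground) (hc : s.Computable comp) (h : gt s t) : t.Computable comp := by
  by_contra hn
  exact hgt.asymm h (hpart t s ht hs hn hc)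

/-- An uncomputable term of `D` would exceed every term of `C`, and so make `D` the greater clause.
This is where the partition of the ordering confines the argument to computable clauses. -/
theorem clause_computable_of_gt (hgt : IsSimplificationOrder gt) (hpart : IsPartitioned comp gt)
    (hC : Clause.Ground C) (hD : Clause.Ground D) (hc : Clause.Computable comp C)
    (h : ClauseGt gt C D) : Clause.Computable comp D := by
  by_contra hn
  simp only [Clause.Computable, Literal.Computable, not_forall] at hn
  obtain ⟨L, hL, t, ht, hn⟩ := hn
  refine hgt.clauseGt_asymm h (clauseGt_of_mem hL fun K hK => litGt_of_mem ht fun u hu => ?_)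
  exact hpart t u (Literal.ground_iff.1 (Clause.ground_iff.1 hD L hL) t ht)
    (Literal.ground_iff.1 (Clause.ground_iff.1 hC K hK) u hu) hn (hc K hK u hu)

/-- A non-empty ground clause has a maximal literal. -/
theorem exists_maximal (hgt : IsSimplificationOrder gt) (hC : Clause.Ground C) (h : C ≠ 0) :
    ∃ L D, C = L ::ₘ D ∧ ∀ K ∈ D, K = L ∨ LitGt gt L K := by
  obtain ⟨L, hL, hmax⟩ := exists_greatest (gt := LitGt gt) (fun _ _ _ => litGt_trans) h
    fun a ha b hb hab => hgt.litGt_total (Clause.ground_iff.1 hC a ha)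
      (Clause.ground_iff.1 hC b hb) hab
  obtain ⟨D, rfl⟩ := Multiset.exists_cons_of_mem hL
  exact ⟨L, D, rfl, fun K hK => hmax K (Multiset.mem_cons_of_mem hK)⟩

end IsSimplificationOrder

open Relation

/-! ### Ground rewrite systems -/

/-- The equality that decides the truth of ground equations: joinability. -/
def Joinable (R : RewriteSystem Sg) : Term Sg → Term Sg → Prop := Join (ReflTransGen (Step R))

/-- All rules are ground and ordered. -/
structure OrderedGround (gt : Term Sg → Term Sg → Prop) (R : RewriteSystem Sg) : Prop where
  rule_gt : ∀ ρ ∈ R, gt ρ.1 ρ.2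
  left_ground : ∀ ρ ∈ R, ρ.1.Ground
  right_ground : ∀ ρ ∈ R, ρ.2.Ground

/-- Left-hand sides do not overlap. -/
def OverlapFree (R : RewriteSystem Sg) : Prop :=
  ∀ ρ ∈ R, ∀ ρ' ∈ R, ρ'.1.Subterm ρ.1 → ρ' = ρ

section

variable {gt : Term Sg → Term Sg → Prop} {R R' : RewriteSystem Sg} {s t u l r : Term Sg}
  {L : Literal Sg} {C D : Clause Sg}

theorem OrderedGround.mono (h : OrderedGround gt R') (hR : R ⊆ R') : OrderedGround gt R :=
  ⟨fun ρ hρ => h.1 ρ (hR hρ), fun ρ hρ => h.2 ρ (hR hρ), fun ρ hρ => h.3 ρ (hR hρ)⟩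

theorem OverlapFree.mono (h : OverlapFree R') (hR : R ⊆ R') : OverlapFree R :=
  fun ρ hρ ρ' hρ' => h ρ (hR hρ) ρ' (hR hρ')

theorem Step.mono (hR : R ⊆ R') (h : Step R s t) : Step R' s t := by
  induction h with
  | rule l r σ hσ h => exact .rule l r σ hσ (hR h)
  | congr f ts i s t _ ih => exact .congr f ts i s t ih

theorem Step.of_mem (h : (l, r) ∈ R) : Step R l r := by
  have := Step.rule l r _ isSubst_var h
  rwa [Term.subst_var, Term.subst_var] at this

theorem Step.app {f : Sg.Sym} {ts : Fin (Sg.arity f) → Term Sg} {i : Fin (Sg.arity f)}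
    (h : Step R (ts i) u) : Step R (.app f ts) (.app f (Function.update ts i u)) := by
  have := Step.congr f ts i _ _ h
  rwa [Function.update_eq_self] at this

theorem Step.of_subterm (h : (l, r) ∈ R) (hl : l.Subterm t) : ∃ u, Step R t u := by
  induction hl with
  | refl => exact ⟨r, .of_mem h⟩
  | arg f ts i _ ih =>
    obtain ⟨u, hu⟩ := ih
    exact ⟨_, hu.app⟩

theorem Step.decreases (hgt : IsSimplificationOrder gt) (hR : OrderedGround gt R) (h : Step R s t) :
    gt s t := by
  induction h with
  | rule l r σ hσ h => exact hgt.subst _ _ σ hσ (hR.rule_gt _ h)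
  | congr f ts i s t _ ih => exact hgt.context f ts i s t ih

theorem Step.exists_rule (hR : OrderedGround gt R) (h : Step R s t) :
    ∃ ρ ∈ R, ρ.1.Subterm s := by
  induction h with
  | rule l r σ hσ h => exact ⟨_, h, by rw [(hR.left_ground _ h).subst]; exact .refl⟩
  | congr f ts i s t _ ih =>
    obtain ⟨ρ, hρ, h⟩ := ih
    exact ⟨ρ, hρ, .arg f _ i (by rwa [Function.update_self])⟩

theorem Step.ground (hR : OrderedGround gt R) (h : Step R s t) (hs : s.Ground) : t.Ground := by
  induction h with
  | rule l r σ hσ h =>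
    rw [(hR.right_ground _ h).subst]; exact hR.right_ground _ h
  | congr f ts i s t _ ih =>
    rw [Term.ground_app] at hs ⊢
    intro j
    by_cases hj : j = i
    · subst hj
      have := hs j
      rw [Function.update_self] at this ⊢
      exact ih this
    · have := hs j
      rwa [Function.update_of_ne hj] at this ⊢

theorem Step.sort (hR : ∀ ρ ∈ R, ρ.2.sort = ρ.1.sort) (h : Step R s t) : t.sort = s.sort := by
  cases h with
  | rule l r σ hσ h => rw [Term.sort_subst hσ, Term.sort_subst hσ, hR _ h]
  | congr f ts i s t _ => rfl

theorem Step.ws (hR : ∀ ρ ∈ R, ρ.2.WS ∧ ρ.2.sort = ρ.1.sort) (h : Step R s t) (hs : s.WS) :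
    t.WS := by
  induction h with
  | rule l r σ hσ h => exact (hR _ h).1.subst hσ
  | congr f ts i s t hst ih =>
    intro j
    have := hs j
    by_cases hj : j = i
    · subst hj
      rw [Function.update_self] at this ⊢
      exact ⟨ih this.1, (hst.sort fun ρ hρ => (hR ρ hρ).2).trans this.2⟩
    · rwa [Function.update_of_ne hj] at this ⊢

/-- A ground rule can fire only if its left-hand side itself occurs in the term. -/
theorem Step.restrict (hR : OrderedGround gt R') (h : Step R' s t)
    (hs : ∀ ρ ∈ R', ρ.1.Subterm s → ρ ∈ R) : Step R s t := by
  induction h with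
  | rule l r σ hσ h =>
    refine .rule l r σ hσ (hs _ h ?_)
    rw [(hR.left_ground _ h).subst]; exact .refl
  | congr f ts i s t _ ih =>
    exact .congr f ts i s t (ih fun ρ hρ hs' =>
      hs ρ hρ (.arg f _ i (by rwa [Function.update_self])))

theorem Step.app_cases {f : Sg.Sym} {ts : Fin (Sg.arity f) → Term Sg} (hR : OrderedGround gt R)
    (h : Step R (.app f ts) t) :
    (.app f ts, t) ∈ R ∨ ∃ i u, Step R (ts i) u ∧ t = .app f (Function.update ts i u) := by
  generalize e : Term.app f ts = s at h
  cases h with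
  | rule l r σ hσ h =>
    rw [(hR.left_ground _ h).subst, (hR.right_ground _ h).subst]
    exact .inl h
  | congr g us i s t h =>
    right
    cases e
    exact ⟨i, t, by rwa [Function.update_self], by rw [Function.update_idem]⟩

/-- Non-overlap forces any rule that fires inside `l` to be the rule for `l` itself; comparing
sizes, it cannot fire strictly inside. -/
theorem Step.eq_of_mem (hR : OrderedGround gt R) (hO : OverlapFree R) (h : (l, r) ∈ R)
    (hs : Step R l t) : t = r := by
  cases hs with
  | rule l' r' σ hσ h' =>
    rw [(hR.left_ground _ h').subst] at h
    have := hO _ h _ h' .refl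
    rw [(hR.right_ground _ h').subst]
    exact congrArg Prod.snd this
  | congr f ts i s t hs =>
    obtain ⟨ρ, hρ, hs'⟩ := hs.exists_rule hR
    have h₁ : s.Subterm (.app f (Function.update ts i s)) :=
      .arg f _ i (by rw [Function.update_self]; exact .refl)
    have := hO _ h ρ hρ (hs'.trans h₁)
    subst this
    have h₂ : s.size < (Term.app f (Function.update ts i s)).size := by
      have : s.size ≤ ∑ j, ((Function.update ts i s) j).size := by
        have := Finset.single_le_sum (f := fun j => ((Function.update ts i s) j).size)
          (fun _ _ => Nat.zero_le _) (Finset.mem_univ i)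
        simpa using this
      simp only [Term.size]; omega
    rcases hs'.size_lt with e | h₃
    · have h₄ := congrArg Term.size e
      dsimp only at h₄
      omega
    · exact absurd h₂ h₃.asymm

/-- A left-hand side has a single reduct. Otherwise both steps take place in arguments: in different
ones they commute, and in the same one the induction applies. The form of the conclusion is the one
that Mathlib's Church–Rosser lemma expects. -/
theorem Step.diamond (hR : OrderedGround gt R) (hO : OverlapFree R) (a b c : Term Sg)
    (hab : Step R a b) (hac : Step R a c) :
    ∃ d, ReflGen (Step R) b d ∧ ReflTransGen (Step R) c d := by
  suffices h : ∃ d, ReflGen (Step R) b d ∧ ReflGen (Step R) c d by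
    obtain ⟨d, h₁, h₂⟩ := h
    exact ⟨d, h₁, h₂.to_reflTransGen⟩
  by_cases h : ∃ r, (a, r) ∈ R
  · obtain ⟨r, h⟩ := h
    exact ⟨r, by rw [hab.eq_of_mem hR hO h], by rw [hac.eq_of_mem hR hO h]⟩
  induction a generalizing b c with
  | var x =>
    exfalso
    generalize e : Term.var x = a at hab
    cases hab with
    | rule l r σ hσ hm => rw [(hR.left_ground _ hm).subst] at e; exact h ⟨r, e ▸ hm⟩
    | congr => cases e
  | app f ts ih =>
    obtain ⟨i, u, hu, rfl⟩ := (hab.app_cases hR).resolve_left fun h' => h ⟨_, h'⟩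
    obtain ⟨j, v, hv, rfl⟩ := (hac.app_cases hR).resolve_left fun h' => h ⟨_, h'⟩
    by_cases hij : i = j
    · subst hij
      have : ∃ d, ReflGen (Step R) u d ∧ ReflGen (Step R) v d := by
        by_cases hi : ∃ r, (ts i, r) ∈ R
        · obtain ⟨r, hi⟩ := hi
          exact ⟨r, by rw [hu.eq_of_mem hR hO hi], by rw [hv.eq_of_mem hR hO hi]⟩
        · exact ih i _ _ hu hv hi
      obtain ⟨d, h₁, h₂⟩ := this
      have lift : ∀ w, ReflGen (Step R) w d → ReflGen (Step R)
          (.app f (Function.update ts i w)) (.app f (Function.update ts i d)) := by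
        intro w hw
        cases hw with
        | refl => exact .refl
        | single h => exact .single (.congr f ts i _ _ h)
      exact ⟨_, lift _ h₁, lift _ h₂⟩
    · refine ⟨.app f (Function.update (Function.update ts i u) j v), .single (Step.app ?_), ?_⟩
      · rwa [Function.update_of_ne (Ne.symm hij)]
      · rw [Function.update_comm hij]
        refine .single (Step.app ?_)
        rwa [Function.update_of_ne hij]

theorem Joinable.equivalence (hR : OrderedGround gt R) (hO : OverlapFree R) :
    Equivalence (Joinable R) :=
  equivalence_join_reflTransGen (Step.diamond hR hO)

theorem Joinable.of_rtg (h : ReflTransGen (Step R) s t) : Joinable R s t := ⟨t, h, .refl⟩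

theorem Joinable.refl (s : Term Sg) : Joinable R s s := .of_rtg .refl

theorem rtg_mono (hR : R ⊆ R') (h : ReflTransGen (Step R) s t) : ReflTransGen (Step R') s t :=
  ReflTransGen.mono (fun _ _ h => Step.mono hR h) _ _ h

theorem Joinable.mono (hR : R ⊆ R') (h : Joinable R s t) : Joinable R' s t :=
  let ⟨u, h₁, h₂⟩ := h
  ⟨u, rtg_mono hR h₁, rtg_mono hR h₂⟩

theorem rtg_le (hgt : IsSimplificationOrder gt) (hR : OrderedGround gt R)
    (h : ReflTransGen (Step R) s t) : t = s ∨ gt s t := by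
  induction h with
  | refl => exact .inl rfl
  | tail _ h ih =>
    right
    rcases ih with rfl | ih
    · exact h.decreases hgt hR
    · exact hgt.trans _ _ _ ih (h.decreases hgt hR)

theorem rtg_app {f : Sg.Sym} {ts us : Fin (Sg.arity f) → Term Sg}
    (h : ∀ i, ReflTransGen (Step R) (ts i) (us i)) :
    ReflTransGen (Step R) (.app f ts) (.app f us) := by
  classical
  -- The arguments are rewritten one at a time; `F` collects those already done.
  have key : ∀ F : Finset (Fin (Sg.arity f)),
      ReflTransGen (Step R) (.app f ts) (.app f fun i => if i ∈ F then us i else ts i) := by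
    intro F
    induction F using Finset.induction_on with
    | empty => simpa using ReflTransGen.refl
    | insert a F ha ih =>
      refine ih.trans ?_
      have e₁ : (fun i => if i ∈ F then us i else ts i) =
          Function.update (fun i => if i ∈ F then us i else ts i) a (ts a) := by
        rw [eq_comm, Function.update_eq_self_iff]; simp [ha]
      have e₂ : (fun i => if i ∈ insert a F then us i else ts i) =
          Function.update (fun i => if i ∈ F then us i else ts i) a (us a) := by
        funext i
        by_cases hi : i = a
        · subst hi; simp
        · simp [hi]
      rw [e₁, e₂]
      exact ReflTransGen.lift (fun w => Term.app f (Function.update _ a w))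
        (fun _ _ h => Step.congr f _ a _ _ h) _ _ (h a)
  simpa using key Finset.univ

theorem rtg_subst {σ τ : Var Sg → Term Sg} (h : ∀ x, ReflTransGen (Step R) (σ x) (τ x))
    (t : Term Sg) : ReflTransGen (Step R) (t.subst σ) (t.subst τ) := by
  induction t with
  | var x => exact h x
  | app f ts ih => exact rtg_app ih

theorem rtg_replace {s k u : Term Sg} {σ : Var Sg → Term Sg}
    (h : ReflTransGen (Step R) (k.subst σ) (u.subst σ)) :
    ReflTransGen (Step R) (s.subst σ) ((s.replace k u).subst σ) := by
  induction s with
  | var x =>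
    simp only [Term.replace]; split_ifs with e
    · rwa [e]
    · exact .refl
  | app f ts ih =>
    simp only [Term.replace]; split_ifs with e
    · rwa [e]
    · exact rtg_app ih

theorem Joinable.app {f : Sg.Sym} {ts us : Fin (Sg.arity f) → Term Sg}
    (h : ∀ i, Joinable R (ts i) (us i)) : Joinable R (.app f ts) (.app f us) := by
  choose w h₁ h₂ using h
  exact ⟨_, rtg_app h₁, rtg_app h₂⟩

theorem exists_normalForm (hgt : IsSimplificationOrder gt) (hR : OrderedGround gt R)
    (t : Term Sg) : ∃ u, NormalForm R t u := by
  induction t using hgt.wf.induction with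
  | _ t ih =>
    by_cases h : Irreducible R t
    · exact ⟨t, .refl, h⟩
    · simp only [Irreducible, not_forall, not_not] at h
      obtain ⟨u, hu⟩ := h
      obtain ⟨w, hw, hi⟩ := ih u (hu.decreases hgt hR)
      exact ⟨w, .head hu hw, hi⟩

/-- Termination suffices: a common reduct can be rewritten further to a normal form. Confluence is
not needed here. -/
theorem exists_common_normalForm_iff (hgt : IsSimplificationOrder gt) (hR : OrderedGround gt R) :
    (∃ u, ∀ w ∈ s(s, t), NormalForm R w u) ↔ Joinable R s t := by
  simp only [Sym2.mem_iff, forall_eq_or_imp, forall_eq]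
  constructor
  · rintro ⟨u, h₁, h₂⟩
    exact ⟨u, h₁.1, h₂.1⟩
  · rintro ⟨u, h₁, h₂⟩
    obtain ⟨w, hw, hi⟩ := exists_normalForm hgt hR u
    exact ⟨w, ⟨h₁.trans hw, hi⟩, ⟨h₂.trans hw, hi⟩⟩

theorem trueLit_pos_iff (hgt : IsSimplificationOrder gt) (hR : OrderedGround gt R) :
    TrueLit R ⟨true, s(s, t)⟩ ↔ Joinable R s t := by
  rw [← exists_common_normalForm_iff hgt hR]; rfl

theorem trueLit_neg_iff (hgt : IsSimplificationOrder gt) (hR : OrderedGround gt R) :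
    TrueLit R ⟨false, s(s, t)⟩ ↔ ¬ Joinable R s t := by
  rw [← exists_common_normalForm_iff hgt hR]; rfl

/-- Rewriting decreases terms, so a rule whose left-hand side is not bounded by `t` never applies on
the way. -/
theorem rtg_restrict (hgt : IsSimplificationOrder gt) (hR : OrderedGround gt R')
    (ht : t.Ground) (h : ∀ ρ ∈ R', ρ.1 = t ∨ gt t ρ.1 → ρ ∈ R) (hs : ReflTransGen (Step R') t u) :
    ReflTransGen (Step R) t u := by
  induction hs using ReflTransGen.head_induction_on with
  | refl => exact .refl
  | @head a b hab _ ih =>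
    refine .head (hab.restrict hR fun ρ hρ hs' => h ρ hρ (hgt.subterm_le hs' ht))
      (ih (hab.ground hR ht) fun ρ hρ h' => h ρ hρ (.inr ?_))
    rcases h' with h' | h'
    · rw [h']; exact hab.decreases hgt hR
    · exact hgt.trans _ _ _ (hab.decreases hgt hR) h'

theorem Joinable.restrict (hgt : IsSimplificationOrder gt) (hR : OrderedGround gt R')
    (hs : s.Ground) (ht : t.Ground) (h₁ : ∀ ρ ∈ R', ρ.1 = s ∨ gt s ρ.1 → ρ ∈ R)
    (h₂ : ∀ ρ ∈ R', ρ.1 = t ∨ gt t ρ.1 → ρ ∈ R) (h : Joinable R' s t) : Joinable R s t :=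
  let ⟨u, hu₁, hu₂⟩ := h
  ⟨u, rtg_restrict hgt hR hs h₁ hu₁, rtg_restrict hgt hR ht h₂ hu₂⟩

/-- Truth of a ground literal depends only on the rules whose left-hand sides are bounded by its
terms. -/
theorem trueLit_agree (hgt : IsSimplificationOrder gt) (hR : OrderedGround gt R') (hRR : R ⊆ R')
    (hL : L.Ground) (h : ∀ t ∈ L.atom, ∀ ρ ∈ R', ρ.1 = t ∨ gt t ρ.1 → ρ ∈ R) :
    TrueLit R L ↔ TrueLit R' L := by
  obtain ⟨b, a⟩ := L
  induction a using Sym2.ind with | _ s t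
  simp only [Literal.ground_iff, Sym2.mem_iff, forall_eq_or_imp, forall_eq] at hL h
  have : Joinable R s t ↔ Joinable R' s t :=
    ⟨Joinable.mono hRR, Joinable.restrict hgt hR hL.1 hL.2 h.1 h.2⟩
  cases b
  · rw [trueLit_neg_iff hgt hR, trueLit_neg_iff hgt (hR.mono hRR), this]
  · rw [trueLit_pos_iff hgt hR, trueLit_pos_iff hgt (hR.mono hRR), this]

theorem trueLit_mono (hgt : IsSimplificationOrder gt) (hR : OrderedGround gt R') (hRR : R ⊆ R')
    (hL : L.pos = true) (h : TrueLit R L) : TrueLit R' L := by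
  obtain ⟨b, a⟩ := L
  induction a using Sym2.ind with | _ s t
  subst hL
  rw [trueLit_pos_iff hgt hR]
  exact ((trueLit_pos_iff hgt (hR.mono hRR)).1 h).mono hRR

theorem trueLit_anti (hgt : IsSimplificationOrder gt) (hR : OrderedGround gt R') (hRR : R ⊆ R')
    (hL : L.pos = false) (h : TrueLit R' L) : TrueLit R L := by
  obtain ⟨b, a⟩ := L
  induction a using Sym2.ind with | _ s t
  subst hL
  rw [trueLit_neg_iff hgt (hR.mono hRR)]
  exact fun h' => ((trueLit_neg_iff hgt hR).1 h) (h'.mono hRR)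

/-- Rewriting the terms of the substitution preserves truth. -/
theorem trueLit_subst_congr (hgt : IsSimplificationOrder gt) (hR : OrderedGround gt R)
    (hO : OverlapFree R) {σ τ : Var Sg → Term Sg} (h : ∀ x, ReflTransGen (Step R) (σ x) (τ x)) :
    TrueLit R (L.subst σ) ↔ TrueLit R (L.subst τ) := by
  obtain ⟨b, a⟩ := L
  induction a using Sym2.ind with | _ s t
  have E := Joinable.equivalence hR hO
  have hs := Joinable.of_rtg (rtg_subst h s)
  have ht := Joinable.of_rtg (rtg_subst h t)
  have : Joinable R (s.subst σ) (t.subst σ) ↔ Joinable R (s.subst τ) (t.subst τ) :=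
    ⟨fun h => E.trans (E.symm hs) (E.trans h ht), fun h => E.trans hs (E.trans h (E.symm ht))⟩
  cases b
  · simp only [Literal.subst, Sym2.map_mk, trueLit_neg_iff hgt hR, this]
  · simp only [Literal.subst, Sym2.map_mk, trueLit_pos_iff hgt hR, this]

/-! ### The term model -/

/-- The model whose elements are the classes of joinable terms. -/
noncomputable def termModel
    (inhabited : ∀ a : Sg.Srt, ∃ t : Term Sg, t.WS ∧ t.sort = a ∧ t.Ground)
    (hE : Equivalence (Joinable R)) : Interp Sg where
  U := Quotient (⟨Joinable R, hE⟩ : Setoid (Term Sg))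
  dom a := {c | ∃ t : Term Sg, t.WS ∧ t.sort = a ∧ t.Ground ∧ c = Quotient.mk _ t}
  dom_nonempty a :=
    let ⟨t, h₁, h₂, h₃⟩ := inhabited a
    ⟨_, t, h₁, h₂, h₃, rfl⟩
  -- The choice of representatives is immaterial, because joinability is a congruence.
  fn f us := Quotient.mk _ (.app f fun i => (us i).out)
  fn_mem f us h := by
    choose t h₁ h₂ h₃ h₄ using h
    refine ⟨.app f t, fun i => ⟨h₁ i, h₂ i⟩, rfl, Term.ground_app.2 h₃, Quotient.sound ?_⟩
    refine Joinable.app fun i => ?_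
    rw [h₄ i]
    exact Quotient.mk_out (s := ⟨Joinable R, hE⟩) (t i)

theorem termModel_eval
    (inhabited : ∀ a : Sg.Srt, ∃ t : Term Sg, t.WS ∧ t.sort = a ∧ t.Ground)
    (hE : Equivalence (Joinable R)) (v : Var Sg → (termModel inhabited hE).U) (ht : t.Ground) :
    (termModel inhabited hE).eval v t = Quotient.mk _ t := by
  induction t with
  | var x => simp [Term.Ground, Term.vars] at ht
  | app f ts ih =>
    refine Quotient.sound (s := ⟨Joinable R, hE⟩) (Joinable.app fun i => ?_)
    exact (congrArg (fun c => Joinable R (Quotient.out c) (ts i))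
      (ih i (Term.ground_app.1 ht i))).mpr (Quotient.mk_out (s := ⟨Joinable R, hE⟩) (ts i))

theorem termModel_holdsLit
    (inhabited : ∀ a : Sg.Srt, ∃ t : Term Sg, t.WS ∧ t.sort = a ∧ t.Ground)
    (hE : Equivalence (Joinable R)) (hgt : IsSimplificationOrder gt) (hR : OrderedGround gt R)
    (v : Var Sg → (termModel inhabited hE).U) (hL : L.Ground) :
    (termModel inhabited hE).HoldsLit v L ↔ TrueLit R L := by
  obtain ⟨b, a⟩ := L
  induction a using Sym2.ind with | _ s t
  simp only [Literal.ground_iff, Sym2.mem_iff, forall_eq_or_imp, forall_eq] at hL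
  have : (termModel inhabited hE).eval v s = (termModel inhabited hE).eval v t ↔
      Joinable R s t := by
    rw [termModel_eval inhabited hE v hL.1, termModel_eval inhabited hE v hL.2]
    exact Quotient.eq (r := ⟨Joinable R, hE⟩)
  cases b
  · rw [trueLit_neg_iff hgt hR, ← this]
    simp [Interp.HoldsLit]
  · rw [trueLit_pos_iff hgt hR, ← this]
    simp [Interp.HoldsLit]

theorem termModel_holdsClause
    (inhabited : ∀ a : Sg.Srt, ∃ t : Term Sg, t.WS ∧ t.sort = a ∧ t.Ground)
    (hE : Equivalence (Joinable R)) (hgt : IsSimplificationOrder gt) (hR : OrderedGround gt R)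
    (v : Var Sg → (termModel inhabited hE).U) (hC : Clause.Ground C) :
    (termModel inhabited hE).HoldsClause v C ↔ TrueClause R C :=
  exists_congr fun L => and_congr_right fun hL =>
    termModel_holdsLit inhabited hE hgt hR v (Clause.ground_iff.1 hC L hL)

/-- Redundancy is stated through first-order consequence; evaluating it in the term model of `R`
turns it into truth in `R`. -/
theorem trueClause_of_entails
    (inhabited : ∀ a : Sg.Srt, ∃ t : Term Sg, t.WS ∧ t.sort = a ∧ t.Ground) (hgt : IsSimplificationOrder gt) (hR : OrderedGround gt R)
    (hO : OverlapFree R) {Γ : Set (Clause Sg)} (hΓ : ∀ D ∈ Γ, Clause.Ground D ∧ TrueClause R D)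
    (hC : Clause.Ground C) (h : Entails Γ C) : TrueClause R C := by
  have hE := Joinable.equivalence hR hO
  -- The clauses are ground, so any assignment serves; one exists because the domains are non-empty.
  choose v hv using fun x : Var Sg => (termModel inhabited hE).dom_nonempty x.sort
  refine (termModel_holdsClause inhabited hE hgt hR v hC).1 (h _ (fun D hD w _ => ?_) v hv)
  exact (termModel_holdsClause inhabited hE hgt hR w (hΓ D hD).1).2 (hΓ D hD).2

end

/-! ### Unification -/

section Unification

/-- The substitution solves all equations of the list. -/
def Unifies (E : List (Term Sg × Term Sg)) (τ : Var Sg → Term Sg) : Prop :=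
  ∀ e ∈ E, e.1.subst τ = e.2.subst τ

def eqsVars (E : List (Term Sg × Term Sg)) : Set (Var Sg) :=
  {x | ∃ e ∈ E, x ∈ e.1.vars ∨ x ∈ e.2.vars}

def eqsSize (E : List (Term Sg × Term Sg)) : ℕ := (E.map fun e => e.1.size + e.2.size).sum

theorem eqsVars_finite (E : List (Term Sg × Term Sg)) : (eqsVars E).Finite := by
  have : eqsVars E = ⋃ e ∈ {e | e ∈ E}, (e.1.vars ∪ e.2.vars) := by ext; simp [eqsVars]
  rw [this]
  exact Set.Finite.biUnion (List.finite_toSet E) fun e _ => e.1.vars_finite.union e.2.vars_finite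

theorem IsMGU.congr {U U' : (Var Sg → Term Sg) → Prop} {σ : Var Sg → Term Sg}
    (h : ∀ τ, U τ ↔ U' τ) (hσ : IsMGU U σ) : IsMGU U' σ :=
  ⟨hσ.1, (h σ).1 hσ.2.1, fun θ hθ hU => hσ.2.2 θ hθ ((h θ).2 hU)⟩

theorem unifies_cons {e : Term Sg × Term Sg} {E : List (Term Sg × Term Sg)}
    {τ : Var Sg → Term Sg} : Unifies (e :: E) τ ↔ e.1.subst τ = e.2.subst τ ∧ Unifies E τ := by
  simp [Unifies]

theorem single_self (x : Var Sg) (t : Term Sg) : single x t x = t := by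
  simp [single]

theorem single_of_ne {x y : Var Sg} {t : Term Sg} (h : y ≠ x) : single x t y = .var y := by
  simp [single, h]

theorem subst_single_subst {x : Var Sg} {t u : Term Sg} {τ : Var Sg → Term Sg}
    (h : τ x = t.subst τ) : (u.subst (single x t)).subst τ = u.subst τ := by
  rw [Term.subst_subst]
  refine Term.subst_congr fun y _ => ?_
  by_cases hy : y = x
  · subst hy; simp [single, h]
  · simp [single, hy, Term.subst]

theorem subst_single_of_notMem {x : Var Sg} {t u : Term Sg} (h : x ∉ u.vars) :
    u.subst (single x t) = u := by
  conv_rhs => rw [← Term.subst_var u]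
  refine Term.subst_congr fun y hy => ?_
  have : y ≠ x := fun e => h (e ▸ hy)
  simp [single, this]

theorem unifies_map_single {x : Var Sg} {t : Term Sg} {E : List (Term Sg × Term Sg)}
    {τ : Var Sg → Term Sg} (h : τ x = t.subst τ) :
    Unifies (E.map fun e => (e.1.subst (single x t), e.2.subst (single x t))) τ ↔ Unifies E τ := by
  simp only [Unifies, List.mem_map, forall_exists_index, and_imp, forall_apply_eq_imp_iff₂,
    subst_single_subst h]

theorem isSubst_single {x : Var Sg} {t : Term Sg} (ht : t.WS) (hs : t.sort = x.sort) :
    IsSubst (single x t) :=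
  isSubst_var.update ht hs

/-- A solution of `x = t` is unchanged by first substituting `t` for `x`, so it also solves the
reduced system and factors through its most general unifier. -/
theorem IsMGU.eliminate {x : Var Sg} {t : Term Sg} {E : List (Term Sg × Term Sg)}
    (hx : x ∉ t.vars) (ht : t.WS) (hs : t.sort = x.sort) {σ : Var Sg → Term Sg}
    (hσ : IsMGU (Unifies (E.map fun e => (e.1.subst (single x t), e.2.subst (single x t)))) σ) :
    IsMGU (Unifies ((.var x, t) :: E)) fun y => (single x t y).subst σ := by
  refine ⟨(isSubst_single ht hs).comp hσ.1, ?_, fun θ hθ hU => ?_⟩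
  · rw [unifies_cons]
    constructor
    · rw [← Term.subst_subst, ← Term.subst_subst, subst_single_of_notMem hx]
      simp [single, Term.subst]
    · intro e he
      rw [← Term.subst_subst, ← Term.subst_subst]
      exact hσ.2.1 _ (List.mem_map.2 ⟨e, he, rfl⟩)
  · rw [unifies_cons] at hU
    obtain ⟨ρ, hρ, h⟩ := hσ.2.2 θ hθ ((unifies_map_single hU.1).2 hU.2)
    refine ⟨ρ, hρ, fun y => ?_⟩
    rw [Term.subst_subst, ← Term.subst_congr fun z _ => h z]
    by_cases hy : y = x
    · subst hy; simpa [single, Term.subst] using hU.1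
    · simp [single, hy, Term.subst]

theorem eqsVars_map_single {x : Var Sg} {t : Term Sg} {E : List (Term Sg × Term Sg)}
    (hx : x ∉ t.vars) :
    eqsVars (E.map fun e => (e.1.subst (single x t), e.2.subst (single x t))) ⊆
      eqsVars ((.var x, t) :: E) \ {x} := by
  have key : ∀ (u : Term Sg) (z : Var Sg), z ∈ (u.subst (single x t)).vars →
      z ≠ x ∧ (z ∈ u.vars ∨ z ∈ t.vars) := by
    intro u z hz
    rw [Term.vars_subst] at hz
    obtain ⟨y, hy, hz⟩ := hz
    by_cases e : y = x
    · subst e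
      rw [single_self] at hz
      exact ⟨fun e => hx (e ▸ hz), .inr hz⟩
    · rw [single_of_ne e] at hz
      cases hz
      exact ⟨e, .inl hy⟩
  rintro z ⟨e, he, hz⟩
  obtain ⟨e, he', rfl⟩ := List.mem_map.1 he
  refine ⟨?_, ?_⟩
  · rcases hz with hz | hz
    · rcases (key _ z hz).2 with h | h
      · exact ⟨e, List.mem_cons_of_mem _ he', .inl h⟩
      · exact ⟨_, List.mem_cons_self, .inr h⟩
    · rcases (key _ z hz).2 with h | h
      · exact ⟨e, List.mem_cons_of_mem _ he', .inr h⟩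
      · exact ⟨_, List.mem_cons_self, .inr h⟩
  · rcases hz with hz | hz
    · exact (key _ z hz).1
    · exact (key _ z hz).1

/-- The occurs check: otherwise the instance of `x` would be a proper subterm of itself. -/
theorem notMem_vars_of_unifies {x : Var Sg} {t : Term Sg} {θ : Var Sg → Term Sg}
    (h : θ x = t.subst θ) (ht : t ≠ .var x) : x ∉ t.vars := by
  intro hx
  cases t with
  | var y => cases hx; exact ht rfl
  | app f ts =>
    obtain ⟨i, hi⟩ := hx
    have h₁ := ((Term.mem_vars_iff_subterm.1 hi).subst θ)
    have h₂ : ((ts i).subst θ).size < ((Term.app f ts).subst θ).size := by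
      have : ((ts i).subst θ).size ≤ ∑ j, ((ts j).subst θ).size :=
        Finset.single_le_sum (f := fun j => ((ts j).subst θ).size) (fun _ _ => Nat.zero_le _)
          (Finset.mem_univ i)
      simp only [Term.subst, Term.size]; omega
    have h₃ : ((Term.var x).subst θ).size ≤ ((ts i).subst θ).size := by
      rcases h₁.size_lt with e | h
      · rw [e]
      · exact h.le
    have h₄ := congrArg Term.size h
    simp only [Term.subst] at h₂ h₃ h₄
    omega

/-- Unification by transformation of equations, terminating lexicographically in the number of
variables and the total size. The given solution `θ` rules out clashes, occurs-check failures and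
sort mismatches. -/
theorem exists_mgu_list (k n : ℕ) (E : List (Term Sg × Term Sg)) (hk : (eqsVars E).ncard ≤ k)
    (hn : eqsSize E ≤ n) (hE : ∀ e ∈ E, e.1.WS ∧ e.2.WS) {θ : Var Sg → Term Sg} (hθ : IsSubst θ)
    (hU : Unifies E θ) : ∃ σ, IsMGU (Unifies E) σ := by
  induction k using Nat.strong_induction_on generalizing n E with | _ k ihk
  induction n using Nat.strong_induction_on generalizing E with | _ n ihn
  -- Eliminating `x` lowers the number of variables, however much the equations grow.
  have elim : ∀ (x : Var Sg) (t : Term Sg) (E' : List (Term Sg × Term Sg)), t ≠ .var x →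
      Unifies ((.var x, t) :: E') θ → (∀ e ∈ (.var x, t) :: E', e.1.WS ∧ e.2.WS) →
      (eqsVars ((.var x, t) :: E')).ncard ≤ k → ∃ σ, IsMGU (Unifies ((.var x, t) :: E')) σ := by
    intro x t E' hne hU hE hk
    have hU' := unifies_cons.1 hU
    have hx := notMem_vars_of_unifies hU'.1 hne
    have hs : t.sort = x.sort := by
      rw [← Term.sort_subst hθ t, ← hU'.1]; exact (hθ.1 x).2
    have ht : t.WS := (hE _ List.mem_cons_self).2
    have hmem : x ∈ eqsVars ((.var x, t) :: E') := ⟨_, List.mem_cons_self, .inl rfl⟩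
    have hlt : (eqsVars (E'.map fun e => (e.1.subst (single x t), e.2.subst (single x t)))).ncard
        < k := by
      refine lt_of_lt_of_le (Set.ncard_lt_ncard ?_ (eqsVars_finite _)) hk
      refine Set.ssubset_of_subset_of_ssubset (eqsVars_map_single hx) ?_
      exact Set.sdiff_singleton_ssubset.2 hmem
    obtain ⟨σ, hσ⟩ := ihk _ hlt _ _ le_rfl le_rfl (fun e he => by
      obtain ⟨e, he', rfl⟩ := List.mem_map.1 he
      have := hE e (List.mem_cons_of_mem _ he')
      exact ⟨this.1.subst (isSubst_single ht hs), this.2.subst (isSubst_single ht hs)⟩)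
      ((unifies_map_single hU'.1).2 hU'.2)
    exact ⟨_, hσ.eliminate hx ht hs⟩
  match E with
  | [] =>
    refine ⟨Term.var, isSubst_var, fun e he => (List.not_mem_nil he).elim, fun τ hτ _ => ?_⟩
    exact ⟨τ, hτ, fun _ => rfl⟩
  | (.var x, t) :: E' =>
    by_cases ht : t = .var x
    · subst ht
      obtain ⟨σ, hσ⟩ := ihn (eqsSize E') (lt_of_lt_of_le (by simp [eqsSize, Term.size]) hn) E'
        (le_trans (Set.ncard_le_ncard (by rintro z ⟨e, he, hz⟩; exact ⟨e, List.mem_cons_of_mem _ he, hz⟩)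
          (eqsVars_finite _)) hk) le_rfl (fun e he => hE e (List.mem_cons_of_mem _ he))
        (unifies_cons.1 hU).2
      exact ⟨σ, hσ.congr fun τ => by simp [unifies_cons]⟩
    · exact elim x t E' ht hU hE hk
  | (.app f ts, .var x) :: E' =>
    obtain ⟨σ, hσ⟩ := elim x (.app f ts) E' (fun h => by cases h)
      (by rw [unifies_cons] at hU ⊢; exact ⟨hU.1.symm, hU.2⟩)
      (fun e he => by
        rcases List.mem_cons.1 he with rfl | he
        · exact (hE _ List.mem_cons_self).symm
        · exact hE e (List.mem_cons_of_mem _ he))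
      (by
        refine le_trans (Set.ncard_le_ncard ?_ (eqsVars_finite _)) hk
        rintro z ⟨e, he, hz⟩
        rcases List.mem_cons.1 he with rfl | he
        · exact ⟨_, List.mem_cons_self, hz.symm⟩
        · exact ⟨e, List.mem_cons_of_mem _ he, hz⟩)
    exact ⟨σ, hσ.congr fun τ => by simp only [unifies_cons, eq_comm]⟩
  | (.app f ts, .app g us) :: E' =>
    have h₀ := (unifies_cons.1 hU).1
    simp only [Term.subst, Term.app.injEq] at h₀
    obtain ⟨rfl, -⟩ := h₀
    -- Decomposition brings in no variables and removes the two head symbols, so the size drops.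
    have hiff : ∀ τ, Unifies (List.ofFn (fun i => (ts i, us i)) ++ E') τ ↔
        Unifies ((.app f ts, .app f us) :: E') τ := by
      intro τ
      rw [unifies_cons]
      simp only [Unifies, List.mem_append, List.mem_ofFn, Term.subst, Term.app.injEq, heq_eq_eq,
        true_and, funext_iff]
      constructor
      · exact fun h => ⟨fun i => h _ (.inl ⟨i, rfl⟩), fun e he => h e (.inr he)⟩
      · rintro ⟨h₁, h₂⟩ e (⟨i, rfl⟩ | he)
        · exact h₁ i
        · exact h₂ e he
    obtain ⟨σ, hσ⟩ := ihn (eqsSize (List.ofFn (fun i => (ts i, us i)) ++ E'))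
      (lt_of_lt_of_le (by
        simp only [eqsSize, List.map_append, List.sum_append, List.map_ofFn, List.sum_ofFn,
          Function.comp_def, Finset.sum_add_distrib, List.map_cons, List.sum_cons, Term.size]
        omega) hn)
      _ (le_trans (Set.ncard_le_ncard (by
          rintro z ⟨e, he, hz⟩
          rcases List.mem_append.1 he with he | he
          · obtain ⟨i, rfl⟩ := List.mem_ofFn.1 he
            exact ⟨_, List.mem_cons_self, hz.imp (fun h => ⟨i, h⟩) fun h => ⟨i, h⟩⟩
          · exact ⟨e, List.mem_cons_of_mem _ he, hz⟩) (eqsVars_finite _)) hk) le_rfl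
      (fun e he => by
        rcases List.mem_append.1 he with he | he
        · obtain ⟨i, rfl⟩ := List.mem_ofFn.1 he
          have := hE _ List.mem_cons_self
          exact ⟨(this.1 i).1, (this.2 i).1⟩
        · exact hE e (List.mem_cons_of_mem _ he)) ((hiff θ).2 hU)
    exact ⟨σ, hσ.congr hiff⟩

/-- Unifiable terms have a most general unifier. -/
theorem exists_mgu {s t : Term Sg} (hs : s.WS) (ht : t.WS) {θ : Var Sg → Term Sg}
    (hθ : IsSubst θ) (h : s.subst θ = t.subst θ) :
    ∃ σ, IsMGU (fun τ => s.subst τ = t.subst τ) σ := by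
  obtain ⟨σ, hσ⟩ := exists_mgu_list _ _ [(s, t)] le_rfl le_rfl (by simp [hs, ht]) hθ
    (by simpa [Unifies] using h)
  exact ⟨σ, hσ.congr fun τ => by simp [Unifies]⟩

end Unification

/-! ### Renaming apart -/

theorem Literal.vars_subst {σ : Var Sg → Term Sg} {L : Literal Sg} {y : Var Sg}
    (h : y ∈ (L.subst σ).vars) : ∃ x ∈ L.vars, y ∈ (σ x).vars := by
  obtain ⟨t, ht, hy⟩ := h
  obtain ⟨u, hu, rfl⟩ := Literal.mem_atom_subst.1 ht
  rw [Term.vars_subst] at hy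
  obtain ⟨x, hx, hy⟩ := hy
  exact ⟨x, ⟨u, hu, hx⟩, hy⟩

theorem Prog.vars_subst {σ : Var Sg → Term Sg} {p : Prog Sg} {y : Var Sg}
    (h : y ∈ (p.subst σ).vars) : ∃ x ∈ p.vars, y ∈ (σ x).vars := by
  induction p with
  | term t =>
    rw [Prog.subst, Prog.vars, Term.vars_subst] at h
    exact h
  | ite c p q ihp ihq =>
    rcases h with (h | h) | h
    · obtain ⟨x, hx, hy⟩ := Literal.vars_subst (L := ⟨true, c⟩) h
      exact ⟨x, .inl (.inl hx), hy⟩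
    · obtain ⟨x, hx, hy⟩ := ihp h
      exact ⟨x, .inl (.inr hx), hy⟩
    · obtain ⟨x, hx, hy⟩ := ihq h
      exact ⟨x, .inr hx, hy⟩

theorem AnsClause.vars_subst {σ : Var Sg → Term Sg} {A : AnsClause Sg} {y : Var Sg}
    (h : y ∈ (A.subst σ).vars) : ∃ x ∈ A.vars, y ∈ (σ x).vars := by
  rcases h with ⟨L, hL, h⟩ | h
  · obtain ⟨K, hK, rfl⟩ := Clause.mem_subst.1 hL
    obtain ⟨x, hx, hy⟩ := Literal.vars_subst h
    exact ⟨x, .inl ⟨K, hK, hx⟩, hy⟩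
  · obtain ⟨x, hx, hy⟩ := Prog.vars_subst h
    exact ⟨x, .inr hx, hy⟩

open Classical in
/-- Every instance of an answer clause is an instance of a variant that avoids given variables. -/
theorem exists_variant (A : AnsClause Sg) {V : Set (Var Sg)} (hV : V.Finite)
    {θ : Var Sg → Term Sg} (hθ : IsSubst θ) :
    ∃ P θ', A.Variant P ∧ Disjoint P.vars V ∧ IsSubst θ' ∧ P.subst θ' = A.subst θ := by
  -- Shifting indices by a strict bound on those of `A` and `V` moves every variable of `A` out of
  -- both sets.
  obtain ⟨n, hn⟩ : ∃ n, ∀ x ∈ A.vars ∪ V, x.idx < n := by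
    obtain ⟨m, hm⟩ := ((A.vars_finite.union hV).image Var.idx).bddAbove
    exact ⟨m + 1, fun x hx => Nat.lt_succ_of_le (hm ⟨x, hx, rfl⟩)⟩
  let ρ : Var Sg → Term Sg := fun x =>
    if x ∈ A.vars then .var ⟨x.sort, x.idx + n⟩ else .var x
  -- The inverse acts only on the shifted copies, since a substitution may move only finitely many
  -- variables.
  let ρ' : Var Sg → Term Sg := fun x =>
    if n ≤ x.idx ∧ (⟨x.sort, x.idx - n⟩ : Var Sg) ∈ A.vars then .var ⟨x.sort, x.idx - n⟩ else .var x
  have hρ : IsSubst ρ := by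
    refine ⟨fun x => ?_, A.vars_finite.subset fun x hx => ?_⟩
    · simp only [ρ]; split_ifs <;> exact ⟨trivial, rfl⟩
    · by_contra h
      exact hx (by simp only [ρ, if_neg h])
  have hρ' : IsSubst ρ' := by
    refine ⟨fun x => ?_, (A.vars_finite.image fun x => ⟨x.sort, x.idx + n⟩).subset fun x hx => ?_⟩
    · simp only [ρ']; split_ifs <;> exact ⟨trivial, rfl⟩
    · by_cases h : n ≤ x.idx ∧ (⟨x.sort, x.idx - n⟩ : Var Sg) ∈ A.vars
      · exact ⟨_, h.2, by simp [Nat.sub_add_cancel h.1]⟩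
      · exact absurd (by simp only [ρ', if_neg h]) hx
  have hinv : ∀ x ∈ A.vars, (ρ x).subst ρ' = .var x := by
    intro x hx
    simp [ρ, ρ', hx, Term.subst]
  have hback : (A.subst ρ).subst ρ' = A := by
    rw [AnsClause.subst_subst, AnsClause.subst_congr hinv, AnsClause.subst_var]
  refine ⟨A.subst ρ, fun x => (ρ' x).subst θ, ⟨⟨ρ, hρ, rfl⟩, ρ', hρ', hback.symm⟩, ?_,
    hρ'.comp hθ, ?_⟩
  · rw [Set.disjoint_left]
    intro y hy hyV
    obtain ⟨x, hx, hy⟩ := AnsClause.vars_subst hy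
    simp only [ρ, if_pos hx, Term.vars, Set.mem_singleton_iff] at hy
    have := hn y (.inr hyV)
    rw [hy] at this
    simp at this
  · rw [← AnsClause.subst_subst, hback]

/-! ### Production of rules by clauses -/

/-- Production of a rule by a clause, with the conditions left out. -/
def ClauseProduces (gt : Term Sg → Term Sg → Prop) (R : RewriteSystem Sg) (C : Clause Sg)
    (l r : Term Sg) : Prop :=
  ∃ D : Clause Sg, C = .eq l r ::ₘ D ∧ ¬ TrueClause R C ∧ StrictlyMaximal gt (.eq l r) D ∧
    gt l r ∧ ¬ TrueClause (R ∪ {(l, r)}) D ∧ Irreducible R l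

section Production

variable {gt : Term Sg → Term Sg → Prop} (hgt : IsSimplificationOrder gt) (Q : Set (Clause Sg))

/-- The rules produced by a clause from `Q`, by recursion on the ordering of clauses. -/
noncomputable def produced : Clause Sg → RewriteSystem Sg :=
  hgt.clauseGt_wf.fix fun C ih =>
    {ρ | C ∈ Q ∧ ClauseProduces gt {ρ' | ∃ D, ∃ h : ClauseGt gt C D, ρ' ∈ ih D h} C ρ.1 ρ.2}

/-- The rules produced by clauses smaller than `C`. -/
def producedBelow (C : Clause Sg) : RewriteSystem Sg :=
  {ρ | ∃ D, ClauseGt gt C D ∧ ρ ∈ produced hgt Q D}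

def allProduced : RewriteSystem Sg := {ρ | ∃ D, ρ ∈ produced hgt Q D}

theorem produced_eq (C : Clause Sg) :
    produced hgt Q C = {ρ | C ∈ Q ∧ ClauseProduces gt (producedBelow hgt Q C) C ρ.1 ρ.2} := by
  conv_lhs => rw [produced, WellFounded.fix_eq]
  simp only [producedBelow, produced, exists_prop]

variable {hgt Q} {C D : Clause Sg} {l r : Term Sg} {L : Literal Sg} {R R' : RewriteSystem Sg}

theorem mem_produced : (l, r) ∈ produced hgt Q C ↔
    C ∈ Q ∧ ClauseProduces gt (producedBelow hgt Q C) C l r := by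
  rw [produced_eq]; rfl

theorem produced_subset_all : produced hgt Q C ⊆ allProduced hgt Q := fun _ h => ⟨C, h⟩

theorem producedBelow_subset_all : producedBelow hgt Q C ⊆ allProduced hgt Q :=
  fun _ ⟨D, _, h⟩ => ⟨D, h⟩

theorem producedBelow_mono (h : ClauseGt gt C D) :
    producedBelow hgt Q D ∪ produced hgt Q D ⊆ producedBelow hgt Q C := by
  rintro ρ (⟨E, hE, hρ⟩ | hρ)
  · exact ⟨E, IsSimplificationOrder.clauseGt_trans h hE, hρ⟩
  · exact ⟨D, h, hρ⟩

theorem StrictlyMaximal.greatest (hgt : IsSimplificationOrder gt) (hC : Clause.Ground (L ::ₘ D))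
    (h : StrictlyMaximal gt L D) : ∀ K ∈ D, LitGt gt L K := by
  intro K hK
  have hK' := h K hK
  rw [not_or] at hK'
  exact (hgt.litGt_total (Clause.ground_iff.1 hC K (Multiset.mem_cons_of_mem hK))
    (Clause.ground_iff.1 hC L (Multiset.mem_cons_self _ _)) hK'.2).resolve_left hK'.1

theorem produced_spec (hQ : ∀ C ∈ Q, Clause.Ground C) (h : (l, r) ∈ produced hgt Q C) :
    C ∈ Q ∧ gt l r ∧ l.Ground ∧ r.Ground ∧ Irreducible (producedBelow hgt Q C) l ∧
      ¬ TrueClause (producedBelow hgt Q C) C ∧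
      ∃ D, C = .eq l r ::ₘ D ∧ ∀ K ∈ D, LitGt gt (.eq l r) K := by
  obtain ⟨hC, D, rfl, hf, hmax, hlr, -, hirr⟩ := mem_produced.1 h
  have hg := hQ _ hC
  have hL := Literal.ground_iff.1 (Clause.ground_iff.1 hg _ (Multiset.mem_cons_self _ _))
  exact ⟨hC, hlr, hL l (Sym2.mem_mk_left _ _), hL r (Sym2.mem_mk_right _ _), hirr, hf, D, rfl,
    hmax.greatest hgt hg⟩

/-- The literal of a produced rule is the greatest one of its clause. -/
theorem produced_greatest (hQ : ∀ C ∈ Q, Clause.Ground C) (h : (l, r) ∈ produced hgt Q C) :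
    ∀ K ∈ C, K = .eq l r ∨ LitGt gt (.eq l r) K := by
  obtain ⟨-, -, -, -, -, -, D, rfl, hD⟩ := produced_spec hQ h
  intro K hK
  exact (Multiset.mem_cons.1 hK).imp_right (hD K)

theorem eq_mem_of_produced (h : (l, r) ∈ produced hgt Q C) : Literal.eq l r ∈ C := by
  obtain ⟨-, D, rfl, -⟩ := mem_produced.1 h
  exact Multiset.mem_cons_self _ _

/-- A clause with a literal greater than the literal of a rule is greater than the clause that
produces the rule. -/
theorem clauseGt_of_produced (hQ : ∀ C ∈ Q, Clause.Ground C) (h : (l, r) ∈ produced hgt Q C)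
    (hL : L ∈ D) (hgtL : LitGt gt L (.eq l r)) : ClauseGt gt D C := by
  refine IsSimplificationOrder.clauseGt_of_mem hL fun K hK => ?_
  rcases produced_greatest hQ h K hK with rfl | hK
  · exact hgtL
  · exact IsSimplificationOrder.litGt_trans hgtL hK

theorem orderedGround_all (hQ : ∀ C ∈ Q, Clause.Ground C) :
    OrderedGround gt (allProduced hgt Q) := by
  refine ⟨?_, ?_, ?_⟩ <;> rintro ⟨l, r⟩ ⟨C, h⟩
  · exact (produced_spec hQ h).2.1
  · exact (produced_spec hQ h).2.2.1
  · exact (produced_spec hQ h).2.2.2.1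

/-- If the clause of the contained left-hand side is smaller, its rule was present when the other
left-hand side was tested for irreducibility. If it is greater, equal left-hand sides contradict its
own test, and a properly contained one contradicts the order of the clauses. -/
theorem overlapFree_all (hQ : ∀ C ∈ Q, Clause.Ground C) : OverlapFree (allProduced hgt Q) := by
  rintro ⟨l, r⟩ ⟨C, h⟩ ⟨l', r'⟩ ⟨D, h'⟩ hsub
  obtain ⟨hC, hlr, hl, hr, hirr, -, -⟩ := produced_spec hQ h
  obtain ⟨hD, hlr', hl', hr', hirr', -, -⟩ := produced_spec hQ h'
  dsimp only at hsub
  by_cases hCD : C = D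
  · subst hCD
    have e : Literal.eq l r = Literal.eq l' r' := by
      rcases produced_greatest hQ h _ (eq_mem_of_produced h') with e | h₁
      · exact e.symm
      · rcases produced_greatest hQ h' _ (eq_mem_of_produced h) with e | h₂
        · exact e
        · exact absurd h₁ (hgt.litGt_asymm h₂)
    simp only [Literal.eq, Literal.mk.injEq, true_and, Sym2.eq_iff] at e
    rcases e with ⟨rfl, rfl⟩ | ⟨rfl, rfl⟩
    · rfl
    · exact absurd hlr (hgt.asymm hlr')
  · exfalso
    rcases hgt.clauseGt_total (hQ _ hC) (hQ _ hD) hCD with hlt | hlt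
    · obtain ⟨u, hu⟩ := Step.of_subterm (R := producedBelow hgt Q C) ⟨D, hlt, h'⟩ hsub
      exact hirr u hu
    · rcases hgt.subterm_le hsub hl with rfl | hll
      · exact hirr' r (Step.of_mem ⟨C, hlt, h⟩)
      · refine hgt.clauseGt_asymm hlt (clauseGt_of_produced hQ h' (eq_mem_of_produced h) ?_)
        refine IsSimplificationOrder.litGt_of_mem (Sym2.mem_mk_left _ _) fun u hu => ?_
        rcases Literal.mem_mk.1 hu with rfl | rfl
        · exact hll
        · exact hgt.trans _ _ _ hll hlr'

/-- Truth of a clause persists when rules of greater clauses are added. -/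
theorem trueClause_persists (hQ : ∀ C ∈ Q, Clause.Ground C) (hC : Clause.Ground C)
    (h₀ : producedBelow hgt Q C ⊆ R) (h₁ : R ⊆ R') (h₂ : R' ⊆ allProduced hgt Q)
    (h : TrueClause R C) : TrueClause R' C := by
  obtain ⟨L, hL, h⟩ := h
  refine ⟨L, hL, ?_⟩
  have hR' := (orderedGround_all hQ).mono h₂
  have hLg := Clause.ground_iff.1 hC L hL
  cases hb : L.pos with
  | true => exact trueLit_mono hgt hR' h₁ hb h
  | false =>
    -- Added rules could falsify a disequation only by rewriting one of its sides. The literal of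
    -- such a rule is smaller than the disequation, so the producing clause is smaller than `C` and
    -- the rule was already counted.
    have h' := trueLit_anti hgt (hR'.mono h₁) h₀ hb h
    refine (trueLit_agree hgt hR' (h₀.trans h₁) hLg fun t ht ρ hρ hle => ?_).1 h'
    obtain ⟨K, hK⟩ := h₂ hρ
    obtain ⟨l, r⟩ := ρ
    obtain ⟨hKQ, hlr, hl, -⟩ := produced_spec hQ hK
    refine ⟨K, ?_, hK⟩
    have hLl : LitGt gt L (.eq l r) := by
      by_contra hn
      have := hgt.lt_lhs hlr hl hLg hn hb ht
      rcases hle with e | hle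
      · exact hgt.irrefl _ (e ▸ this)
      · exact hgt.asymm this hle
    exact clauseGt_of_produced hQ hK hL hLl

/-- The truth of literals bounded by a rule is decided by that rule and those of smaller
clauses. -/
theorem trueLit_decided (hQ : ∀ C ∈ Q, Clause.Ground C) (h : (l, r) ∈ produced hgt Q C)
    (hL : L.Ground) (hle : ¬ LitGt gt L (.eq l r))
    (h₁ : producedBelow hgt Q C ∪ {(l, r)} ⊆ R) (h₂ : R ⊆ allProduced hgt Q) :
    TrueLit (producedBelow hgt Q C ∪ {(l, r)}) L ↔ TrueLit R L := by
  obtain ⟨-, hlr, hl, -⟩ := produced_spec hQ h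
  refine trueLit_agree hgt ((orderedGround_all hQ).mono h₂) h₁ hL fun t ht ρ hρ hρt => ?_
  obtain ⟨K, hK⟩ := h₂ hρ
  obtain ⟨l', r'⟩ := ρ
  obtain ⟨-, hlr', -⟩ := produced_spec hQ hK
  dsimp only at hρt
  have hll : l' = l ∨ gt l l' := by
    rcases hgt.le_lhs hlr hl hL hle ht with rfl | htl
    · exact hρt
    · rcases hρt with rfl | hρt
      · exact .inr htl
      · exact .inr (hgt.trans _ _ _ htl hρt)
  -- A rule with left-hand side `l` is the given one by non-overlap; a smaller left-hand side
  -- belongs to a smaller clause.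
  rcases hll with rfl | hll
  · right
    exact overlapFree_all hQ _ ⟨C, h⟩ _ ⟨K, hK⟩ .refl
  · refine .inl ⟨K, clauseGt_of_produced hQ hK (eq_mem_of_produced h) ?_, hK⟩
    refine IsSimplificationOrder.litGt_of_mem (Sym2.mem_mk_left _ _) fun u hu => ?_
    rcases Literal.mem_mk.1 hu with rfl | rfl
    · exact hll
    · exact hgt.trans _ _ _ hll hlr'

end Production

/-! ### Existence and uniqueness of the model -/

section Model

variable {gt : Term Sg → Term Sg → Prop} {comp : Set Sg.Sym} {G : Set (CClause Sg)}
  {R : RewriteSystem Sg} {K : CClause Sg} {l r : Term Sg}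

/-- The truth of conditions is consulted only for uncomputable clauses, so here it has no influence.
-/
theorem produces_iff (hK : K.Computable comp) :
    Produces gt comp R K l r ↔ ClauseProduces gt R K.clause l r := by
  constructor
  · rintro ⟨C, h₁, -, h₂, -, h₃⟩
    exact ⟨C, h₁, h₂, h₃⟩
  · rintro ⟨C, h₁, h₂, h₃⟩
    exact ⟨C, h₁, hK.2, h₂, fun h => absurd hK.1 h, h₃⟩

/-- The clauses of a set of conditional clauses. -/
def clausesOf (G : Set (CClause Sg)) : Set (Clause Sg) := {C | ⟨C, []⟩ ∈ G}

/-- The model construction by clauses: only empty conditions contribute rules. -/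
noncomputable def construction (hgt : IsSimplificationOrder gt) (G : Set (CClause Sg)) (K : G) :
    RewriteSystem Sg :=
  {ρ | K.1.cond = [] ∧ ρ ∈ produced hgt (clausesOf G) K.1.clause}

theorem trueClause_of_mem (hgt : IsSimplificationOrder gt) (hR : OrderedGround gt R)
    (h : (l, r) ∈ R) {C : Clause Sg} (hC : Literal.eq l r ∈ C) : TrueClause R C :=
  ⟨_, hC, (trueLit_pos_iff hgt hR).2 (.of_rtg (.single (.of_mem h)))⟩

/-- Closure under dropping conditions is what makes the recursion well-defined. The ordering on
conditions need not be well-founded (`[K] ≻ [L, K] ≻ [L, L, K] ≻ …` whenever `K ≻ L`), so the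
induction runs over clauses, and all conditions of one clause are treated at once by comparison with
the empty one. -/
theorem isModelConstruction_iff (hgt : IsSimplificationOrder gt)
    (hG : ∀ K ∈ G, K.Ground ∧ K.Computable comp ∧ (⟨K.clause, []⟩ : CClause Sg) ∈ G)
    {E : G → RewriteSystem Sg} :
    IsModelConstruction gt comp G E ↔ E = construction hgt G := by
  have hQ : ∀ C ∈ clausesOf G, Clause.Ground C := fun C hC => (hG _ hC).1.1
  have hbelow : ∀ (E : G → RewriteSystem Sg) (K : G),
      (∀ D : G, ClauseGt gt K.1.clause D.1.clause → E D = construction hgt G D) →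
      below gt E K.1 = producedBelow hgt (clausesOf G) K.1.clause ∪
        {ρ | ∃ D : G, K.1.clause = D.1.clause ∧ CondGt gt K.1.cond D.1.cond ∧ ρ ∈ E D} := by
    intro E K hE
    ext ρ
    constructor
    · rintro ⟨D, hD | ⟨h₁, h₂⟩, hρ⟩
      · rw [hE D hD] at hρ
        exact .inl ⟨_, hD, hρ.2⟩
      · exact .inr ⟨D, h₁, h₂, hρ⟩
    · rintro (⟨D, hD, hρ⟩ | ⟨D, h₁, h₂, hρ⟩)
      · have hDG : (⟨D, []⟩ : CClause Sg) ∈ G := (mem_produced.1 hρ).1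
        refine ⟨⟨_, hDG⟩, .inl hD, ?_⟩
        rw [hE ⟨_, hDG⟩ hD]
        exact ⟨rfl, hρ⟩
      · exact ⟨D, .inr ⟨h₁, h₂⟩, hρ⟩
  constructor
  · intro hE
    have hrules : ∀ (K : G) (l r : Term Sg), (l, r) ∈ E K → Literal.eq l r ∈ K.1.clause ∧ gt l r := by
      intro K l r h
      rw [hE K] at h
      obtain ⟨C, h₁, -, -, -, -, h₂, -⟩ := h
      exact ⟨h₁ ▸ Multiset.mem_cons_self _ _, h₂⟩
    -- Orderedness is read off from the recursion itself, since nothing is yet known about how `E`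
    -- compares with `construction`.
    have hord : ∀ K : CClause Sg, OrderedGround gt (below gt E K) := by
      intro K
      refine ⟨?_, ?_, ?_⟩ <;> rintro ⟨l, r⟩ ⟨D, -, h⟩ <;> have h := hrules D l r h
      · exact h.2
      · exact Literal.ground_iff.1 (Clause.ground_iff.1 (hG _ D.2).1.1 _ h.1) l
          (Sym2.mem_mk_left _ _)
      · exact Literal.ground_iff.1 (Clause.ground_iff.1 (hG _ D.2).1.1 _ h.1) r
          (Sym2.mem_mk_right _ _)
    suffices h : ∀ (C : Clause Sg) (K : G), K.1.clause = C → E K = construction hgt G K from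
      funext fun K => h _ K rfl
    intro C
    induction C using hgt.clauseGt_wf.induction with | _ C ih
    rintro K rfl
    have hb : ∀ K' : G, K'.1.clause = K.1.clause → below gt E K'.1 = _ := fun K' e =>
      hbelow E K' fun D hD => ih _ (e ▸ hD) D rfl
    have hnil : ∀ K' : G, K'.1.clause = K.1.clause → K'.1.cond = [] →
        E K' = produced hgt (clausesOf G) K.1.clause := by
      intro K' e hc
      ext ⟨l, r⟩
      have hK' : K.1.clause ∈ clausesOf G := (hG _ K.2).2.2
      rw [hE K', Set.mem_ofPred_eq, produces_iff (hG _ K'.2).2.1, hb K' e, mem_produced, e]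
      have : {ρ | ∃ D : G, K.1.clause = D.1.clause ∧ CondGt gt K'.1.cond D.1.cond ∧ ρ ∈ E D} =
          (∅ : RewriteSystem Sg) := by
        rw [Set.eq_empty_iff_forall_notMem]
        rintro ρ ⟨D, -, h, -⟩
        rw [hc] at h
        cases h
      rw [this, Set.union_empty]
      exact ⟨fun h => ⟨hK', h⟩, fun h => h.2⟩
    by_cases hc : K.1.cond = []
    · rw [hnil K rfl hc]
      ext ρ
      exact ⟨fun h => ⟨hc, h⟩, fun h => h.2⟩
    · have : construction hgt G K = ∅ := by
        rw [Set.eq_empty_iff_forall_notMem]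
        exact fun ρ hρ => hc hρ.1
      rw [this, Set.eq_empty_iff_forall_notMem]
      rintro ⟨l, r⟩ hρ
      have hρ' := hρ
      rw [hE K, Set.mem_ofPred_eq, produces_iff (hG _ K.2).2.1] at hρ'
      obtain ⟨-, -, hf, -⟩ := id hρ'
      -- A rule produced earlier from the same clause would make that clause true below `K`.
      have hnone : ∀ D : G, K.1.clause = D.1.clause → CondGt gt K.1.cond D.1.cond →
          ∀ ρ, ρ ∉ E D := by
        rintro D h₁ h₂ ⟨l', r'⟩ h'
        refine hf (trueClause_of_mem hgt (hord _) ⟨D, .inr ⟨h₁, h₂⟩, h'⟩ ?_)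
        rw [h₁]
        exact (hrules D l' r' h').1
      rw [hb K rfl] at hρ'
      have hempty : {ρ | ∃ D : G, K.1.clause = D.1.clause ∧ CondGt gt K.1.cond D.1.cond ∧
          ρ ∈ E D} = (∅ : RewriteSystem Sg) := by
        rw [Set.eq_empty_iff_forall_notMem]
        rintro ρ ⟨D, h₁, h₂, h₃⟩
        exact hnone D h₁ h₂ ρ h₃
      rw [hempty, Set.union_empty] at hρ'
      -- With no rules from the same clause, `K` and its condition-free version face the same
      -- system. The latter would then produce the rule as well, against `hnone`.
      have hK₀ := (hG _ K.2).2.2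
      refine hnone ⟨_, hK₀⟩ rfl ?_ (l, r) ?_
      · cases hcc : K.1.cond with
        | nil => exact absurd hcc hc
        | cons L ls => exact .nil L ls
      · rw [hnil ⟨_, hK₀⟩ rfl rfl, mem_produced]
        exact ⟨hK₀, hρ'⟩
  · rintro rfl K
    have hb := hbelow (construction hgt G) K fun D _ => rfl
    ext ⟨l, r⟩
    have hK₀ : K.1.clause ∈ clausesOf G := (hG _ K.2).2.2
    rw [Set.mem_ofPred_eq, produces_iff (hG _ K.2).2.1, hb]
    have hsame : {ρ | ∃ D : G, K.1.clause = D.1.clause ∧ CondGt gt K.1.cond D.1.cond ∧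
        ρ ∈ construction hgt G D} =
        {ρ | K.1.cond ≠ [] ∧ ρ ∈ produced hgt (clausesOf G) K.1.clause} := by
      ext ρ
      constructor
      · rintro ⟨D, h₁, h₂, -, h₃⟩
        refine ⟨fun e => ?_, h₁ ▸ h₃⟩
        rw [e] at h₂
        cases h₂
      · rintro ⟨h₁, h₂⟩
        refine ⟨⟨_, hK₀⟩, rfl, ?_, rfl, h₂⟩
        cases hcc : K.1.cond with
        | nil => exact absurd hcc h₁
        | cons L ls => exact .nil L ls
    rw [hsame]
    by_cases hc : K.1.cond = []
    · have : {ρ | K.1.cond ≠ [] ∧ ρ ∈ produced hgt (clausesOf G) K.1.clause} =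
          (∅ : RewriteSystem Sg) := by
        rw [Set.eq_empty_iff_forall_notMem]
        exact fun ρ hρ => hρ.1 hc
      rw [this, Set.union_empty]
      exact ⟨fun h => (mem_produced.1 h.2).2, fun h => ⟨hc, mem_produced.2 ⟨hK₀, h⟩⟩⟩
    · have : {ρ | K.1.cond ≠ [] ∧ ρ ∈ produced hgt (clausesOf G) K.1.clause} =
          produced hgt (clausesOf G) K.1.clause := by
        ext ρ
        exact ⟨fun h => h.2, fun h => ⟨hc, h⟩⟩
      rw [this]
      refine ⟨fun h => absurd h.1 hc, fun h => ?_⟩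
      exfalso
      obtain ⟨-, -, hf, -⟩ := id h
      -- If the condition-free clause produces nothing, `K` repeats its failed test; otherwise the
      -- clause is already true.
      by_cases hp : produced hgt (clausesOf G) K.1.clause = ∅
      · rw [hp, Set.union_empty] at h
        have := mem_produced.2 ⟨hK₀, h⟩
        rw [hp] at this
        exact this
      · obtain ⟨⟨l', r'⟩, hρ⟩ := Set.nonempty_iff_ne_empty.2 hp
        refine hf (trueClause_of_mem hgt ((orderedGround_all (hgt := hgt) hQ).mono ?_) (.inr hρ)
          (eq_mem_of_produced hρ))
        exact Set.union_subset producedBelow_subset_all produced_subset_all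

theorem total_construction (hgt : IsSimplificationOrder gt) (G : Set (CClause Sg)) :
    total (construction hgt G) = allProduced hgt (clausesOf G) := by
  ext ρ
  constructor
  · rintro ⟨K, -, h⟩
    exact ⟨_, h⟩
  · rintro ⟨C, h⟩
    exact ⟨⟨⟨C, []⟩, (mem_produced (l := ρ.1) (r := ρ.2).1 h).1⟩, rfl, h⟩

end Model

/-! ### Invariants of derivations -/

section Derivations

variable {gt : Term Sg → Term Sg → Prop} {comp : Set Sg.Sym}

theorem Clause.ws_cons {L : Literal Sg} {C : Clause Sg} : WS (L ::ₘ C) ↔ L.WS ∧ WS C := by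
  simp [WS]

theorem Clause.ws_add {C D : Clause Sg} : WS (C + D) ↔ WS C ∧ WS D := by
  simp [WS, or_imp, forall_and]

theorem sort_eq_of_subst_eq {σ : Var Sg → Term Sg} (hσ : IsSubst σ) {s t : Term Sg}
    (h : s.subst σ = t.subst σ) : s.sort = t.sort := by
  rw [← Term.sort_subst hσ s, h, Term.sort_subst hσ]

theorem ws_superposition {σ : Var Sg → Term Sg} (hσ : IsSubst σ) {l r s t l' : Term Sg} {b : Bool}
    {C D : Clause Sg} (h₁ : Clause.WS (.eq l r ::ₘ C)) (h₂ : Clause.WS (.mk' b s t ::ₘ D))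
    (h : l.subst σ = l'.subst σ) :
    Clause.WS (Clause.subst σ (.mk' b (s.replace l' r) t ::ₘ (C + D))) := by
  refine Clause.WS.subst hσ ?_
  rw [Clause.ws_cons] at h₁ h₂ ⊢
  rw [Clause.ws_add]
  obtain ⟨hl, hr, hlr⟩ := Literal.ws_mk.1 h₁.1
  obtain ⟨hs, ht, hst⟩ := Literal.ws_mk.1 h₂.1
  have hsort : r.sort = l'.sort := hlr.symm.trans (sort_eq_of_subst_eq hσ h)
  exact ⟨Literal.ws_mk.2 ⟨hs.replace hr hsort, ht, (Term.sort_replace hsort).trans hst⟩, h₁.2, h₂.2⟩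

theorem Inference.ws {Ps : List (AnsClause Sg)} {σ : Var Sg → Term Sg} {A : AnsClause Sg}
    (h : Inference gt comp Ps σ A) (hPs : ∀ P ∈ Ps, Clause.WS P.clause) : Clause.WS A.clause := by
  cases h with
  | supC l r s t l' b C D p q σ _ _ _ _ mgu =>
    exact ws_superposition mgu.1 (hPs _ List.mem_cons_self)
      (hPs _ (List.mem_cons_of_mem _ List.mem_cons_self)) mgu.2.1
  | supU l r s t l' b C D p q σ _ _ _ _ mgu =>
    exact ws_superposition mgu.1 (hPs _ List.mem_cons_self)
      (hPs _ (List.mem_cons_of_mem _ List.mem_cons_self)) mgu.2.1.1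
  | eqRes s t C p σ _ mgu =>
    have := hPs _ (List.mem_singleton.2 rfl)
    exact (Clause.ws_cons.1 this).2.subst mgu.1
  | eqFac s t l r C p σ _ mgu =>
    have := hPs _ (List.mem_singleton.2 rfl)
    simp only [Clause.ws_cons] at this
    obtain ⟨h₁, h₂, h₃⟩ := this
    refine Clause.WS.subst mgu.1 ?_
    simp only [Clause.ws_cons]
    refine ⟨h₁, ?_, h₃⟩
    obtain ⟨-, ht, hst⟩ := Literal.ws_mk.1 h₁
    obtain ⟨-, hr, hlr⟩ := Literal.ws_mk.1 h₂
    exact Literal.ws_mk.2 ⟨ht, hr, hst.symm.trans ((sort_eq_of_subst_eq mgu.1 mgu.2.1).trans hlr)⟩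

theorem Inference.ans_computable {Ps : List (AnsClause Sg)} {σ : Var Sg → Term Sg}
    {A : AnsClause Sg} (h : Inference gt comp Ps σ A) : A.ans.Computable comp := by
  cases h <;> assumption

theorem Abs.ws {A B : AnsClause Sg} (h : Abs gt comp A B) (hA : Clause.WS A.clause) :
    Clause.WS B.clause := by
  obtain ⟨s, t, k, b, C, p, x, -, occ, -, -, -, -, -, hsort⟩ := h
  simp only [Clause.ws_cons] at hA ⊢
  obtain ⟨hs, ht, hst⟩ := Literal.ws_mk.1 hA.1
  have hx : (Term.var x : Term Sg).sort = k.sort := hsort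
  exact ⟨Literal.ws_mk.2 ⟨hs.replace trivial hx, ht, (Term.sort_replace hx).trans hst⟩,
    Literal.ws_mk.2 ⟨trivial, occ.ws hs, hx⟩, hA.2⟩

/-- Well-sortedness is needed twice: to obtain most general unifiers that preserve sorts, and to
remain among substitutions when their values are rewritten. -/
theorem Derivable.ws {I : Set (AnsClause Sg)} (hI : ∀ A ∈ I, Clause.WS A.clause)
    {A : AnsClause Sg} (h : Derivable gt comp I A) : Clause.WS A.clause := by
  induction h with
  | init A hA => exact hI A hA
  | infer Ps σ A h _ ih => exact h.ws ih
  | abs A B h _ ih => exact h.ws ih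
  | variant A B h _ ih =>
    obtain ⟨⟨ρ, hρ, rfl⟩, -⟩ := h
    exact ih.subst hρ

theorem AnsClause.Variant.ans_computable {A B : AnsClause Sg} (h : A.Variant B)
    (hA : A.ans.Computable comp) : B.ans.Computable comp := by
  obtain ⟨-, ρ, hρ, rfl⟩ := h
  exact Prog.Computable.of_subst hA

theorem AnsClause.Variant.ws {A B : AnsClause Sg} (h : A.Variant B) (hA : Clause.WS A.clause) :
    Clause.WS B.clause := by
  obtain ⟨⟨ρ, hρ, rfl⟩, -⟩ := h
  exact hA.subst hρ

/-- The initial answer is a variable, every inference rule demands a computable answer of its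
conclusion, and abstraction and renaming keep answers computable. -/
theorem Derivable.ans_computable {I : Set (AnsClause Sg)}
    (hI : ∀ A ∈ I, A.ans.Computable comp) {A : AnsClause Sg} (h : Derivable gt comp I A) :
    A.ans.Computable comp := by
  induction h with
  | init A hA => exact hI A hA
  | infer Ps σ A h _ ih => exact h.ans_computable
  | abs A B h _ ih => cases h; exact ih
  | variant A B h _ ih => exact h.ans_computable ih

/-! ### Instances of abstracted clauses -/

theorem IsSimplificationOrder.subst_gt_of_proper (hgt : IsSimplificationOrder gt) {k s : Term Sg}
    (h : k.Subterm s) (hne : k ≠ s) {θ : Var Sg → Term Sg} (hs : (s.subst θ).Ground) :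
    gt (s.subst θ) (k.subst θ) := by
  cases h with
  | refl => exact absurd rfl hne
  | arg f ts i h =>
    have h₁ := hgt.gt_arg hs i
    rcases hgt.subterm_le (h.subst θ) (Term.ground_app.1 hs i) with e | h₂
    · rw [e]; exact h₁
    · exact hgt.trans _ _ _ h₁ h₂

/-- Abstraction adds to every computable ground instance only false literals that are smaller
than some literal of that instance. -/
theorem exists_abs_instance (hgt : IsSimplificationOrder gt) {A B : AnsClause Sg}
    (h : Relation.ReflTransGen (Abs gt comp) A B) (hA : Clause.WS A.clause)
    {θ : Var Sg → Term Sg} (hθ : IsSubst θ) (hg : Clause.Ground (Clause.subst θ A.clause))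
    (hc : Clause.Computable comp (Clause.subst θ A.clause)) :
    Clause.WS B.clause ∧ ∃ θ', IsSubst θ' ∧ ∃ U : Clause Sg,
      Clause.subst θ' B.clause = Clause.subst θ A.clause + U ∧
      ∀ L ∈ U, (∃ u : Term Sg, L = .neq u u ∧ u.Ground ∧ u.Computable comp) ∧
        ∃ K ∈ Clause.subst θ A.clause, LitGt gt K L := by
  induction h with
  | refl => exact ⟨hA, θ, hθ, 0, by simp, by simp⟩
  | @tail B B' _ hab ih =>
    obtain ⟨hB, θ', hθ', U, hU, hprop⟩ := ih
    refine ⟨hab.ws hB, ?_⟩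
    obtain ⟨s, t, k, b, C, p, x, -, occ, -, sep, -, -, fresh, hsort⟩ := hab
    -- Separability would be contradictory for `k = s`. Hence `k` is a proper subterm, and its
    -- ground instance is strictly smaller than that of `s`.
    have hne : k ≠ s := by
      rintro rfl
      obtain ⟨τ, -, h₁, h₂⟩ := sep
      exact h₁ h₂
    have hgU : ∀ L ∈ Clause.subst θ A.clause + U, L.Ground ∧ L.Computable comp := by
      intro L hL
      rcases Multiset.mem_add.1 hL with hL | hL
      · exact ⟨Clause.ground_iff.1 hg L hL, hc L hL⟩
      · obtain ⟨⟨u, rfl, h₁, h₂⟩, -⟩ := hprop L hL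
        refine ⟨Literal.ground_iff.2 fun w hw => ?_, fun w hw => ?_⟩ <;>
        · rcases Literal.mem_mk.1 hw with rfl | rfl <;> assumption
    have hmem : (Literal.mk' b s t).subst θ' ∈ Clause.subst θ A.clause + U := by
      rw [← hU, Clause.subst_cons]; exact Multiset.mem_cons_self _ _
    have hs_mem : s.subst θ' ∈ ((Literal.mk' b s t).subst θ').atom :=
      Literal.mem_atom_subst.2 ⟨s, Sym2.mem_mk_left _ _, rfl⟩
    have hsg : (s.subst θ').Ground := Literal.ground_iff.1 (hgU _ hmem).1 _ hs_mem
    have hsc : (s.subst θ').Computable comp := (hgU _ hmem).2 _ hs_mem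
    have hkg : (k.subst θ').Ground := (occ.subst θ').ground hsg
    have hkc : (k.subst θ').Computable comp := (occ.subst θ').computable hsc
    have hks : gt (s.subst θ') (k.subst θ') := hgt.subst_gt_of_proper occ hne hsg
    have hsW : s.WS := (Literal.ws_mk.1 (Clause.ws_cons.1 hB).1).1
    classical
    -- Sending the fresh variable to the instance of `k` restores the abstracted literal and turns
    -- the new one into `kθ' ≉ kθ'`.
    let θ'' : Var Sg → Term Sg := Function.update θ' x (k.subst θ')
    have hθ'' : IsSubst θ'' := hθ'.update ((occ.ws hsW).subst hθ')
      ((Term.sort_subst hθ' k).trans hsort.symm)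
    have hagree : ∀ y ∈ AnsClause.vars ⟨.mk' b s t ::ₘ C, p⟩, θ'' y = θ' y := by
      intro y hy
      have : y ≠ x := fun e => fresh (e ▸ hy)
      simp [θ'', this]
    have hvs : ∀ y ∈ (Literal.mk' b s t).vars, θ'' y = θ' y := fun y hy =>
      hagree y (.inl ⟨_, Multiset.mem_cons_self _ _, hy⟩)
    have hss : s.subst θ'' = s.subst θ' := Term.subst_congr fun y hy =>
      hvs y ⟨s, Sym2.mem_mk_left _ _, hy⟩
    have htt : t.subst θ'' = t.subst θ' := Term.subst_congr fun y hy =>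
      hvs y ⟨t, Sym2.mem_mk_right _ _, hy⟩
    have hkk : k.subst θ'' = k.subst θ' := Term.subst_congr fun y hy =>
      hvs y ⟨s, Sym2.mem_mk_left _ _, occ.vars_subset hy⟩
    have hCC : Clause.subst θ'' C = Clause.subst θ' C := Clause.subst_congr fun y hy => by
      obtain ⟨L, hL, hy⟩ := hy
      exact hagree y (.inl ⟨L, Multiset.mem_cons_of_mem hL, hy⟩)
    have hx : (Term.var x).subst θ'' = k.subst θ' := by simp [Term.subst, θ'']
    have hrep : (s.replace k (.var x)).subst θ'' = s.subst θ' := by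
      rw [Term.replace_subst_of_subst_eq (hx.trans hkk.symm), hss]
    refine ⟨θ'', hθ'', .neq (k.subst θ') (k.subst θ') ::ₘ U, ?_, fun L hL => ?_⟩
    · rw [Clause.subst_cons] at hU
      rw [Clause.subst_cons, Clause.subst_cons, hCC, Multiset.add_cons, ← hU, Multiset.cons_swap]
      congr 1
      · simp only [Literal.neq, Literal.subst, Sym2.map_mk, hx, hkk]
      · congr 1
        simp only [Literal.mk', Literal.subst, Sym2.map_mk, hrep, htt]
    · rcases Multiset.mem_cons.1 hL with rfl | hL
      · refine ⟨⟨_, rfl, hkg, hkc⟩, ?_⟩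
        have hlt : LitGt gt ((Literal.mk' b s t).subst θ') (.neq (k.subst θ') (k.subst θ')) := by
          refine IsSimplificationOrder.litGt_of_mem hs_mem fun u hu => ?_
          rcases Literal.mem_mk.1 hu with rfl | rfl <;> exact hks
        -- The abstracted literal may itself stem from an earlier abstraction; then the literal
        -- dominating it is used.
        rcases Multiset.mem_add.1 hmem with hm | hm
        · exact ⟨_, hm, hlt⟩
        · obtain ⟨-, K, hK, hKL⟩ := hprop _ hm
          exact ⟨K, hK, IsSimplificationOrder.litGt_trans hKL hlt⟩
      · exact hprop L hL

end Derivations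

/-! ### The clauses of the computable grounding -/

section Grounding

/-- Follow the branch that yields `K` to where it stops, at a simple term or at a clause without
`y`. The program found there gives the same clause with no condition collected. -/
theorem iteNF_spec {C : Clause Sg} {y : Var Sg} {t : Prog Sg} (ht : t.HasSort y.sort)
    {K : CClause Sg} (hK : K ∈ iteNF C y t) :
    (∃ ρ, IsSubst ρ ∧ K.clause = Clause.subst ρ C) ∧
      ∃ t' : Prog Sg, t'.HasSort y.sort ∧ (⟨K.clause, []⟩ : CClause Sg) ∈ iteNF C y t' := by
  induction t generalizing K with
  | term t =>
    obtain rfl : K = _ := hK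
    exact ⟨⟨_, isSubst_single ht.1 ht.2, rfl⟩, .term t, ht, rfl⟩
  | ite c p q ihp ihq =>
    have hK₀ := hK
    simp only [iteNF] at hK
    split_ifs at hK with hy
    · rcases hK with ⟨D, hD, rfl⟩ | ⟨D, hD, rfl⟩
      · exact ihp (K := D) ht.2.1 hD
      · exact ihq (K := D) ht.2.2 hD
    · obtain rfl : K = _ := hK
      exact ⟨⟨_, isSubst_var, (Clause.subst_var C).symm⟩, _, ht, hK₀⟩

variable {Λ : Specification Sg} {N : ClausalForm Λ} {S : Set (AnsClause Sg)}

theorem cgr_spec {K : CClause Sg} (hK : K ∈ CGr N S) :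
    K.Ground ∧ K.Computable Λ.comp ∧ (⟨K.clause, []⟩ : CClause Sg) ∈ CGr N S := by
  obtain ⟨hg, hc, h⟩ := hK
  refine ⟨hg, hc, ⟨hg.1, by simp⟩, ⟨hc.1, by simp⟩, ?_⟩
  rcases h with ⟨C, hC, t, ht, K', hK', θ, hθ, rfl⟩ | ⟨A, hA, θ, hθ, rfl⟩
  · obtain ⟨-, t', ht', hmem⟩ := iteNF_spec ht hK'
    exact .inl ⟨C, hC, t', ht', _, hmem, θ, hθ, rfl⟩
  · exact .inr ⟨A, hA, θ, hθ, rfl⟩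

theorem clausesOf_cgr {C : Clause Sg} (hC : C ∈ clausesOf (CGr N S)) :
    Clause.Ground C ∧ Clause.Computable Λ.comp C ∧
      ((∃ C' ∈ N.clauses, ∃ θ, IsSubst θ ∧ C = Clause.subst θ C') ∨
        ∃ A ∈ S, ∃ θ, IsSubst θ ∧ C = Clause.subst θ A.clause) := by
  obtain ⟨hg, hc, h⟩ := hC
  refine ⟨hg.1, hc.1, ?_⟩
  rcases h with ⟨D, hD, t, ht, K', hK', θ, hθ, h⟩ | ⟨A, hA, θ, hθ, h⟩
  · obtain ⟨⟨ρ, hρ, e⟩, -⟩ := iteNF_spec ht hK'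
    refine .inl ⟨D, hD, _, hρ.comp hθ, ?_⟩
    rw [← Clause.subst_subst, ← e]
    exact congrArg CClause.clause h
  · exact .inr ⟨A, hA, θ, hθ, congrArg CClause.clause h⟩

theorem mem_clausesOf_cgr {A : AnsClause Sg} (hA : A ∈ S) {θ : Var Sg → Term Sg} (hθ : IsSubst θ)
    (hg : Clause.Ground (Clause.subst θ A.clause))
    (hc : Clause.Computable Λ.comp (Clause.subst θ A.clause)) :
    Clause.subst θ A.clause ∈ clausesOf (CGr N S) :=
  ⟨⟨hg, by simp⟩, ⟨hc, by simp⟩, .inr ⟨A, hA, θ, hθ, rfl⟩⟩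

end Grounding

/-! ### Consequences of saturation for ground instances -/

/-- The computable ground instances of the clauses of `S`. -/
def compInstances (comp : Set Sg.Sym) (S : Set (AnsClause Sg)) : Set (Clause Sg) :=
  {C | Clause.Ground C ∧ Clause.Computable comp C ∧
    ∃ A ∈ S, ∃ θ, IsSubst θ ∧ C = Clause.subst θ A.clause}

/-- What the completeness argument uses about a saturated set. -/
structure SaturatedSet (gt : Term Sg → Term Sg → Prop) (comp : Set Sg.Sym)
    (S : Set (AnsClause Sg)) : Prop where
  inhabited : ∀ a : Sg.Srt, ∃ t : Term Sg, t.WS ∧ t.sort = a ∧ t.Ground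
  order : IsSimplificationOrder gt
  partitioned : IsPartitioned comp gt
  ws : ∀ A ∈ S, Clause.WS A.clause
  ans : ∀ A ∈ S, A.ans.Computable comp
  saturated : Saturated gt comp S
  nonempty : ∀ p : Prog Sg, p.Computable comp → (⟨0, p⟩ : AnsClause Sg) ∉ S

/-- `P` is a variant of a non-redundant member of `S`, with variables outside `V`, and `C` is its
instance under the computable substitution `θ`. -/
structure Premise (gt : Term Sg → Term Sg → Prop) (comp : Set Sg.Sym) (S : Set (AnsClause Sg))
    (V : Set (Var Sg)) (P : AnsClause Sg) (θ : Var Sg → Term Sg) (C : Clause Sg) : Prop where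
  variant : ∃ B ∈ S, B.Variant P ∧ ¬ Redundant gt S B
  disjoint : Disjoint P.vars V
  isSubst : IsSubst θ
  computable : ∀ x, (θ x).Computable comp
  ground : Clause.Ground C
  subst_eq : Clause.subst θ P.clause = C

theorem Clause.subst_eq_cons {θ : Var Sg → Term Sg} {C D : Clause Sg} {L : Literal Sg}
    (h : Clause.subst θ C = L ::ₘ D) :
    ∃ K E, C = K ::ₘ E ∧ K.subst θ = L ∧ Clause.subst θ E = D := by
  classical
  obtain ⟨K, hK, h₁, h₂⟩ := (Multiset.map_eq_cons _ _ _ _).2 h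
  exact ⟨K, C.erase K, (Multiset.cons_erase hK).symm, h₁, h₂⟩

/-- The literal ordering is stable under substitutions, so maximality in an instance lifts to the
clause. -/
theorem selected_of_subst {gt : Term Sg → Term Sg → Prop} (hgt : IsSimplificationOrder gt)
    {θ : Var Sg → Term Sg} (hθ : IsSubst θ) {L : Literal Sg} {C : Clause Sg}
    (h : ∀ K ∈ Clause.subst θ C, ¬ LitGt gt K (L.subst θ)) : Selected gt L C :=
  fun K hK hKL => h _ (Clause.mem_subst.2 ⟨K, hK, rfl⟩) (hgt.litGt_subst hθ hKL)

theorem not_trueClause_cons {R : RewriteSystem Sg} {L : Literal Sg} {C : Clause Sg} :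
    ¬ TrueClause R (L ::ₘ C) ↔ ¬ TrueLit R L ∧ ¬ TrueClause R C := by
  simp [TrueClause]

/-- Redundancy refers to ground answer clauses, while the answer may contain variables foreign to
the clause; grounding these leaves the clause instance untouched. -/
theorem exists_clause_grounding
    (inhabited : ∀ a : Sg.Srt, ∃ t : Term Sg, t.WS ∧ t.sort = a ∧ t.Ground) (A : AnsClause Sg)
    {θ : Var Sg → Term Sg} (hθ : IsSubst θ) (hg : Clause.Ground (Clause.subst θ A.clause)) :
    ∃ θ', IsSubst θ' ∧ (A.subst θ').Ground ∧ (A.subst θ').clause = Clause.subst θ A.clause := by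
  obtain ⟨γ, hγ, hV⟩ := exists_grounding inhabited (A.subst θ).vars_finite
  refine ⟨_, hθ.comp hγ, ?_, ?_⟩ <;> rw [← AnsClause.subst_subst]
  · exact AnsClause.ground_subst hV
  · exact hg.subst γ

/-! ### Minimal false instances: equality resolution and factoring -/

namespace SaturatedSet

variable {gt : Term Sg → Term Sg → Prop} {comp : Set Sg.Sym} {S : Set (AnsClause Sg)}
  {R : RewriteSystem Sg} {C D F : Clause Sg} {A P : AnsClause Sg} {θ σ τ : Var Sg → Term Sg}
  {V : Set (Var Sg)} {l r s t : Term Sg}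

/-- Redundancy ranges over all ground instances of `S`, but below a computable clause only
computable ones remain. -/
theorem mem_compInstances (h : SaturatedSet gt comp S) (hC : Clause.Ground C)
    (hc : Clause.Computable comp C) (hD : D ∈ groundInstances S) (hCD : ClauseGt gt C D) :
    D ∈ compInstances comp S := by
  obtain ⟨A, hA, θ, hθ, hg, rfl⟩ := hD
  have hg' : Clause.Ground (A.subst θ).clause := hg.clause
  exact ⟨hg', h.order.clause_computable_of_gt h.partitioned hC hg' hc hCD, A, hA, θ, hθ, rfl⟩

theorem entails_compInstances (h : SaturatedSet gt comp S) (hA : Redundant gt S A)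
    (hθ : IsSubst θ) (hg : Clause.Ground (Clause.subst θ A.clause))
    (hc : Clause.Computable comp (Clause.subst θ A.clause)) :
    Entails {D | D ∈ compInstances comp S ∧ ClauseGt gt (Clause.subst θ A.clause) D}
      (Clause.subst θ A.clause) := by
  obtain ⟨θ', hθ', hg', e⟩ := exists_clause_grounding h.inhabited A hθ hg
  have := hA θ' hθ' hg'
  rw [e] at this
  exact fun M hM => this M fun D hD => hM D ⟨h.mem_compInstances hg hc hD.1 hD.2, hD.2⟩

/-- If the clause were redundant, its instance would follow from smaller instances, all of which are
true. -/
theorem not_redundant (h : SaturatedSet gt comp S) (hR : OrderedGround gt R)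
    (hO : OverlapFree R) (hθ : IsSubst θ) (hg : Clause.Ground (Clause.subst θ A.clause))
    (hc : Clause.Computable comp (Clause.subst θ A.clause))
    (hlt : ∀ D ∈ compInstances comp S, ClauseGt gt (Clause.subst θ A.clause) D → TrueClause R D)
    (hf : ¬ TrueClause R (Clause.subst θ A.clause)) : ¬ Redundant gt S A := fun hA =>
  hf (trueClause_of_entails h.inhabited h.order hR hO (fun D hD => ⟨hD.1.1, hlt D hD.1 hD.2⟩) hg
    (h.entails_compInstances hA hθ hg hc))

open Classical in
theorem exists_premise (h : SaturatedSet gt comp S) (hR : OrderedGround gt R)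
    (hO : OverlapFree R) (hC : C ∈ compInstances comp S)
    (hlt : ∀ D ∈ compInstances comp S, ClauseGt gt C D → TrueClause R D)
    (hf : ¬ TrueClause R C) (hV : V.Finite) : ∃ P θ, Premise gt comp S V P θ C := by
  obtain ⟨hg, hc, A, hA, θ, hθ, rfl⟩ := hC
  obtain ⟨P, θ', hP, hPV, hθ', e⟩ := exists_variant A hV hθ
  have e' : Clause.subst θ' P.clause = Clause.subst θ A.clause := congrArg AnsClause.clause e
  -- Outside the clause nothing is known about the computability of `θ'`, so it is reset there to
  -- the identity, whose values are computable.
  have e'' : Clause.subst (fun x => if x ∈ Clause.vars P.clause then θ' x else .var x) P.clause =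
      Clause.subst θ A.clause := by
    rw [← e']
    exact Clause.subst_congr fun x hx => if_pos hx
  refine ⟨P, _, ⟨⟨A, hA, hP, h.not_redundant hR hO hθ hg hc hlt hf⟩, hPV,
    hθ'.piecewise isSubst_var _, fun x => ?_, hg, e''⟩⟩
  split_ifs with hx
  · rw [← e'] at hc
    exact (Clause.computable_subst_iff.1 hc).2 x hx
  · exact Term.computable_var comp x

theorem ws_premise (h : SaturatedSet gt comp S) (hP : Premise gt comp S V P θ C) :
    Clause.WS P.clause := by
  obtain ⟨B, hB, hv, -⟩ := hP.variant
  exact hv.ws (h.ws B hB)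

theorem ans_premise (h : SaturatedSet gt comp S) (hP : Premise gt comp S V P θ C) :
    P.ans.Computable comp := by
  obtain ⟨B, hB, hv, -⟩ := hP.variant
  exact hv.ans_computable (h.ans B hB)

/-- Computable ground instances of premises are instances of members of `S`. -/
theorem premise_instance (hP : Premise gt comp S V P θ C) (hτ : IsSubst τ)
    (hg : Clause.Ground (Clause.subst τ P.clause))
    (hc : Clause.Computable comp (Clause.subst τ P.clause)) :
    Clause.subst τ P.clause ∈ compInstances comp S := by
  obtain ⟨B, hB, ⟨⟨ρ, hρ, rfl⟩, -⟩, -⟩ := hP.variant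
  exact ⟨hg, hc, B, hB, _, hρ.comp hτ, Clause.subst_subst ρ τ B.clause⟩

/-- The conclusion of an inference with suitable premises is true, if it is smaller than one of
them. -/
theorem inference_true (h : SaturatedSet gt comp S) (hR : OrderedGround gt R)
    (hO : OverlapFree R) {Ps : List (AnsClause Sg)} (hinf : Inference gt comp Ps σ (A.subst σ))
    (hτ : IsSubst τ) (hθ : ∀ x, θ x = (σ x).subst τ)
    (hPs : ∀ P ∈ Ps, (∃ B ∈ S, B.Variant P ∧ ¬ Redundant gt S B) ∧
      Clause.Ground (Clause.subst θ P.clause) ∧ Clause.Computable comp (Clause.subst θ P.clause) ∧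
      ∀ D ∈ compInstances comp S, ClauseGt gt (Clause.subst θ P.clause) D → TrueClause R D)
    (hA : Clause.Ground (Clause.subst θ A.clause))
    (hlt : ∃ P ∈ Ps, ClauseGt gt (Clause.subst θ P.clause) (Clause.subst θ A.clause)) :
    TrueClause R (Clause.subst θ A.clause) := by
  have hθ' : θ = fun x => (σ x).subst τ := funext hθ
  have hfin : ((A.subst θ).vars ∪ ⋃ P ∈ {P | P ∈ Ps}, (P.subst θ).vars).Finite :=
    (AnsClause.vars_finite _).union
      (Set.Finite.biUnion (List.finite_toSet Ps) fun P _ => AnsClause.vars_finite _)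
  -- `γ` also grounds the answers, as the definition of redundant inferences requires, and leaves
  -- the ground clauses unchanged.
  obtain ⟨γ, hγ, hV⟩ := exists_grounding h.inhabited hfin
  have key : ∀ B : AnsClause Sg, (B.subst σ).subst (fun x => (τ x).subst γ) =
      (B.subst θ).subst γ := by
    intro B
    rw [← AnsClause.subst_subst, AnsClause.subst_subst σ τ, ← hθ']
  have hcl : ∀ B : AnsClause Sg, Clause.Ground (Clause.subst θ B.clause) →
      ((B.subst θ).subst γ).clause = Clause.subst θ B.clause := fun B hB => hB.subst γ
  have := h.saturated Ps σ _ hinf (fun P hP => (hPs P hP).1) _ (hτ.comp hγ)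
    (fun P hP => by
      rw [key]
      exact AnsClause.ground_subst fun x hx => hV x (.inr (Set.mem_biUnion hP hx)))
    (by
      rw [key]
      exact AnsClause.ground_subst fun x hx => hV x (.inl hx))
  rw [key, hcl A hA] at this
  -- The first alternative fails because the conclusion is smaller than some premise.
  rcases this with h' | h'
  · obtain ⟨P, hP, hPA⟩ := hlt
    have := h' P hP
    rw [key, hcl P (hPs P hP).2.1] at this
    exact absurd this (h.order.clauseGt_asymm hPA)
  · refine trueClause_of_entails h.inhabited h.order hR hO ?_ hA h'
    rintro D ⟨hD, P, hP, hPD⟩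
    rw [key, hcl P (hPs P hP).2.1] at hPD
    have hD' := h.mem_compInstances (hPs P hP).2.1 (hPs P hP).2.2.1 hD hPD
    exact ⟨hD'.1, (hPs P hP).2.2.2 D hD' hPD⟩

/-- Instantiation never removes symbols, so a unifier with a computable instance is computable. This
yields the side conditions on answers. -/
theorem computable_mgu (hP : ∀ x, (θ x).Computable comp) (hθ : ∀ x, θ x = (σ x).subst τ)
    (x : Var Sg) : (σ x).Computable comp := by
  have := hP x
  rw [hθ] at this
  exact (Term.computable_subst_iff.1 this).1

theorem subst_factor (hθ : ∀ x, θ x = (σ x).subst τ) (s : Term Sg) :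
    (s.subst σ).subst τ = s.subst θ := by
  rw [Term.subst_subst]
  exact Term.subst_congr fun x _ => (hθ x).symm

/-- A side condition of the inference rules holds because it holds for a ground instance. -/
theorem not_ge_of_subst (hgt : IsSimplificationOrder gt) (hτ : IsSubst τ)
    (hθ : ∀ x, θ x = (σ x).subst τ) {u v : Term Sg} (h : gt (u.subst θ) (v.subst θ)) :
    ¬ (gt (v.subst σ) (u.subst σ) ∨ v.subst σ = u.subst σ) := by
  rw [← subst_factor hθ, ← subst_factor hθ v] at h
  rintro (h' | h')
  · exact hgt.asymm h (hgt.subst _ _ τ hτ h')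
  · rw [h'] at h
    exact hgt.irrefl _ h

/-- Dropping `s ≉ s` gives a smaller conclusion, which is true by redundancy of the inference. -/
theorem eqRes_true (h : SaturatedSet gt comp S) (hR : OrderedGround gt R) (hO : OverlapFree R)
    (hP : Premise gt comp S V P θ (.neq s s ::ₘ D)) (hD : .neq s s ::ₘ D ∈ compInstances comp S)
    (hlt : ∀ F ∈ compInstances comp S, ClauseGt gt (.neq s s ::ₘ D) F → TrueClause R F)
    (hmax : ∀ K ∈ D, ¬ LitGt gt K (.neq s s)) : TrueClause R (.neq s s ::ₘ D) := by
  have hws := h.ws_premise hP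
  have hans := h.ans_premise hP
  obtain ⟨L, C, hC, hL, hCD⟩ := Clause.subst_eq_cons hP.subst_eq
  obtain ⟨u, v, rfl, hu, hv⟩ := Literal.exists_of_subst_eq hL
  obtain ⟨c, p⟩ := P
  subst hC
  obtain ⟨hwu, hwv, -⟩ := Literal.ws_mk.1 (Clause.ws_cons.1 hws).1
  obtain ⟨σ, hσ⟩ := exists_mgu hwu hwv hP.isSubst (hu.trans hv.symm)
  obtain ⟨τ, hτ, hθ⟩ := hσ.2.2 θ hP.isSubst (hu.trans hv.symm)
  have hinf : Inference gt comp [⟨.neq u v ::ₘ C, p⟩] σ (AnsClause.subst σ ⟨C, p⟩) := by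
    refine .eqRes u v C p σ (selected_of_subst h.order hP.isSubst ?_) hσ ?_
    · rw [hCD]
      intro K hK
      have := hmax K hK
      rwa [← hL] at this
    · exact Prog.computable_subst hans (computable_mgu hP.computable hθ)
  have hgD : Clause.Ground D := Clause.ground_iff.2 fun K hK =>
    Clause.ground_iff.1 hP.ground K (Multiset.mem_cons_of_mem hK)
  have := h.inference_true hR hO hinf hτ hθ (fun P' hP' => ?_) (by simpa only [hCD] using hgD) ?_
  · obtain ⟨K, hK, hKt⟩ := this
    simp only [hCD] at hK
    exact ⟨K, Multiset.mem_cons_of_mem hK, hKt⟩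
  · rw [List.mem_singleton] at hP'
    subst hP'
    have e := hP.subst_eq
    dsimp only [Literal.neq] at e ⊢
    rw [e]
    exact ⟨hP.variant, hP.ground, hD.2.1, hlt⟩
  · refine ⟨_, List.mem_singleton.2 rfl, ?_⟩
    have e := hP.subst_eq
    dsimp only [Literal.neq] at e ⊢
    rw [e, hCD]
    have := BagGt.of_dominated (gt := LitGt gt) (X := {Literal.neq s s}) (Y := 0) (Z := D)
      (by simp) (by simp)
    rwa [add_zero, add_comm, Multiset.singleton_add] at this

/-- Factoring trades `l ≈ s` for the smaller `r ≉ s`. The conclusion is true while `l ≈ r` and `D`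
are false, so `r ≉ s` is what holds. -/
theorem eqFac_true (h : SaturatedSet gt comp S) (hR : OrderedGround gt R) (hO : OverlapFree R)
    (hP : Premise gt comp S V P θ (.eq l r ::ₘ .eq l s ::ₘ D))
    (hD : .eq l r ::ₘ .eq l s ::ₘ D ∈ compInstances comp S)
    (hlt : ∀ F ∈ compInstances comp S, ClauseGt gt (.eq l r ::ₘ .eq l s ::ₘ D) F →
      TrueClause R F)
    (hf : ¬ TrueClause R (.eq l r ::ₘ .eq l s ::ₘ D)) (hlr : gt l r)
    (hmax : ∀ K ∈ (.eq l s ::ₘ D : Clause Sg), ¬ LitGt gt K (.eq l r)) :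
    ¬ Joinable R r s := by
  have hws := h.ws_premise hP
  have hans := h.ans_premise hP
  obtain ⟨L, C₁, hC₁, hL, hCD₁⟩ := Clause.subst_eq_cons hP.subst_eq
  obtain ⟨u, v, rfl, hu, hv⟩ := Literal.exists_of_subst_eq hL
  obtain ⟨L', C, rfl, hL', hCD⟩ := Clause.subst_eq_cons hCD₁
  obtain ⟨u', v', rfl, hu', hv'⟩ := Literal.exists_of_subst_eq hL'
  obtain ⟨c, p⟩ := P
  subst hC₁
  simp only [Clause.ws_cons] at hws
  have huu := hu.trans hu'.symm
  obtain ⟨σ, hσ⟩ := exists_mgu (Literal.ws_mk.1 hws.1).1 (Literal.ws_mk.1 hws.2.1).1 hP.isSubst huu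
  obtain ⟨τ, hτ, hθ⟩ := hσ.2.2 θ hP.isSubst huu
  have hrs : ¬ gt s r := fun hsr =>
    hmax _ (Multiset.mem_cons_self _ _) (IsSimplificationOrder.eq_gt_eq hsr)
  have hinf : Inference gt comp [⟨.eq u v ::ₘ .eq u' v' ::ₘ C, p⟩] σ
      (AnsClause.subst σ ⟨.eq u v ::ₘ .neq v v' ::ₘ C, p⟩) := by
    refine .eqFac u v u' v' C p σ (selected_of_subst h.order hP.isSubst ?_) hσ ?_ ?_ ?_
    · rw [show Clause.subst θ (Literal.eq u' v' ::ₘ C) = _ from hCD₁]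
      intro K hK
      have := hmax K hK
      rwa [← hL] at this
    · exact not_ge_of_subst h.order hτ hθ (by rwa [hu, hv])
    · intro h'
      have := h.order.subst _ _ τ hτ h'
      rw [subst_factor hθ, subst_factor hθ, hv, hv'] at this
      exact hrs this
    · exact Prog.computable_subst hans (computable_mgu hP.computable hθ)
  have hcon : Clause.subst θ (.eq u v ::ₘ .neq v v' ::ₘ C) = .eq l r ::ₘ .neq r s ::ₘ D := by
    rw [Clause.subst_cons, Clause.subst_cons, hCD]
    simp only [Literal.eq, Literal.neq, Literal.subst, Sym2.map_mk, hu, hv, hv']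
  have hgr := Clause.ground_iff.1 hP.ground
  have hglr := Literal.ground_iff.1 (hgr (.eq l r) (by simp))
  have hgls := Literal.ground_iff.1 (hgr (.eq l s) (by simp))
  have hgrr : r.Ground := hglr r (Sym2.mem_mk_right _ _)
  have hgss : s.Ground := hgls s (Sym2.mem_mk_right _ _)
  have hls : gt l s := by
    by_cases e : r = s
    · exact e ▸ hlr
    · exact h.order.trans _ _ _ hlr ((h.order.total r s hgrr hgss e).resolve_right hrs)
  have hgc : Clause.Ground (.eq l r ::ₘ .neq r s ::ₘ D) := by
    refine Clause.ground_iff.2 fun K hK => ?_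
    rcases Multiset.mem_cons.1 hK with rfl | hK
    · exact hgr _ (by simp)
    · rcases Multiset.mem_cons.1 hK with rfl | hK
      · refine Literal.ground_iff.2 fun w hw => ?_
        rcases Literal.mem_mk.1 hw with rfl | rfl <;> assumption
      · exact hgr _ (by simp [hK])
  have := h.inference_true hR hO hinf hτ hθ (fun P' hP' => ?_) (by rw [hcon]; exact hgc) ?_
  · rw [hcon] at this
    simp only [not_trueClause_cons] at hf
    obtain ⟨K, hK, hKt⟩ := this
    rcases Multiset.mem_cons.1 hK with rfl | hK
    · exact absurd hKt hf.1
    · rcases Multiset.mem_cons.1 hK with rfl | hK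
      · exact (trueLit_neg_iff h.order hR).1 hKt
      · exact absurd ⟨K, hK, hKt⟩ hf.2.2
  · rw [List.mem_singleton] at hP'
    subst hP'
    have e := hP.subst_eq
    dsimp only [Literal.eq] at e ⊢
    rw [e]
    exact ⟨hP.variant, hP.ground, hD.2.1, hlt⟩
  · refine ⟨_, List.mem_singleton.2 rfl, ?_⟩
    rw [hcon]
    have e := hP.subst_eq
    dsimp only [Literal.eq] at e ⊢
    rw [e]
    have hdom : LitGt gt (.eq l s) (.neq r s) := by
      refine IsSimplificationOrder.litGt_of_mem (Sym2.mem_mk_left _ _) fun w hw => ?_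
      rcases Literal.mem_mk.1 hw with rfl | rfl <;> assumption
    have := BagGt.of_dominated (gt := LitGt gt) (X := {Literal.eq l s}) (Y := {Literal.neq r s})
      (Z := Literal.eq l r ::ₘ D) (by simp) (by simpa using hdom)
    rw [add_comm _ {Literal.eq l s}, add_comm _ {Literal.neq r s}, Multiset.singleton_add,
      Multiset.singleton_add, Multiset.cons_swap, Multiset.cons_swap (Literal.neq r s)] at this
    exact this

/-- A false clause with a maximal reductive equation meets the conditions for the production of a
rule. -/
theorem false_of_irreducible (h : SaturatedSet gt comp S) (hR : OrderedGround gt R)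
    (hO : OverlapFree R) (hD : .eq l r ::ₘ D ∈ compInstances comp S)
    (hlt : ∀ F ∈ compInstances comp S, ClauseGt gt (.eq l r ::ₘ D) F → TrueClause R F)
    (hf : ¬ TrueClause R (.eq l r ::ₘ D)) (hlr : gt l r)
    (hmax : ∀ K ∈ D, ¬ LitGt gt K (.eq l r)) (hirr : Irreducible R l) :
    StrictlyMaximal gt (.eq l r) D ∧ ¬ TrueClause (R ∪ {(l, r)}) D := by
  obtain ⟨P, θ, hP⟩ := h.exists_premise hR hO hD hlt hf Set.finite_empty
  -- Factoring keeps the right-hand sides of all other equations for `l` apart from `r`; both claims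
  -- rest on this.
  have fac : ∀ s, Literal.eq l s ∈ D → ¬ Joinable R r s := by
    intro s hs
    obtain ⟨D', rfl⟩ := Multiset.exists_cons_of_mem hs
    exact h.eqFac_true hR hO hP hD hlt hf hlr hmax
  have hgr := Clause.ground_iff.1 hP.ground
  have hglr := Literal.ground_iff.1 (hgr (.eq l r) (by simp))
  have hl : l.Ground := hglr l (Sym2.mem_mk_left _ _)
  have hr : r.Ground := hglr r (Sym2.mem_mk_right _ _)
  have hR' : OrderedGround gt (R ∪ {(l, r)}) := by
    refine ⟨?_, ?_, ?_⟩ <;> rintro ρ (hρ | rfl)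
    · exact hR.rule_gt ρ hρ
    · exact hlr
    · exact hR.left_ground ρ hρ
    · exact hl
    · exact hR.right_ground ρ hρ
    · exact hr
  have hsub : R ⊆ R ∪ {(l, r)} := Set.subset_union_left
  have hrestrict : ∀ t, gt l t → ∀ ρ ∈ R ∪ {(l, r)}, ρ.1 = t ∨ gt t ρ.1 → ρ ∈ R := by
    rintro t ht ρ (hρ | rfl) h'
    · exact hρ
    · rcases h' with rfl | h'
      · exact absurd ht (h.order.irrefl _)
      · exact absurd h' (h.order.asymm ht)
  refine ⟨fun K hK h' => ?_, ?_⟩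
  · rcases h' with h' | rfl
    · exact hmax K hK h'
    · exact fac r hK (.refl r)
  · rintro ⟨L, hL, hLt⟩
    have hLg := hgr L (Multiset.mem_cons_of_mem hL)
    have hLf : ¬ TrueLit R L := fun h' => hf ⟨L, Multiset.mem_cons_of_mem hL, h'⟩
    cases hb : L.pos with
    | false => exact hLf (trueLit_anti h.order hR' hsub hb hLt)
    | true =>
      by_cases hlL : l ∈ L.atom
      · obtain ⟨b, a⟩ := L
        obtain ⟨v, rfl⟩ := Sym2.mem_iff_exists.1 hlL
        dsimp only at hb
        subst hb
        have hv : v.Ground := Literal.ground_iff.1 hLg v (Sym2.mem_mk_right _ _)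
        have hne : v ≠ l := by
          rintro rfl
          exact hLf ((trueLit_pos_iff h.order hR).2 (.refl v))
        have hlv : gt l v := (h.order.le_lhs hlr hl hLg (hmax _ hL)
          (Sym2.mem_mk_right _ _)).resolve_left hne
        obtain ⟨w, hlw, hvw⟩ := (trueLit_pos_iff h.order hR').1 hLt
        -- As `l` is irreducible in `R`, its rewriting either is empty, which is impossible since
        -- `v` is smaller than `l`, or begins with the new rule.
        have hrw : Relation.ReflTransGen (Step (R ∪ {(l, r)})) r w := by
          rcases Relation.ReflTransGen.cases_head hlw with rfl | ⟨x, hx, hxw⟩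
          · rcases rtg_le h.order hR' hvw with e | e
            · exact absurd e.symm hne
            · exact absurd e (h.order.asymm hlv)
          · have hxr : x = r := by
              have hroot : ∀ ρ ∈ R ∪ {(l, r)}, ρ.1.Subterm l → ρ ∈ ({(l, r)} : RewriteSystem Sg) := by
                rintro ρ (hρ | hρ) hs
                · obtain ⟨u, hu⟩ := Step.of_subterm hρ hs
                  exact absurd hu (hirr u)
                · exact hρ
              have h₁ := hx.restrict (R := {(l, r)}) hR' hroot
              refine h₁.eq_of_mem (hR'.mono Set.subset_union_right) ?_ rfl
              rintro ρ rfl ρ' rfl -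
              rfl
            exact hxr ▸ hxw
        -- Both `r` and `v` are smaller than `l`, so the new rule takes no part in joining them.
        refine fac v hL (Joinable.restrict h.order hR' hr hv (hrestrict r hlr)
          (hrestrict v hlv) ⟨w, hrw, hvw⟩)
      · refine hLf ((trueLit_agree h.order hR' hsub hLg fun t ht => hrestrict t ?_).2 hLt)
        exact (h.order.le_lhs hlr hl hLg (hmax _ hL) ht).resolve_left fun e => hlL (e ▸ ht)

end SaturatedSet

/-- Every clause of `Q`, after the addition of trivially false smaller literals, is an instance of
`S` or follows from smaller instances of `S`. -/
structure CoveredBy (gt : Term Sg → Term Sg → Prop) (comp : Set Sg.Sym) (S : Set (AnsClause Sg))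
    (Q : Set (Clause Sg)) : Prop where
  ground : ∀ C ∈ Q, Clause.Ground C
  ws : ∀ C ∈ Q, Clause.WS C
  instances : compInstances comp S ⊆ Q
  cover : ∀ C ∈ Q, ∃ U : Clause Sg,
    (∀ L ∈ U, (∃ u : Term Sg, L = .neq u u ∧ u.Ground) ∧ ∃ K ∈ C, LitGt gt K L) ∧
    (C + U ∈ compInstances comp S ∨
      Entails {D | D ∈ compInstances comp S ∧ ClauseGt gt (C + U) D} (C + U))

/-! ### Minimal false instances: superposition and the truth of all instances -/

namespace SaturatedSet

variable {gt : Term Sg → Term Sg → Prop} {comp : Set Sg.Sym} {S : Set (AnsClause Sg)}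
  {Q : Set (Clause Sg)} {R : RewriteSystem Sg} {C D F U : Clause Sg} {A P : AnsClause Sg}
  {θ : Var Sg → Term Sg} {V : Set (Var Sg)} {l r s t : Term Sg} {L : Literal Sg}

theorem false_add (hgt : IsSimplificationOrder gt) (hR : OrderedGround gt R)
    (hU : ∀ L ∈ U, ∃ u : Term Sg, L = .neq u u) (h : TrueClause R (C + U)) : TrueClause R C := by
  obtain ⟨L, hL, hLt⟩ := h
  rcases Multiset.mem_add.1 hL with hL | hL
  · exact ⟨L, hL, hLt⟩
  · obtain ⟨u, rfl⟩ := hU L hL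
    exact absurd (.refl u) ((trueLit_neg_iff hgt hR).1 hLt)

theorem ground_add (hC : Clause.Ground C) (hU : ∀ L ∈ U, ∃ u : Term Sg, L = .neq u u ∧ u.Ground) :
    Clause.Ground (C + U) := by
  refine Clause.ground_iff.2 fun L hL => ?_
  rcases Multiset.mem_add.1 hL with hL | hL
  · exact Clause.ground_iff.1 hC L hL
  · obtain ⟨u, rfl, hu⟩ := hU L hL
    refine Literal.ground_iff.2 fun w hw => ?_
    rcases Literal.mem_mk.1 hw with rfl | rfl <;> exact hu

open Classical in
/-- The substitution of a minimal false instance is irreducible. -/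
theorem irreducible_of_minimal (h : SaturatedSet gt comp S) (hR : OrderedGround gt R)
    (hO : OverlapFree R) (hws : ∀ ρ ∈ R, ρ.2.WS ∧ ρ.2.sort = ρ.1.sort)
    (hP : Premise gt comp S V P θ C) (hC : C ∈ compInstances comp S)
    (hlt : ∀ D ∈ compInstances comp S, ClauseGt gt C D → TrueClause R D)
    (hf : ¬ TrueClause R C) {x : Var Sg} (hx : x ∈ Clause.vars P.clause) :
    Irreducible R (θ x) := by
  intro u hu
  have hsg : Clause.Ground (Clause.subst θ P.clause) := by rw [hP.subst_eq]; exact hP.ground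
  have hsc : Clause.Computable comp (Clause.subst θ P.clause) := by rw [hP.subst_eq]; exact hC.2.1
  have hxg := Clause.ground_subst_iff.1 hsg
  have hug : u.Ground := hu.ground hR (hxg x hx)
  have hgtu : gt (θ x) u := hu.decreases h.order hR
  -- Rewriting the value of `x` gives a smaller instance of the same clause with the same truth
  -- value, against minimality.
  let θ' : Var Sg → Term Sg := Function.update θ x u
  have hθ' : IsSubst θ' := hP.isSubst.update (hu.ws hws (hP.isSubst.1 x).1)
    ((hu.sort fun ρ hρ => (hws ρ hρ).2).trans (hP.isSubst.1 x).2)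
  have hrtg : ∀ y, Relation.ReflTransGen (Step R) (θ y) (θ' y) := by
    intro y
    by_cases hy : y = x
    · subst hy; simpa [θ'] using Relation.ReflTransGen.single hu
    · simpa [θ', hy] using Relation.ReflTransGen.refl
  have hg' : Clause.Ground (Clause.subst θ' P.clause) := by
    refine Clause.ground_subst_iff.2 fun y hy => ?_
    by_cases e : y = x
    · subst e; simpa [θ'] using hug
    · simpa [θ', e] using hxg y hy
  have hc' : Clause.Computable comp (Clause.subst θ' P.clause) := by
    refine Clause.computable_subst_iff.2 ⟨(Clause.computable_subst_iff.1 hsc).1, fun y _ => ?_⟩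
    by_cases e : y = x
    · subst e
      simpa [θ'] using h.order.computable_of_gt h.partitioned (hxg y hx) hug
        (hP.computable y) hgtu
    · simpa [θ', e] using hP.computable y
  have hterm : ∀ w : Term Sg, w.subst θ = w.subst θ' ∨ gt (w.subst θ) (w.subst θ') := fun w =>
    (rtg_le h.order hR (rtg_subst hrtg w)).imp_left Eq.symm
  have hlit : ∀ L : Literal Sg, (∃ w ∈ L.atom, w.subst θ ≠ w.subst θ') →
      LitGt gt (L.subst θ) (L.subst θ') := by
    rintro L ⟨w, hw, hne⟩
    rw [LitGt, Literal.bag_subst, Literal.bag_subst]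
    exact BagGt.map_of_ge (fun w _ => hterm w) ⟨w, Literal.mem_bag.2 hw, hne⟩
  have hCgt : ClauseGt gt C (Clause.subst θ' P.clause) := by
    rw [← hP.subst_eq]
    refine BagGt.map_of_ge (fun L _ => ?_) ?_
    · by_cases e : ∃ w ∈ L.atom, w.subst θ ≠ w.subst θ'
      · exact .inr (hlit L e)
      · push Not at e
        refine .inl (Literal.bag_injective ?_)
        rw [Literal.bag_subst, Literal.bag_subst]
        exact Multiset.map_congr rfl fun w hw => e w (Literal.mem_bag.1 hw)
    -- Strictness comes from a literal in which `x` occurs: its instance really changes.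
    · obtain ⟨L, hL, w, hw, hxw⟩ := hx
      refine ⟨L, hL, fun e => ?_⟩
      have hlt := hlit L ⟨w, hw, fun e' => ?_⟩
      · rw [e] at hlt
        exact h.order.litGt_irrefl _ hlt
      · have := Term.subst_inj e' x hxw
        simp only [θ', Function.update_self] at this
        rw [← this] at hgtu
        exact h.order.irrefl _ hgtu
  obtain ⟨L, hL, hLt⟩ := hlt _ (premise_instance hP hθ' hg' hc') hCgt
  obtain ⟨K, hK, rfl⟩ := Clause.mem_subst.1 hL
  refine hf ⟨K.subst θ, ?_, (trueLit_subst_congr h.order hR hO hrtg).2 hLt⟩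
  rw [← hP.subst_eq]
  exact Clause.mem_subst.2 ⟨K, hK, rfl⟩

theorem produced_ws {hgt : IsSimplificationOrder gt} (hQ : ∀ C ∈ Q, Clause.WS C) :
    ∀ ρ ∈ allProduced hgt Q, ρ.2.WS ∧ ρ.2.sort = ρ.1.sort := by
  rintro ⟨l, r⟩ ⟨C, hC⟩
  have h₁ := hQ C (mem_produced.1 hC).1 _ (eq_mem_of_produced hC)
  obtain ⟨-, hr, hlr⟩ := Literal.ws_mk.1 h₁
  exact ⟨hr, hlr.symm⟩

/-- Every rule is also obtained from an instance of `S` that is minimal among the instances which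
are false below the clause that produces the rule. -/
theorem exists_instance_of_produced (h : SaturatedSet gt comp S) (hQ : CoveredBy gt comp S Q)
    (hlr : (l, r) ∈ produced h.order Q C)
    (ih : ∀ F ∈ compInstances comp S, ClauseGt gt C F →
      TrueClause (producedBelow h.order Q C) F) :
    ∃ F, .eq l r ::ₘ F ∈ compInstances comp S ∧ (∀ K ∈ F, LitGt gt (.eq l r) K) ∧
      ¬ TrueClause (producedBelow h.order Q C) (.eq l r ::ₘ F) ∧
      (∀ D ∈ compInstances comp S, ClauseGt gt (.eq l r ::ₘ F) D →
        TrueClause (producedBelow h.order Q C) D) ∧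
      ¬ TrueClause (producedBelow h.order Q C ∪ {(l, r)}) F := by
  have hR := (orderedGround_all (hgt := h.order) hQ.ground).mono (producedBelow_subset_all (C := C))
  have hO := (overlapFree_all (hgt := h.order) hQ.ground).mono (producedBelow_subset_all (C := C))
  obtain ⟨hCQ, hgtlr, hl, hr, hirr, hCf, C', hCC', hC'⟩ := produced_spec hQ.ground hlr
  obtain ⟨U, hU, hcov⟩ := hQ.cover C hCQ
  have hUlt : ∀ K ∈ C' + U, LitGt gt (.eq l r) K := by
    intro K hK
    rcases Multiset.mem_add.1 hK with hK | hK
    · exact hC' K hK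
    · obtain ⟨-, L, hL, hLK⟩ := hU K hK
      rcases produced_greatest hQ.ground hlr L hL with rfl | hL
      · exact hLK
      · exact IsSimplificationOrder.litGt_trans hL hLK
  have hCU : C + U = .eq l r ::ₘ (C' + U) := by rw [hCC', Multiset.cons_add]
  have hCUf : ¬ TrueClause (producedBelow h.order Q C) (C + U) := fun h' =>
    hCf (false_add h.order hR (fun L hL => (hU L hL).1.imp fun u hu => hu.1) h')
  have hCUg : Clause.Ground (C + U) := ground_add (hQ.ground C hCQ) fun L hL => (hU L hL).1
  -- Either `C + U` is itself such an instance, or it follows from smaller ones, and then one of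
  -- these is false because `C + U` is.
  have hne : ∃ F, F ∈ {F | F ∈ compInstances comp S ∧
      ¬ TrueClause (producedBelow h.order Q C) F ∧ ¬ ClauseGt gt F (C + U)} := by
    rcases hcov with hcov | hcov
    · exact ⟨C + U, hcov, hCUf, h.order.clauseGt_irrefl _⟩
    · by_contra hn
      push Not at hn
      refine hCUf (trueClause_of_entails h.inhabited h.order hR hO ?_ hCUg hcov)
      rintro D ⟨hD, hDlt⟩
      refine ⟨hD.1, ?_⟩
      by_contra hDf
      exact hn D ⟨hD, hDf, h.order.clauseGt_asymm hDlt⟩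
  obtain ⟨F, ⟨hF, hFf, hFle⟩, hmin⟩ := h.order.clauseGt_wf.has_min _ hne
  have hsmall : ∀ D ∈ compInstances comp S, ClauseGt gt F D →
      TrueClause (producedBelow h.order Q C) D := by
    intro D hD hFD
    by_contra hDf
    exact hmin D ⟨hD, hDf, fun h' => hFle (IsSimplificationOrder.clauseGt_trans hFD h')⟩ hFD
  have hglr : (Literal.eq l r).Ground :=
    Clause.ground_iff.1 (hQ.ground C hCQ) _ (eq_mem_of_produced hlr)
  have hle : ∀ K ∈ F, K = .eq l r ∨ LitGt gt (.eq l r) K := by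
    intro K hK
    by_cases e : K = .eq l r
    · exact .inl e
    · refine .inr ((h.order.litGt_total (Clause.ground_iff.1 hF.1 K hK) hglr e).resolve_left ?_)
      intro hlt
      refine hFle (IsSimplificationOrder.clauseGt_of_mem hK fun M hM => ?_)
      rw [hCU] at hM
      rcases Multiset.mem_cons.1 hM with rfl | hM
      · exact hlt
      · exact IsSimplificationOrder.litGt_trans hlt (hUlt M hM)
  -- Without this literal `F` would lie below `C`, where all instances are true.
  have hmem : Literal.eq l r ∈ F := by
    by_contra hn
    refine hFf (ih F hF (IsSimplificationOrder.clauseGt_of_mem (eq_mem_of_produced hlr) ?_))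
    exact fun K hK => (hle K hK).resolve_left fun e => hn (e ▸ hK)
  obtain ⟨F', rfl⟩ := Multiset.exists_cons_of_mem hmem
  -- A second copy would dominate `C' + U` and make the clause greater than `C + U`.
  have hnot : Literal.eq l r ∉ F' := by
    intro hm
    obtain ⟨F'', rfl⟩ := Multiset.exists_cons_of_mem hm
    refine hFle ?_
    rw [hCU, ← Multiset.singleton_add, ← Multiset.singleton_add _ (C' + U)]
    exact BagGt.of_dominated (by simp) fun K hK => ⟨_, Multiset.mem_cons_self _ _, hUlt K hK⟩
  have hlt' : ∀ K ∈ F', LitGt gt (.eq l r) K := fun K hK =>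
    (hle K (Multiset.mem_cons_of_mem hK)).resolve_left fun e => hnot (e ▸ hK)
  exact ⟨F', hF, hlt', hFf, hsmall, (h.false_of_irreducible hR hO hF hsmall hFf hgtlr
    (fun K hK => h.order.litGt_asymm (hlt' K hK)) hirr).2⟩

open Classical in
/-- A minimal false instance has no reducible greatest literal. -/
theorem irreducible_of_greatest (h : SaturatedSet gt comp S) (hQ : CoveredBy gt comp S Q) {b : Bool}
    (hD : .mk' b s t ::ₘ D ∈ compInstances comp S)
    (ih : ∀ F ∈ compInstances comp S, ClauseGt gt (.mk' b s t ::ₘ D) F →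
      TrueClause (producedBelow h.order Q F ∪ produced h.order Q F) F)
    (hlt : ∀ F ∈ compInstances comp S, ClauseGt gt (.mk' b s t ::ₘ D) F →
      TrueClause (producedBelow h.order Q (.mk' b s t ::ₘ D)) F)
    (hf : ¬ TrueClause (producedBelow h.order Q (.mk' b s t ::ₘ D)) (.mk' b s t ::ₘ D))
    (hmax : ∀ K ∈ D, K = .mk' b s t ∨ LitGt gt (.mk' b s t) K) (hst : gt s t) :
    Irreducible (producedBelow h.order Q (.mk' b s t ::ₘ D)) s := by
  set R := producedBelow h.order Q (.mk' b s t ::ₘ D)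
  have hall : R ⊆ allProduced h.order Q := producedBelow_subset_all
  have hR := (orderedGround_all (hgt := h.order) hQ.ground).mono hall
  have hO := (overlapFree_all (hgt := h.order) hQ.ground).mono hall
  have hEq := Joinable.equivalence hR hO
  intro u hu
  obtain ⟨⟨l, r⟩, ⟨K, hDK, hlrK⟩, hsub⟩ := hu.exists_rule hR
  dsimp only at hsub
  have hlrR : (l, r) ∈ R := ⟨K, hDK, hlrK⟩
  have hglits := Clause.ground_iff.1 hD.1
  have hglr : (Literal.eq l r).Ground := Clause.ground_iff.1
    (hQ.ground K (produced_spec hQ.ground hlrK).1) _ (eq_mem_of_produced hlrK)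
  -- Equality of the literals would make the clause true by the rule itself; the reverse inequality
  -- would place the producing clause above it.
  have hlit : LitGt gt (.mk' b s t) (.eq l r) := by
    by_cases e : Literal.mk' b s t = .eq l r
    · refine absurd (trueClause_of_mem h.order hR hlrR ?_) hf
      rw [← e]; exact Multiset.mem_cons_self _ _
    · refine (h.order.litGt_total (hglits _ (Multiset.mem_cons_self _ _)) hglr e).resolve_right ?_
      intro hgt'
      refine h.order.clauseGt_asymm hDK (IsSimplificationOrder.clauseGt_of_mem
        (eq_mem_of_produced hlrK) fun M hM => ?_)
      rcases Multiset.mem_cons.1 hM with rfl | hM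
      · exact hgt'
      · rcases hmax M hM with rfl | hM
        · exact hgt'
        · exact IsSimplificationOrder.litGt_trans hgt' hM
  -- The producing clause `K` need not be an instance of `S`; an instance with the same greatest
  -- literal takes its place as a premise.
  obtain ⟨F, hF, hFlt, hFf, hFsmall, hFf'⟩ := h.exists_instance_of_produced hQ hlrK
    fun E hE hKE => trueClause_persists hQ.ground hE.1 Set.subset_union_left
      (producedBelow_mono hKE) producedBelow_subset_all
      (ih E hE (IsSimplificationOrder.clauseGt_trans hDK hKE))
  have hRK : OrderedGround gt (producedBelow h.order Q K) :=
    (orderedGround_all (hgt := h.order) hQ.ground).mono producedBelow_subset_all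
  have hOK : OverlapFree (producedBelow h.order Q K) :=
    (overlapFree_all (hgt := h.order) hQ.ground).mono producedBelow_subset_all
  have hDF : ClauseGt gt (.mk' b s t ::ₘ D) (.eq l r ::ₘ F) := by
    refine IsSimplificationOrder.clauseGt_of_mem (Multiset.mem_cons_self _ _) fun M hM => ?_
    rcases Multiset.mem_cons.1 hM with rfl | hM
    · exact hlit
    · exact IsSimplificationOrder.litGt_trans hlit (hFlt M hM)
  have hFfR : ¬ TrueClause R F := by
    rintro ⟨M, hM, hMt⟩
    refine hFf' ⟨M, hM, (trueLit_decided hQ.ground hlrK (Clause.ground_iff.1 hF.1 M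
      (Multiset.mem_cons_of_mem hM)) (h.order.litGt_asymm (hFlt M hM)) ?_ hall).2 hMt⟩
    rintro ρ (hρ | rfl)
    · exact producedBelow_mono hDK (.inl hρ)
    · exact hlrR
  obtain ⟨P, θ₁, hP⟩ := h.exists_premise hR hO hD hlt hf Set.finite_empty
  obtain ⟨P', θ₂, hP'⟩ := h.exists_premise hRK hOK hF hFsmall hFf P.vars_finite
  have hvarirr : ∀ x ∈ Clause.vars P.clause, Irreducible R (θ₁ x) := fun x hx =>
    h.irreducible_of_minimal hR hO (fun ρ hρ => produced_ws hQ.ws ρ (hall hρ)) hP hD hlt hf hx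
  -- The premises share no variables, so their substitutions merge into one.
  let θ : Var Sg → Term Sg := fun x => if x ∈ P'.vars then θ₂ x else θ₁ x
  have hθ : IsSubst θ := hP'.isSubst.piecewise hP.isSubst _
  have hθ₁ : ∀ x ∈ P.vars, θ x = θ₁ x := fun x hx =>
    if_neg (Set.disjoint_right.1 hP'.disjoint hx)
  have hθ₂ : ∀ x ∈ P'.vars, θ x = θ₂ x := fun x hx => if_pos hx
  have hθc : ∀ x, (θ x).Computable comp := by
    intro x
    by_cases hx : x ∈ P'.vars
    · rw [hθ₂ x hx]; exact hP'.computable x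
    · rw [show θ x = θ₁ x from if_neg hx]; exact hP.computable x
  have hPD : Clause.subst θ P.clause = .mk' b s t ::ₘ D := by
    rw [← hP.subst_eq]
    exact Clause.subst_congr fun x hx => hθ₁ x (.inl hx)
  have hPF : Clause.subst θ P'.clause = .eq l r ::ₘ F := by
    rw [← hP'.subst_eq]
    exact Clause.subst_congr fun x hx => hθ₂ x (.inl hx)
  have hws := h.ws_premise hP
  have hans := h.ans_premise hP
  have hws' := h.ws_premise hP'
  have hans' := h.ans_premise hP'
  obtain ⟨M, D₀, hD₀, hM, hDD⟩ := Clause.subst_eq_cons hPD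
  obtain ⟨s₀, t₀, rfl, hs₀, ht₀⟩ := Literal.exists_of_subst_eq hM
  obtain ⟨M', F₀, hF₀, hM', hFF⟩ := Clause.subst_eq_cons hPF
  obtain ⟨l₀, r₀, rfl, hl₀, hr₀⟩ := Literal.exists_of_subst_eq hM'
  obtain ⟨c, q⟩ := P
  obtain ⟨c', p⟩ := P'
  subst hD₀ hF₀
  have hsub' := hsub
  rw [← hs₀] at hsub'
  -- A redex inside the value of a variable is excluded by minimality; what is left is an overlap at
  -- a non-variable position.
  rcases Term.Subterm.of_subst hsub' with ⟨l', hl', hnv, hll⟩ | ⟨x, hx, hlx⟩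
  swap
  · have hx' : x ∈ Clause.vars (⟨b, s(s₀, t₀)⟩ ::ₘ D₀) :=
      ⟨_, Multiset.mem_cons_self _ _, s₀, Sym2.mem_mk_left _ _, hx⟩
    rw [hθ₁ x (.inl hx')] at hlx
    obtain ⟨w, hw⟩ := Step.of_subterm hlrR hlx
    exact hvarirr x hx' w hw
  have huni : l₀.subst θ = l'.subst θ := hl₀.trans hll.symm
  have hwl₀ := Literal.ws_mk.1 (Clause.ws_cons.1 hws').1
  have hws₀ := Literal.ws_mk.1 (Clause.ws_cons.1 hws).1
  obtain ⟨σ, hσ⟩ := exists_mgu hwl₀.1 (hl'.ws hws₀.1) hθ huni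
  obtain ⟨τ, hτ, hfac⟩ := hσ.2.2 θ hθ huni
  have hgtlr : gt l r := (produced_spec hQ.ground hlrK).2.1
  have hinf : Inference gt comp [⟨.eq l₀ r₀ ::ₘ F₀, p⟩, ⟨.mk' b s₀ t₀ ::ₘ D₀, q⟩] σ
      (AnsClause.subst σ ⟨.mk' b (s₀.replace l' r₀) t₀ ::ₘ (F₀ + D₀), .ite s(l₀, r₀) q p⟩) := by
    refine .supC l₀ r₀ s₀ t₀ l' b F₀ D₀ p q σ hP'.disjoint ?_ ?_ hl' hσ hnv ?_ ?_ ?_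
    · refine selected_of_subst h.order hθ ?_
      rw [hFF, show (Literal.eq l₀ r₀).subst θ = _ from hM']
      exact fun K hK => h.order.litGt_asymm (hFlt K hK)
    · refine selected_of_subst h.order hθ ?_
      rw [hDD, show (Literal.mk' b s₀ t₀).subst θ = _ from hM]
      intro K hK
      rcases hmax K hK with rfl | hK
      · exact h.order.litGt_irrefl _
      · exact h.order.litGt_asymm hK
    · exact not_ge_of_subst h.order hτ hfac (by rwa [hl₀, hr₀])
    · exact not_ge_of_subst h.order hτ hfac (by rwa [hs₀, ht₀])
    · have hσc := computable_mgu hθc hfac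
      refine Prog.computable_subst ⟨fun w hw => ?_, hans, hans'⟩ hσc
      have hlc : Literal.Computable comp (.eq l₀ r₀) := by
        have := hF.2.1 (.eq l r) (Multiset.mem_cons_self _ _)
        rw [← show (Literal.eq l₀ r₀).subst θ = _ from hM'] at this
        exact (Literal.computable_subst_iff.1 this).1
      exact hlc w hw
  set s' := (s₀.replace l' r₀).subst θ with hs'
  have hcon : Clause.subst θ (.mk' b (s₀.replace l' r₀) t₀ ::ₘ (F₀ + D₀)) =
      .mk' b s' t ::ₘ (F + D) := by
    rw [Clause.subst_cons, Clause.subst_add, hFF, hDD]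
    simp only [Literal.mk', Literal.subst, Sym2.map_mk, ht₀, ← hs']
  -- All occurrences of `l'` are replaced at once, hence possibly several rewrite steps.
  have hrtg : Relation.ReflTransGen (Step R) s s' := by
    rw [← hs₀]
    refine rtg_replace ?_
    rw [hll, hr₀]
    exact .single (.of_mem hlrR)
  have hss' : gt s s' := by
    refine (rtg_le h.order hR hrtg).resolve_left ?_
    rw [← hs₀]
    refine Term.replace_subst_ne hl' ?_
    rw [hll, hr₀]
    rintro rfl
    exact h.order.irrefl _ hgtlr
  have hsg : s.Ground := Literal.ground_iff.1 (hglits _ (Multiset.mem_cons_self _ _)) s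
    (Sym2.mem_mk_left _ _)
  have htg : t.Ground := Literal.ground_iff.1 (hglits _ (Multiset.mem_cons_self _ _)) t
    (Sym2.mem_mk_right _ _)
  have hs'g : s'.Ground := by
    clear_value s'
    clear hss' hcon hs'
    induction hrtg with
    | refl => exact hsg
    | tail _ h₁ ih => exact h₁.ground hR ih
  have hcong : Clause.Ground (.mk' b s' t ::ₘ (F + D)) := by
    refine Clause.ground_iff.2 fun N hN => ?_
    rcases Multiset.mem_cons.1 hN with rfl | hN
    · refine Literal.ground_iff.2 fun w hw => ?_
      rcases Literal.mem_mk.1 hw with rfl | rfl <;> assumption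
    · rcases Multiset.mem_add.1 hN with hN | hN
      · exact Clause.ground_iff.1 hF.1 N (Multiset.mem_cons_of_mem hN)
      · exact hglits N (Multiset.mem_cons_of_mem hN)
  have htrue := h.inference_true hR hO hinf hτ hfac (fun B hB => ?_)
    (by rw [hcon]; exact hcong) ⟨_, List.mem_cons_of_mem _ List.mem_cons_self, ?_⟩
  · rw [hcon] at htrue
    obtain ⟨N, hN, hNt⟩ := htrue
    rcases Multiset.mem_cons.1 hN with rfl | hN
    -- Since `s` rewrites to `s'`, truth of the new literal is truth of the old one.
    · refine hf ⟨.mk' b s t, Multiset.mem_cons_self _ _, ?_⟩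
      have hj : Joinable R s t ↔ Joinable R s' t :=
        ⟨fun h' => hEq.trans (hEq.symm (.of_rtg hrtg)) h', fun h' => hEq.trans (.of_rtg hrtg) h'⟩
      cases b
      · exact (trueLit_neg_iff h.order hR).2
          fun h' => (trueLit_neg_iff h.order hR).1 hNt (hj.1 h')
      · exact (trueLit_pos_iff h.order hR).2 (hj.2 ((trueLit_pos_iff h.order hR).1 hNt))
    · rcases Multiset.mem_add.1 hN with hN | hN
      · exact hFfR ⟨N, hN, hNt⟩
      · exact hf ⟨N, Multiset.mem_cons_of_mem hN, hNt⟩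
  · rcases List.mem_cons.1 hB with rfl | hB
    · refine ⟨hP'.variant, ?_⟩
      rw [show Clause.subst θ (Literal.eq l₀ r₀ ::ₘ F₀) = _ from hPF]
      exact ⟨hF.1, hF.2.1, fun E hE hFE =>
        hlt E hE (IsSimplificationOrder.clauseGt_trans hDF hFE)⟩
    · rw [List.mem_singleton] at hB
      subst hB
      refine ⟨hP.variant, ?_⟩
      rw [show Clause.subst θ (Literal.mk' b s₀ t₀ ::ₘ D₀) = _ from hPD]
      exact ⟨hD.1, hD.2.1, hlt⟩
  · rw [hcon, show Clause.subst θ (Literal.mk' b s₀ t₀ ::ₘ D₀) = _ from hPD]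
    have := BagGt.of_dominated (gt := LitGt gt) (X := {Literal.mk' b s t})
      (Y := Literal.mk' b s' t ::ₘ F) (Z := D) (by simp) fun N hN => ⟨_, Multiset.mem_singleton_self _, ?_⟩
    · rwa [add_comm D, add_comm D, Multiset.singleton_add, Multiset.cons_add] at this
    · rcases Multiset.mem_cons.1 hN with rfl | hN
      · exact IsSimplificationOrder.mk_gt_mk hss'
      · exact IsSimplificationOrder.litGt_trans hlit (hFlt N hN)

/-- Every computable ground instance of a saturated set is true after the production of rules up to
that instance. -/
theorem instance_true (h : SaturatedSet gt comp S) (hQ : CoveredBy gt comp S Q)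
    (hC : C ∈ compInstances comp S) :
    TrueClause (producedBelow h.order Q C ∪ produced h.order Q C) C := by
  induction C using h.order.clauseGt_wf.induction with | _ C ih
  by_contra hCf
  have ih' : ∀ F ∈ compInstances comp S, ClauseGt gt C F →
      TrueClause (producedBelow h.order Q F ∪ produced h.order Q F) F := fun F hF hCF => ih F hCF hF
  have hall : producedBelow h.order Q C ⊆ allProduced h.order Q := producedBelow_subset_all
  have hR := (orderedGround_all (hgt := h.order) hQ.ground).mono hall
  have hO := (overlapFree_all (hgt := h.order) hQ.ground).mono hall
  have hf : ¬ TrueClause (producedBelow h.order Q C) C := fun h' =>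
    hCf (trueClause_persists hQ.ground hC.1 subset_rfl Set.subset_union_left
      (Set.union_subset hall produced_subset_all) h')
  have hlt : ∀ F ∈ compInstances comp S, ClauseGt gt C F →
      TrueClause (producedBelow h.order Q C) F := fun F hF hCF =>
    trueClause_persists hQ.ground hF.1 Set.subset_union_left (producedBelow_mono hCF) hall
      (ih' F hF hCF)
  obtain ⟨P, θ, hP⟩ := h.exists_premise hR hO hC hlt hf Set.finite_empty
  -- An empty instance comes from an empty clause of `S`, and its answer is always computable.
  have hne : C ≠ 0 := by
    rintro rfl
    obtain ⟨B, hB, ⟨⟨ρ, hρ, rfl⟩, -⟩, -⟩ := hP.variant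
    have he := hP.subst_eq
    simp only [AnsClause.subst, Clause.subst, Multiset.map_eq_zero] at he
    obtain ⟨c, p⟩ := B
    dsimp only at he
    subst he
    exact h.nonempty p (h.ans _ hB) hB
  obtain ⟨⟨b, a⟩, D, rfl, hmax⟩ := h.order.exists_maximal hC.1 hne
  have hmax' : ∀ K ∈ D, ¬ LitGt gt K ⟨b, a⟩ := by
    intro K hK
    rcases hmax K hK with rfl | hK
    · exact h.order.litGt_irrefl _
    · exact h.order.litGt_asymm hK
  have hag := Literal.ground_iff.1 (Clause.ground_iff.1 hC.1 _ (Multiset.mem_cons_self _ _))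
  have hpair : ∃ s t, a = s(s, t) ∧ (s = t ∨ gt s t) := by
    induction a using Sym2.ind with | _ s t
    by_cases e : s = t
    · exact ⟨s, t, rfl, .inl e⟩
    · rcases h.order.total s t (hag s (Sym2.mem_mk_left _ _)) (hag t (Sym2.mem_mk_right _ _)) e
        with h' | h'
      · exact ⟨s, t, rfl, .inr h'⟩
      · exact ⟨t, s, Sym2.eq_swap, .inr h'⟩
  obtain ⟨s, t, rfl, hst⟩ := hpair
  have hLf := (not_trueClause_cons.1 hf).1
  rcases hst with rfl | hst
  · cases b
    · exact hf (h.eqRes_true hR hO hP hC hlt hmax')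
    · exact hLf ((trueLit_pos_iff h.order hR).2 (.refl s))
  · have hirr := h.irreducible_of_greatest hQ (b := b) hC ih' hlt hf hmax hst
    cases b
    -- A false disequation has joinable sides, but `s` is irreducible and the smaller `t` cannot
    -- rewrite to it.
    · rw [trueLit_neg_iff h.order hR, not_not] at hLf
      obtain ⟨w, hsw, htw⟩ := hLf
      rcases Relation.ReflTransGen.cases_head hsw with rfl | ⟨x, hx, -⟩
      · rcases rtg_le h.order hR htw with rfl | e
        · exact h.order.irrefl _ hst
        · exact h.order.asymm hst e
      · exact hirr x hx
    -- All conditions for production now hold, so the clause is made true by its own rule.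
    · obtain ⟨h₁, h₂⟩ := h.false_of_irreducible hR hO hC hlt hf hst hmax' hirr
      have hprod : (s, t) ∈ produced h.order Q (⟨true, s(s, t)⟩ ::ₘ D) :=
        mem_produced.2 ⟨hQ.instances hC, D, rfl, hf, h₁, hst, h₂, hirr⟩
      refine hCf (trueClause_of_mem h.order ((orderedGround_all (hgt := h.order) hQ.ground).mono
        (Set.union_subset hall produced_subset_all)) (.inr hprod) (Multiset.mem_cons_self _ _))

/-- All clauses of a covered set are true in the interpretation that it defines. -/
theorem covered_true (h : SaturatedSet gt comp S) (hQ : CoveredBy gt comp S Q) (hC : C ∈ Q) :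
    TrueClause (allProduced h.order Q) C := by
  have hR := orderedGround_all (hgt := h.order) hQ.ground
  have hO := overlapFree_all (hgt := h.order) hQ.ground
  have hinst : ∀ D ∈ compInstances comp S, TrueClause (allProduced h.order Q) D := fun D hD =>
    trueClause_persists hQ.ground hD.1 Set.subset_union_left
      (Set.union_subset producedBelow_subset_all produced_subset_all) subset_rfl
      (h.instance_true hQ hD)
  obtain ⟨U, hU, hcov⟩ := hQ.cover C hC
  refine false_add h.order hR (fun L hL => (hU L hL).1.imp fun u hu => hu.1) (U := U) ?_
  rcases hcov with hcov | hcov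
  · exact hinst _ hcov
  · exact trueClause_of_entails h.inhabited h.order hR hO (fun D hD => ⟨hD.1.1, hinst D hD.1⟩)
      (ground_add (hQ.ground C hC) fun L hL => (hU L hL).1) hcov

end SaturatedSet

/-! ### The computable grounding of a saturated set -/

section Final

variable {Λ : Specification Sg} {N : ClausalForm Λ} {gt : Term Sg → Term Sg → Prop}
  {S : Set (AnsClause Sg)}

theorem initial_ws (N : ClausalForm Λ) : ∀ A ∈ N.initial, Clause.WS A.clause := by
  rintro _ ⟨C, hC, rfl⟩
  exact N.ws C hC

theorem saturatedSet_of_saturatedFrom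
    (inhabited : ∀ a : Sg.Srt, ∃ t : Term Sg, t.WS ∧ t.sort = a ∧ t.Ground)
    (hgt : IsSimplificationOrder gt) (hpart : IsPartitioned Λ.comp gt)
    (hS : SaturatedFrom gt Λ.comp N.initial S)
    (hempty : ∀ p : Prog Sg, p.Computable Λ.comp → (⟨0, p⟩ : AnsClause Sg) ∉ S) :
    SaturatedSet gt Λ.comp S where
  inhabited := inhabited
  order := hgt
  partitioned := hpart
  ws A hA := (hS.derivable A hA).ws (initial_ws N)
  ans A hA := by
    refine (hS.derivable A hA).ans_computable ?_
    rintro _ ⟨C, -, rfl⟩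
    exact Term.computable_var _ _
  saturated := hS.saturated
  nonempty := hempty

/-- The clauses from normal forms are instances of initial clauses; `U` consists of the instantiated
abstraction literals, and is empty for instances of `S`. -/
theorem coveredBy_cgr (h : SaturatedSet gt Λ.comp S) (hS : SaturatedFrom gt Λ.comp N.initial S) :
    CoveredBy gt Λ.comp S (clausesOf (CGr N S)) where
  ground C hC := (clausesOf_cgr hC).1
  ws C hC := by
    obtain ⟨-, -, ⟨C', hC', θ, hθ, rfl⟩ | ⟨A, hA, θ, hθ, rfl⟩⟩ := clausesOf_cgr hC
    · exact (N.ws C' hC').subst hθ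
    · exact (h.ws A hA).subst hθ
  instances := by
    rintro _ ⟨hg, hc, A, hA, θ, hθ, rfl⟩
    exact mem_clausesOf_cgr hA hθ hg hc
  cover C hC := by
    obtain ⟨hg, hc, ⟨C', hC', θ, hθ, rfl⟩ | ⟨A, hA, θ, hθ, rfl⟩⟩ := clausesOf_cgr hC
    · have hA : (⟨C', .term (.var Λ.y)⟩ : AnsClause Sg) ∈ N.initial := ⟨C', hC', rfl⟩
      obtain ⟨B, hAB, hB⟩ := hS.covers _ hA
      obtain ⟨-, θ', hθ', U, e, hU⟩ := exists_abs_instance h.order hAB (initial_ws N _ hA) hθ hg hc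
      dsimp only at e hU
      have hgU : Clause.Ground (Clause.subst θ' B.clause) := by
        rw [e]
        exact SaturatedSet.ground_add hg fun L hL => (hU L hL).1.imp fun u hu => ⟨hu.1, hu.2.1⟩
      have hcU : Clause.Computable Λ.comp (Clause.subst θ' B.clause) := by
        rw [e]
        intro L hL
        rcases Multiset.mem_add.1 hL with hL | hL
        · exact hc L hL
        · obtain ⟨⟨u, rfl, -, hu⟩, -⟩ := hU L hL
          intro w hw
          rcases Literal.mem_mk.1 hw with rfl | rfl <;> exact hu
      refine ⟨U, fun L hL => ⟨(hU L hL).1.imp fun u hu => ⟨hu.1, hu.2.1⟩, (hU L hL).2⟩, ?_⟩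
      rw [← e]
      rcases hB with ⟨B', hB', -, ρ, hρ, rfl⟩ | hB
      · exact .inl ⟨hgU, hcU, B', hB', _, hρ.comp hθ', Clause.subst_subst ρ θ' B'.clause⟩
      · exact .inr (h.entails_compInstances hB hθ' hgU hcU)
    · exact ⟨0, by simp, .inl (by rw [add_zero]; exact ⟨hg, hc, A, hA, θ, hθ, rfl⟩)⟩

end Final
end Synth

theorem mainTheorem3 (Sg : Synth.Signature)
    (inhabited : ∀ a : Sg.Srt, ∃ t : Synth.Term Sg, t.WS ∧ t.sort = a ∧ t.Ground)
    (Λ : Synth.Specification Sg) (N : Synth.ClausalForm Λ)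
    (gt : Synth.Term Sg → Synth.Term Sg → Prop)
    (hgt : Synth.IsSimplificationOrder gt) (hpart : Synth.IsPartitioned Λ.comp gt)
    (S : Set (Synth.AnsClause Sg))
    (hS : Synth.SaturatedFrom gt Λ.comp N.initial S)
    (hempty : ∀ p : Synth.Prog Sg, p.Computable Λ.comp → (⟨0, p⟩ : Synth.AnsClause Sg) ∉ S) :
    (∃! E : Synth.CGr N S → Synth.RewriteSystem Sg,
      Synth.IsModelConstruction gt Λ.comp (Synth.CGr N S) E) ∧
    ∀ E : Synth.CGr N S → Synth.RewriteSystem Sg,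
      Synth.IsModelConstruction gt Λ.comp (Synth.CGr N S) E →
      ∀ K ∈ Synth.CGr N S, Synth.TrueCClause (Synth.total E) K := by
  have hiff := fun E => Synth.isModelConstruction_iff (E := E) hgt
    fun K (hK : K ∈ Synth.CGr N S) => Synth.cgr_spec hK
  refine ⟨⟨Synth.construction hgt _, (hiff _).2 rfl, fun E hE => (hiff E).1 hE⟩, ?_⟩
  rintro E hE K hK
  rw [(hiff E).1 hE, Synth.total_construction]
  have h := Synth.saturatedSet_of_saturatedFrom inhabited hgt hpart hS hempty
  -- The clause part alone is already true, because it occurs in the grounding with the empty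
  -- condition.
  exact .inl (h.covered_true (Synth.coveredBy_cgr h hS) (Synth.cgr_spec hK).2.2)
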